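/- Let $B$ be the open unit disk in $\mathbb{R}^2$ centred at the origin and $r=|x|$. Let $f:[0,\infty)\to(0,\infty)$ be a $C^1$, convex, non-decreasing function with $\int_0^\infty \frac{ds}{f(s)}<\infty$. Let $\varphi,\psi:[0,1]\to[0,\infty)$ be non-increasing and Lipschitz continuous with $\varphi(0)=\psi(0)=1$ and $\varphi>0$ on $[0,1)$, and assume that $\int_0^1 M(s)\,ds<\infty$, where $M(s)=\max_{0\le r\le s}\frac{\psi(r)}{\varphi(r)}$ for $0\le s<1$. For $\alpha,\lambda>0$ consider classical solutions $u\in C^2(B)\cap C(\overline B)$ of $$-\Delta u-\alpha r\varphi(r)\frac{\partial u}{\partial r}=\lambda\,\psi(r) f(u)\ \text{ in } B,\qquad u>0\ \text{ in } B,\qquad u=0\ \text{ on }\partial B. \tag{P}$$ Let $\lambda^*(\alpha)$ be the supremum of all $\lambda>0$ for which (P) has a classical solution, let $u_{\lambda,\alpha}$ be the minimal (smallest) classical solution of (P) for $0<\lambda<\lambda^*(\alpha)$, and let $u^*_\alpha(x)=\lim_{\lambda\uparrow\lambda^*(\alpha)}u_{\lambda,\alpha}(x)$, $x\in\overline B$,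 be the extremal solution. Then for every $\alpha>0$ these objects are well defined ($0<\lambda^*(\alpha)<\infty$, the minimal solutions exist, and the limit exists and is finite), $u^*_\alpha$ is a classical solution of (P) with $\lambda=\lambda^*(\alpha)$, and, as $\alpha\to\infty$: (i) $u^*_\alpha(x)\to 0$ for every $x\in B\setminus\{0\}$, and $u^*_\alpha(0)\to\infty$; (ii) $\displaystyle\int_B u^*_\alpha(x)\,dx\to 0$ and $\displaystyle\int_B \psi(|x|)\,f(u^*_\alpha(x))\,dx\to f(0)\int_B\psi(|x|)\,dx$. -/

import Mathlib

open Set Filter Topology MeasureTheory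

/-- The Euclidean plane. -/
abbrev Plane : Type := EuclideanSpace ℝ (Fin 2)

/-- `M(s) = max_{0 ≤ r ≤ s} ψ(r) / φ(r)`.  It is only used for `0 < s < 1`, where the quotient is
continuous on `[0, s]` (as `φ > 0` on `[0, 1)`) and the supremum is a maximum. -/
noncomputable def maxRatio (φ ψ : ℝ → ℝ) (s : ℝ) : ℝ :=
  sSup ((fun r => ψ r / φ r) '' Icc 0 s)

/-- `u` is a classical solution, in `C²(B) ∩ C(closure B)`, of
`-Δu - α r φ(r) ∂u/∂r = lam ψ(r) f(u)` and `u > 0` in the open unit disk `B`, `u = 0` on `∂B`.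
Here `r = ‖x‖`, and `r ∂u/∂r` at `x` is the derivative of `u` at `x` in the direction `x`. -/
structure IsClassicalSolution (f φ ψ : ℝ → ℝ) (α lam : ℝ) (u : Plane → ℝ) : Prop where
  contDiffOn : ContDiffOn ℝ 2 u (Metric.ball 0 1)
  continuousOn : ContinuousOn u (Metric.closedBall 0 1)
  equation : ∀ x ∈ Metric.ball (0 : Plane) 1,
    -(Laplacian.laplacian u : Plane → ℝ) x - α * φ ‖x‖ * fderiv ℝ u x x = lam * ψ ‖x‖ * f (u x)
  pos : ∀ x ∈ Metric.ball (0 : Plane) 1, 0 < u x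
  boundary : ∀ x ∈ Metric.sphere (0 : Plane) 1, u x = 0

/-- `u` is the minimal (smallest) classical solution for the parameters `α` and `lam`. -/
structure IsMinimalSolution (f φ ψ : ℝ → ℝ) (α lam : ℝ) (u : Plane → ℝ) : Prop where
  isSolution : IsClassicalSolution f φ ψ α lam u
  le_of_isSolution : ∀ w : Plane → ℝ, IsClassicalSolution f φ ψ α lam w →
    ∀ x ∈ Metric.closedBall (0 : Plane) 1, u x ≤ w x

/-- `lamStar` is the extremal parameter `λ*(α)`: the least upper bound in `ℝ` of the set of all
`lam > 0` for which a classical solution exists.  (In particular that set is non-empty and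
bounded above.) -/
def IsExtremalParameter (f φ ψ : ℝ → ℝ) (α lamStar : ℝ) : Prop :=
  IsLUB {lam : ℝ | 0 < lam ∧ ∃ u : Plane → ℝ, IsClassicalSolution f φ ψ α lam u} lamStar

/-- `u` is, on the closed unit disk, the pointwise limit as `lam ↑ λ*(α)` of the minimal
solutions for the parameters `lam`, where `lamStar = λ*(α)`. -/
def IsExtremalSolution (f φ ψ : ℝ → ℝ) (α lamStar : ℝ) (u : Plane → ℝ) : Prop :=
  IsExtremalParameter f φ ψ α lamStar ∧
    ∃ v : ℝ → Plane → ℝ,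
      (∀ lam ∈ Ioo 0 lamStar, IsMinimalSolution f φ ψ α lam (v lam)) ∧
      ∀ x ∈ Metric.closedBall (0 : Plane) 1,
        Tendsto (fun lam => v lam x) (𝓝[<] lamStar) (𝓝 (u x))

/-! With $A(r)=\exp(\alpha\int_0^r s\varphi(s)\,ds)$ the radial equation reads $-(rAu')'=\lambda
rA\psi f(u)$, so a radial solution is a fixed point of the order-preserving integral operator `pot`
applied to `source`. Monotone iteration from `0`, compared in the disk with an arbitrary, possibly
nonradial, solution, shows that minimal solutions are radial. Everything then concerns profiles on
$[0,1]$.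

Write $F(s)=\int_0^s dt/f$ (`timeMap`) and let $p$ be the potential of $\psi$. As $u$ decreases,
$\lambda(p(0)-p(r))\le F(u(0))-F(u(r))$ (`IsRadialSolution.le_timeMap_sub`); in particular $\lambda
p(0)<F(\infty)$, which bounds $\lambda^*$. Regularity of the extremal solution is two-dimensional: a
Riccati inequality for the difference of two ordered solutions bounds the weighted mass of
$\lambda\psi f'(u)$ on $[0,t]$ by $A(b)/\log(b/t)$ (`IsRadialSolution.mass_deriv_le`). Its smallness
near the origin gives a bound for $u(0)$ uniform in $\lambda$ (`RadialData.exists_apply_zero_le`),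
and the limit solves the equation.

For large $\alpha$, the product $\alpha p(0)$ is comparable to $\log\alpha$, so
$\lambda^*/\alpha\to0$ while $\lambda^*\ge c\,\alpha/\log\alpha$. The supersolution
$F^{-1}(\varepsilon+(1+\varepsilon)\lambda p)$ shows that the upper bound on $\lambda^*$ is
asymptotically sharp, which forces $u^*(0)\to\infty$. Between $0$ and $\alpha^{-1/4}$ the quantity
$F(u^*)$ drops by a fixed amount, so $u^*$ is bounded for $r\ge\alpha^{-1/4}$; its flux at a fixed
radius is then exponentially small plus $O(\lambda^*/\alpha)$, whence $u^*\to0$ away from the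
origin. Finally, convexity and integrability of $1/f$ make $f$ grow faster than $s\log s$, and this
excludes concentration of $f(u^*)$ in the disk of radius $\alpha^{-1/4}$
(`IsExtremalFamily.tendsto_integral_inner`). -/

lemma le_of_hasDerivAt_nonneg {F F' : ℝ → ℝ} {a b : ℝ} (hab : a ≤ b)
    (hc : ContinuousOn F (Icc a b)) (hd : ∀ t ∈ Ioo a b, HasDerivAt F (F' t) t)
    (h0 : ∀ t ∈ Ioo a b, 0 ≤ F' t) : F a ≤ F b := by
  have hm : MonotoneOn F (Icc a b) := by
    apply monotoneOn_of_deriv_nonneg (convex_Icc a b) hc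
    · rw [interior_Icc]
      exact fun t ht => (hd t ht).differentiableAt.differentiableWithinAt
    · rw [interior_Icc]
      intro t ht
      rw [(hd t ht).deriv]
      exact h0 t ht
  exact hm (left_mem_Icc.2 hab) (right_mem_Icc.2 hab) hab

/-- The weight `A(r) = exp (α ∫₀ʳ s φ(s) ds)` which turns the radial operator into divergence
form. -/
noncomputable def weight (φ : ℝ → ℝ) (α r : ℝ) : ℝ := Real.exp (α * ∫ s in (0 : ℝ)..r, s * φ s)

/-- The weighted mass `∫₀ᵗ s A(s) g(s) ds`. -/
noncomputable def mass (φ : ℝ → ℝ) (α : ℝ) (g : ℝ → ℝ) (t : ℝ) : ℝ :=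
  ∫ s in (0 : ℝ)..t, s * weight φ α s * g s

/-- Minus the radial derivative of the potential of `g`. -/
noncomputable def flux (φ : ℝ → ℝ) (α : ℝ) (g : ℝ → ℝ) (t : ℝ) : ℝ :=
  mass φ α g t / (t * weight φ α t)

/-- The radial solution of the linear Dirichlet problem with right-hand side `g`. -/
noncomputable def pot (φ : ℝ → ℝ) (α : ℝ) (g : ℝ → ℝ) (r : ℝ) : ℝ :=
  ∫ t in r..(1 : ℝ), flux φ α g t

/-- The quotient `flux t / t`, continuously extended to `t = 0`. -/
noncomputable def fluxQuot (φ : ℝ → ℝ) (α : ℝ) (g : ℝ → ℝ) (t : ℝ) : ℝ :=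
  (∫ s in (0 : ℝ)..1, s * weight φ α (t * s) * g (t * s)) / weight φ α t

/-! ### The linear radial problem in divergence form. -/

section linear

variable {φ g h : ℝ → ℝ} {α : ℝ}

lemma weight_pos (r : ℝ) : 0 < weight φ α r := Real.exp_pos _

lemma weight_zero : weight φ α 0 = 1 := by simp [weight]

lemma hasDerivAt_weight (hφ : Continuous φ) (r : ℝ) :
    HasDerivAt (weight φ α) (α * r * φ r * weight φ α r) r := by
  have h1 : HasDerivAt (fun u => ∫ s in (0 : ℝ)..u, s * φ s) (r * φ r) r :=
    (Continuous.integral_hasStrictDerivAt (by fun_prop) 0 r).hasDerivAt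
  have h2 := (h1.const_mul α).exp
  exact h2.congr_deriv (by rw [weight]; ring)

lemma continuous_weight (hφ : Continuous φ) : Continuous (weight φ α) :=
  continuous_iff_continuousAt.2 fun r => (hasDerivAt_weight hφ r).continuousAt

lemma weight_mono (hφ : Continuous φ) (h0 : ∀ r, 0 ≤ φ r) (hα : 0 ≤ α) {s t : ℝ} (hs : 0 ≤ s)
    (hst : s ≤ t) : weight φ α s ≤ weight φ α t := by
  refine le_of_hasDerivAt_nonneg hst (continuous_weight hφ).continuousOn
    (fun r _ => hasDerivAt_weight hφ r) fun r hr => ?_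
  have h1 : 0 ≤ r := hs.trans hr.1.le
  have h2 := h0 r
  have h3 := (weight_pos (φ := φ) (α := α) r).le
  positivity

lemma one_le_weight (hφ : Continuous φ) (h0 : ∀ r, 0 ≤ φ r) (hα : 0 ≤ α) {t : ℝ} (ht : 0 ≤ t) :
    1 ≤ weight φ α t := by
  rw [← weight_zero (φ := φ) (α := α)]
  exact weight_mono hφ h0 hα le_rfl ht

lemma mass_zero : mass φ α g 0 = 0 := by simp [mass]

lemma continuous_mass_integrand (hφ : Continuous φ) (hg : Continuous g) :
    Continuous fun s => s * weight φ α s * g s :=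
  (continuous_id.mul (continuous_weight hφ)).mul hg

lemma hasDerivAt_mass (hφ : Continuous φ) (hg : Continuous g) (t : ℝ) :
    HasDerivAt (mass φ α g) (t * weight φ α t * g t) t :=
  (Continuous.integral_hasStrictDerivAt (continuous_mass_integrand hφ hg) 0 t).hasDerivAt

lemma continuous_mass (hφ : Continuous φ) (hg : Continuous g) : Continuous (mass φ α g) :=
  continuous_iff_continuousAt.2 fun r => (hasDerivAt_mass hφ hg r).continuousAt

lemma mass_le_mass (hφ : Continuous φ) (hg : Continuous g) (hh : Continuous h) {t : ℝ}
    (ht : 0 ≤ t) (hgh : ∀ s ∈ Icc 0 t, g s ≤ h s) : mass φ α g t ≤ mass φ α h t := by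
  refine intervalIntegral.integral_mono_on ht
    ((continuous_mass_integrand hφ hg).intervalIntegrable _ _)
    ((continuous_mass_integrand hφ hh).intervalIntegrable _ _) fun s hs => ?_
  exact mul_le_mul_of_nonneg_left (hgh s hs) (mul_nonneg hs.1 (weight_pos s).le)

lemma mass_nonneg {t : ℝ} (ht : 0 ≤ t) (hg : ∀ s ∈ Icc 0 t, 0 ≤ g s) : 0 ≤ mass φ α g t :=
  intervalIntegral.integral_nonneg ht fun s hs =>
    mul_nonneg (mul_nonneg hs.1 (weight_pos s).le) (hg s hs)

lemma mass_mono_right (hφ : Continuous φ) (hg : Continuous g) {s t : ℝ} (hs : 0 ≤ s) (hst : s ≤ t)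
    (hg0 : ∀ r ∈ Icc 0 t, 0 ≤ g r) : mass φ α g s ≤ mass φ α g t := by
  refine le_of_hasDerivAt_nonneg hst (continuous_mass hφ hg).continuousOn
    (fun r _ => hasDerivAt_mass hφ hg r) fun r hr => ?_
  exact mul_nonneg (mul_nonneg (hs.trans hr.1.le) (weight_pos r).le)
    (hg0 r ⟨hs.trans hr.1.le, hr.2.le⟩)

lemma mass_const_mul (c t : ℝ) : mass φ α (fun s => c * g s) t = c * mass φ α g t := by
  simp only [mass]
  rw [← intervalIntegral.integral_const_mul]
  congr 1
  ext s
  ring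

lemma flux_const_mul (c t : ℝ) : flux φ α (fun s => c * g s) t = c * flux φ α g t := by
  simp only [flux, mass_const_mul, mul_div_assoc]

lemma pot_const_mul (c t : ℝ) : pot φ α (fun s => c * g s) t = c * pot φ α g t := by
  simp only [pot, flux_const_mul, intervalIntegral.integral_const_mul]

lemma mass_const_le (hφ : Continuous φ) (h0 : ∀ r, 0 ≤ φ r) (hα : 0 ≤ α) {c t : ℝ} (hc : 0 ≤ c)
    (ht : 0 ≤ t) : mass φ α (fun _ => c) t ≤ c * weight φ α t * (t ^ 2 / 2) := by
  have h1 : mass φ α (fun _ => c) t ≤ ∫ s in (0 : ℝ)..t, s * (c * weight φ α t) := by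
    refine intervalIntegral.integral_mono_on ht
      ((continuous_mass_integrand hφ continuous_const).intervalIntegrable _ _)
      ((by fun_prop : Continuous _).intervalIntegrable _ _) fun s hs => ?_
    have h2 := weight_mono hφ h0 hα hs.1 hs.2
    nlinarith [mul_nonneg hs.1 hc, mul_le_mul_of_nonneg_left h2 (mul_nonneg hs.1 hc)]
  rw [intervalIntegral.integral_mul_const, integral_id] at h1
  linarith

lemma mass_le_of_le (hφ : Continuous φ) (h0 : ∀ r, 0 ≤ φ r) (hα : 0 ≤ α) (hg : Continuous g)
    {c t : ℝ} (hc : 0 ≤ c) (ht : 0 ≤ t) (hgc : ∀ s ∈ Icc 0 t, g s ≤ c) :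
    mass φ α g t ≤ c * weight φ α t * (t ^ 2 / 2) :=
  (mass_le_mass hφ hg continuous_const ht hgc).trans (mass_const_le hφ h0 hα hc ht)

lemma le_mass_of_le (hφ : Continuous φ) (h0 : ∀ r, 0 ≤ φ r) (hα : 0 ≤ α) (hg : Continuous g)
    {c t : ℝ} (hc : 0 ≤ c) (ht : 0 ≤ t) (hgc : ∀ s ∈ Icc 0 t, c ≤ g s) :
    c * (t ^ 2 / 2) ≤ mass φ α g t := by
  have h1 : ∫ s in (0 : ℝ)..t, s * c ≤ mass φ α g t := by
    refine intervalIntegral.integral_mono_on ht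
      ((by fun_prop : Continuous _).intervalIntegrable _ _)
      ((continuous_mass_integrand hφ hg).intervalIntegrable _ _) fun s hs => ?_
    have h2 := one_le_weight hφ h0 hα hs.1
    have h3 := hgc s hs
    have h4 : c ≤ weight φ α s * g s := by nlinarith
    calc s * c ≤ s * (weight φ α s * g s) := mul_le_mul_of_nonneg_left h4 hs.1
      _ = _ := by ring
  rw [intervalIntegral.integral_mul_const, integral_id] at h1
  linarith

/-- Rescaling to a fixed interval cancels the zero of the denominator of `flux` at the origin and
leaves a continuous quotient. -/
lemma mass_eq_sq_mul (t : ℝ) :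
    mass φ α g t = t ^ 2 * ∫ s in (0 : ℝ)..1, s * weight φ α (t * s) * g (t * s) := by
  have h := intervalIntegral.mul_integral_comp_mul_left (a := 0) (b := 1)
    (f := fun s => s * weight φ α s * g s) t
  rw [mul_zero, mul_one] at h
  have h2 : ∫ s in (0 : ℝ)..1, t * s * weight φ α (t * s) * g (t * s)
      = t * ∫ s in (0 : ℝ)..1, s * weight φ α (t * s) * g (t * s) := by
    rw [← intervalIntegral.integral_const_mul]
    refine intervalIntegral.integral_congr fun s _ => ?_
    ring
  rw [mass, ← h, h2]
  ring

lemma flux_eq_mul (t : ℝ) : flux φ α g t = t * fluxQuot φ α g t := by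
  rcases eq_or_ne t 0 with rfl | ht
  · simp [flux]
  · rw [flux, fluxQuot, mass_eq_sq_mul]
    have := (weight_pos (φ := φ) (α := α) t).ne'
    field_simp

lemma continuous_fluxQuot (hφ : Continuous φ) (hg : Continuous g) :
    Continuous (fluxQuot φ α g) := by
  refine Continuous.div ?_ (continuous_weight hφ) fun t => (weight_pos t).ne'
  refine intervalIntegral.continuous_parametric_intervalIntegral_of_continuous' ?_ 0 1
  have := continuous_weight (α := α) hφ
  simp only [Function.uncurry_def]
  fun_prop

lemma fluxQuot_zero : fluxQuot φ α g 0 = g 0 / 2 := by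
  simp only [fluxQuot, zero_mul, weight_zero, mul_one, div_one]
  rw [intervalIntegral.integral_mul_const, integral_id]
  ring

lemma continuous_flux (hφ : Continuous φ) (hg : Continuous g) : Continuous (flux φ α g) := by
  have : flux φ α g = fun t => t * fluxQuot φ α g t := funext fun t => flux_eq_mul t
  rw [this]
  exact continuous_id.mul (continuous_fluxQuot hφ hg)

lemma flux_zero : flux φ α g 0 = 0 := by simp [flux]

lemma mass_eq_flux_mul {t : ℝ} (ht : t ≠ 0) :
    mass φ α g t = t * weight φ α t * flux φ α g t := by
  have := (weight_pos (φ := φ) (α := α) t).ne'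
  rw [flux]
  field_simp

lemma hasDerivAt_flux (hφ : Continuous φ) (hg : Continuous g) {t : ℝ} (ht : t ≠ 0) :
    HasDerivAt (flux φ α g)
      (g t - flux φ α g t / t - α * t * φ t * flux φ α g t) t := by
  have hw := (weight_pos (φ := φ) (α := α) t).ne'
  have h := (hasDerivAt_mass (α := α) hφ hg t).fun_div
    ((hasDerivAt_id t).fun_mul (hasDerivAt_weight (α := α) hφ t)) (mul_ne_zero ht hw)
  refine h.congr_deriv ?_
  simp only [flux, id]
  field_simp
  ring

lemma hasDerivAt_pot (hφ : Continuous φ) (hg : Continuous g) (r : ℝ) :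
    HasDerivAt (pot φ α g) (-flux φ α g r) r := by
  have h : HasDerivAt (fun u => ∫ t in (1 : ℝ)..u, flux φ α g t) (flux φ α g r) r :=
    (Continuous.integral_hasStrictDerivAt (continuous_flux hφ hg) 1 r).hasDerivAt
  refine h.neg.congr_of_eventuallyEq (Eventually.of_forall fun u => ?_)
  simp only [pot]
  exact intervalIntegral.integral_symm _ _

lemma continuous_pot (hφ : Continuous φ) (hg : Continuous g) : Continuous (pot φ α g) :=
  continuous_iff_continuousAt.2 fun r => (hasDerivAt_pot hφ hg r).continuousAt

lemma pot_one : pot φ α g 1 = 0 := by simp [pot]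

lemma flux_nonneg {t : ℝ} (ht : 0 ≤ t) (hg : ∀ s ∈ Icc 0 t, 0 ≤ g s) : 0 ≤ flux φ α g t :=
  div_nonneg (mass_nonneg ht hg) (mul_nonneg ht (weight_pos t).le)

lemma flux_le_flux (hφ : Continuous φ) (hg : Continuous g) (hh : Continuous h) {t : ℝ}
    (ht : 0 ≤ t) (hgh : ∀ s ∈ Icc 0 t, g s ≤ h s) : flux φ α g t ≤ flux φ α h t :=
  div_le_div_of_nonneg_right (mass_le_mass hφ hg hh ht hgh) (mul_nonneg ht (weight_pos t).le)

lemma flux_le_of_le (hφ : Continuous φ) (h0 : ∀ r, 0 ≤ φ r) (hα : 0 ≤ α) (hg : Continuous g)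
    {c t : ℝ} (hc : 0 ≤ c) (ht : 0 ≤ t) (hgc : ∀ s ∈ Icc 0 t, g s ≤ c) :
    flux φ α g t ≤ c * (t / 2) := by
  rcases ht.eq_or_lt with rfl | ht'
  · simp [flux_zero]
  · rw [flux, div_le_iff₀ (mul_pos ht' (weight_pos t))]
    refine (mass_le_of_le hφ h0 hα hg hc ht hgc).trans_eq ?_
    ring

lemma pot_le_pot (hφ : Continuous φ) (hg : Continuous g) (hh : Continuous h) {r : ℝ}
    (hr : r ∈ Icc (0 : ℝ) 1) (hgh : ∀ s ∈ Icc (0 : ℝ) 1, g s ≤ h s) :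
    pot φ α g r ≤ pot φ α h r := by
  refine intervalIntegral.integral_mono_on hr.2 ((continuous_flux hφ hg).intervalIntegrable _ _)
    ((continuous_flux hφ hh).intervalIntegrable _ _) fun t ht => ?_
  exact flux_le_flux hφ hg hh (hr.1.trans ht.1) fun s hs => hgh s ⟨hs.1, hs.2.trans ht.2⟩

lemma pot_sub_eq (hφ : Continuous φ) (hg : Continuous g) (r s : ℝ) :
    pot φ α g r - pot φ α g s = ∫ t in r..s, flux φ α g t := by
  have hi : ∀ a b, IntervalIntegrable (flux φ α g) volume a b := fun a b =>
    (continuous_flux hφ hg).intervalIntegrable _ _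
  have := intervalIntegral.integral_add_adjacent_intervals (hi r s) (hi s 1)
  simp only [pot]
  linarith

lemma pot_anti (hφ : Continuous φ) (hg : Continuous g) {r s : ℝ} (hr : 0 ≤ r) (hrs : r ≤ s)
    (hg0 : ∀ t ∈ Icc 0 s, 0 ≤ g t) : pot φ α g s ≤ pot φ α g r := by
  have h : 0 ≤ ∫ t in r..s, flux φ α g t := intervalIntegral.integral_nonneg hrs fun t ht =>
    flux_nonneg (hr.trans ht.1) fun x hx => hg0 x ⟨hx.1, hx.2.trans ht.2⟩
  rw [← pot_sub_eq hφ hg] at h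
  linarith

lemma pot_nonneg (hφ : Continuous φ) (hg : Continuous g) {r : ℝ} (hr : r ∈ Icc (0 : ℝ) 1)
    (hg0 : ∀ t ∈ Icc (0 : ℝ) 1, 0 ≤ g t) : 0 ≤ pot φ α g r := by
  have := pot_anti (α := α) hφ hg hr.1 hr.2 hg0
  rwa [pot_one] at this

lemma pot_sub_le_of_le (hφ : Continuous φ) (h0 : ∀ r, 0 ≤ φ r) (hα : 0 ≤ α) (hg : Continuous g)
    {c r s : ℝ} (hc : 0 ≤ c) (hr : 0 ≤ r) (hrs : r ≤ s) (hs1 : s ≤ 1)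
    (hgc : ∀ t ∈ Icc (0 : ℝ) 1, g t ≤ c) : pot φ α g r - pot φ α g s ≤ c * (s - r) := by
  rw [pot_sub_eq hφ hg]
  have : ∫ t in r..s, flux φ α g t ≤ ∫ t in r..s, c := by
    refine intervalIntegral.integral_mono_on hrs
      ((continuous_flux hφ hg).intervalIntegrable _ _) (by simp) fun t ht => ?_
    have h1 := flux_le_of_le (α := α) hφ h0 hα hg hc (hr.trans ht.1)
      fun x hx => hgc x ⟨hx.1, hx.2.trans (ht.2.trans hs1)⟩
    have h2 : t ≤ 1 := ht.2.trans hs1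
    nlinarith
  rw [intervalIntegral.integral_const, smul_eq_mul] at this
  linarith

/-- Dominated convergence is used twice: for the masses at each fixed `t`, then for the fluxes,
which are bounded by `C` on `[0, 1]`. -/
lemma tendsto_pot {ι : Type*} {l : Filter ι} [l.IsCountablyGenerated] {G : ι → ℝ → ℝ} {C : ℝ}
    (hφ : Continuous φ) (h0 : ∀ r, 0 ≤ φ r) (hα : 0 ≤ α) (hG : ∀ i, Continuous (G i))
    (hG0 : ∀ᶠ i in l, ∀ s ∈ Icc (0 : ℝ) 1, 0 ≤ G i s)
    (hGC : ∀ᶠ i in l, ∀ s ∈ Icc (0 : ℝ) 1, G i s ≤ C) (hC : 0 ≤ C)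
    (hlim : ∀ s ∈ Icc (0 : ℝ) 1, Tendsto (fun i => G i s) l (𝓝 (g s))) {r : ℝ}
    (hr : r ∈ Icc (0 : ℝ) 1) : Tendsto (fun i => pot φ α (G i) r) l (𝓝 (pot φ α g r)) := by
  have hw := continuous_weight (α := α) hφ
  have hmass : ∀ t ∈ Icc (0 : ℝ) 1,
      Tendsto (fun i => mass φ α (G i) t) l (𝓝 (mass φ α g t)) := by
    intro t ht
    refine intervalIntegral.tendsto_integral_filter_of_dominated_convergence
      (fun s => s * weight φ α s * C) ?_ ?_ ?_ ?_
    · exact Eventually.of_forall fun i => (continuous_mass_integrand hφ (hG i)).aestronglyMeasurable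
    · filter_upwards [hG0, hGC] with i h1 h2
      refine Eventually.of_forall fun s hs => ?_
      rw [uIoc_of_le ht.1] at hs
      have hs1 : s ∈ Icc (0 : ℝ) 1 := ⟨hs.1.le, hs.2.trans ht.2⟩
      have h3 : 0 ≤ s * weight φ α s := mul_nonneg hs.1.le (weight_pos s).le
      rw [Real.norm_of_nonneg (mul_nonneg h3 (h1 s hs1))]
      exact mul_le_mul_of_nonneg_left (h2 s hs1) h3
    · exact (by fun_prop : Continuous _).intervalIntegrable _ _
    · refine Eventually.of_forall fun s hs => ?_
      rw [uIoc_of_le ht.1] at hs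
      exact (hlim s ⟨hs.1.le, hs.2.trans ht.2⟩).const_mul _
  refine intervalIntegral.tendsto_integral_filter_of_dominated_convergence (fun t => C) ?_ ?_ ?_ ?_
  · exact Eventually.of_forall fun i => (continuous_flux hφ (hG i)).aestronglyMeasurable
  · filter_upwards [hG0, hGC] with i h1 h2
    refine Eventually.of_forall fun t ht => ?_
    rw [uIoc_of_le hr.2] at ht
    have ht0 : 0 ≤ t := hr.1.trans ht.1.le
    rw [Real.norm_of_nonneg (flux_nonneg ht0 fun s hs => h1 s ⟨hs.1, hs.2.trans ht.2⟩)]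
    refine (flux_le_of_le hφ h0 hα (hG i) hC ht0 fun s hs => h2 s ⟨hs.1, hs.2.trans ht.2⟩).trans ?_
    have := ht.2
    nlinarith
  · simp
  · refine Eventually.of_forall fun t ht => ?_
    rw [uIoc_of_le hr.2] at ht
    exact (hmass t ⟨hr.1.trans ht.1.le, ht.2⟩).div_const _

end linear

/-- The Riesz map of the plane, as a continuous linear map. -/
noncomputable def rieszMap : Plane →L[ℝ] Plane →L[ℝ] ℝ := innerSL ℝ

lemma rieszMap_apply (x y : Plane) : rieszMap x y = inner ℝ x y :=
  rfl

lemma rieszMap_eq (x : Plane) : rieszMap x = innerSL ℝ x :=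
  rfl

lemma norm_rieszMap (x : Plane) : ‖rieszMap x‖ = ‖x‖ := by
  rw [rieszMap_eq, innerSL_apply_norm]

lemma hasFDerivAt_norm_of_ne_zero {x : Plane} (hx : x ≠ 0) :
    HasFDerivAt (fun y : Plane => ‖y‖) (‖x‖⁻¹ • rieszMap x) x := by
  have h := (hasStrictFDerivAt_norm_sq x).hasFDerivAt.sqrt (by positivity)
  have h2 : (fun y : Plane => √(‖y‖ ^ 2)) = fun y => ‖y‖ :=
    funext fun y => Real.sqrt_sq (norm_nonneg y)
  rw [h2, Real.sqrt_sq (norm_nonneg x)] at h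
  refine h.congr_fderiv ?_
  rw [← rieszMap_eq]
  ext y
  simp
  field_simp

/-! ### Radial potentials as $C^2$ functions on the plane. -/

section radial

variable {φ g : ℝ → ℝ} {α : ℝ}

lemma hasFDerivAt_pot_norm (hφ : Continuous φ) (hg : Continuous g) (x : Plane) :
    HasFDerivAt (fun y : Plane => pot φ α g ‖y‖) (-(fluxQuot φ α g ‖x‖ • rieszMap x)) x := by
  rcases eq_or_ne x 0 with rfl | hx
  · have h := hasDerivAt_pot (α := α) hφ hg 0
    rw [flux_zero, neg_zero, hasDerivAt_iff_isLittleO] at h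
    refine HasFDerivAt.of_isLittleO ?_
    simp only [map_zero, smul_zero, neg_zero, sub_zero, norm_zero] at h ⊢
    have ht : Tendsto (fun y : Plane => ‖y‖) (𝓝 0) (𝓝 0) := by
      simpa using (continuous_norm (E := Plane)).tendsto 0
    have := h.comp_tendsto ht
    exact ((Asymptotics.isLittleO_norm_right.1 this).congr_left fun y => by simp)
  · have h := (hasDerivAt_pot (α := α) hφ hg ‖x‖).comp_hasFDerivAt x
      (hasFDerivAt_norm_of_ne_zero hx)
    refine h.congr_fderiv ?_
    have : ‖x‖ ≠ 0 := norm_ne_zero_iff.2 hx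
    rw [flux_eq_mul, smul_smul, neg_mul, neg_smul]
    congr 2
    field_simp

lemma hasDerivAt_fluxQuot (hφ : Continuous φ) (hg : Continuous g) {t : ℝ} (ht : t ≠ 0) :
    HasDerivAt (fluxQuot φ α g) ((g t - 2 * fluxQuot φ α g t
      - α * φ t * t ^ 2 * fluxQuot φ α g t) / t ^ 2 * t) t := by
  have h := (hasDerivAt_flux (α := α) hφ hg ht).fun_div (hasDerivAt_id t) ht
  have h2 : (fun y => flux φ α g y / id y) =ᶠ[𝓝 t] fluxQuot φ α g := by
    filter_upwards [isOpen_ne.mem_nhds ht] with y hy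
    have hy' : y ≠ 0 := hy
    rw [flux_eq_mul, id]
    field_simp
  refine (h.congr_of_eventuallyEq h2.symm).congr_deriv ?_
  simp only [flux_eq_mul, id]
  field_simp
  ring

/-- The coefficient of `x ⊗ x` in the Hessian of a radial potential. -/
noncomputable def hessCoeff (φ : ℝ → ℝ) (α : ℝ) (g : ℝ → ℝ) (t : ℝ) : ℝ :=
  (g t - 2 * fluxQuot φ α g t - α * φ t * t ^ 2 * fluxQuot φ α g t) / t ^ 2

/-- Minus the derivative of the gradient of a radial potential. -/
noncomputable def negHess (φ : ℝ → ℝ) (α : ℝ) (g : ℝ → ℝ) (x : Plane) : Plane →L[ℝ] Plane :=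
  fluxQuot φ α g ‖x‖ • ContinuousLinearMap.id ℝ Plane +
    (hessCoeff φ α g ‖x‖ • rieszMap x).smulRight x

lemma hasFDerivAt_fluxQuot_smul (hφ : Continuous φ) (hg : Continuous g) (x : Plane) :
    HasFDerivAt (fun y : Plane => fluxQuot φ α g ‖y‖ • y) (negHess φ α g x) x := by
  rcases eq_or_ne x 0 with rfl | hx
  · refine HasFDerivAt.of_isLittleO ?_
    simp only [negHess, map_zero, smul_zero, norm_zero, sub_zero,
      ContinuousLinearMap.smulRight_zero, add_zero]
    have h1 : Tendsto (fun y : Plane => fluxQuot φ α g ‖y‖ - fluxQuot φ α g 0) (𝓝 0) (𝓝 0) := by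
      have hc : Continuous fun y : Plane => fluxQuot φ α g ‖y‖ - fluxQuot φ α g 0 :=
        ((continuous_fluxQuot hφ hg).comp continuous_norm).sub continuous_const
      simpa using hc.tendsto 0
    have h2 := (Asymptotics.isLittleO_one_iff ℝ).2 h1
    have h4 := h2.smul_isBigO (Asymptotics.isBigO_refl (fun y : Plane => y) (𝓝 0))
    simp only [one_smul] at h4
    refine h4.congr_left fun y => ?_
    simp [sub_smul]
  · have h := ((hasDerivAt_fluxQuot (α := α) hφ hg (norm_ne_zero_iff.2 hx)).comp_hasFDerivAt x
      (hasFDerivAt_norm_of_ne_zero hx)).smul (hasFDerivAt_id x)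
    refine h.congr_fderiv ?_
    have h1 : ‖x‖ ≠ 0 := norm_ne_zero_iff.2 hx
    rw [negHess, hessCoeff, smul_smul, mul_assoc, mul_inv_cancel₀ h1, mul_one]
    rfl

/-- Only the origin is delicate. There the numerator of `hessCoeff` tends to $g(0)-2\cdot g(0)/2=0$,
while the norm of $x\otimes x$ cancels the denominator $|x|^2$. This is why a merely continuous
radial source yields a $C^2$ potential. -/
lemma continuous_negHess (hφ : Continuous φ) (hg : Continuous g) :
    Continuous (negHess φ α g) := by
  have hd := continuous_fluxQuot (α := α) hφ hg
  refine Continuous.add (by fun_prop) (continuous_iff_continuousAt.2 fun x => ?_)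
  have hm : Continuous fun t => g t - 2 * fluxQuot φ α g t
      - α * φ t * t ^ 2 * fluxQuot φ α g t := by fun_prop
  rcases eq_or_ne x 0 with rfl | hx
  · have hm0 : Tendsto (fun y : Plane => g ‖y‖ - 2 * fluxQuot φ α g ‖y‖
      - α * φ ‖y‖ * ‖y‖ ^ 2 * fluxQuot φ α g ‖y‖) (𝓝 0) (𝓝 0) := by
      have := (hm.comp (continuous_norm (E := Plane))).tendsto 0
      simp only [Function.comp_def, norm_zero, fluxQuot_zero] at this
      convert this using 2
      ring
    have hz : ((hessCoeff φ α g ‖(0 : Plane)‖ • rieszMap (0 : Plane)).smulRight (0 : Plane)) = 0 := by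
      ext; simp
    rw [ContinuousAt, hz]
    refine squeeze_zero_norm (fun y => ?_) (tendsto_zero_iff_norm_tendsto_zero.1 hm0)
    rw [ContinuousLinearMap.norm_smulRight_apply, norm_smul, norm_rieszMap, hessCoeff]
    rcases eq_or_ne y 0 with rfl | hy
    · simp
    · have : ‖y‖ ≠ 0 := norm_ne_zero_iff.2 hy
      rw [norm_div, Real.norm_of_nonneg (by positivity : (0 : ℝ) ≤ ‖y‖ ^ 2)]
      apply le_of_eq
      field_simp
  · have hk : ContinuousAt (fun y : Plane => hessCoeff φ α g ‖y‖) x := by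
      simp only [hessCoeff]
      exact (hm.comp continuous_norm).continuousAt.div (by fun_prop)
        (pow_ne_zero 2 (norm_ne_zero_iff.2 hx))
    have h1 : ContinuousAt (fun y : Plane => hessCoeff φ α g ‖y‖ • rieszMap y) x :=
      hk.smul rieszMap.continuous.continuousAt
    have h2 : Continuous fun p : (Plane →L[ℝ] ℝ) × Plane => p.1.smulRight p.2 :=
      (ContinuousLinearMap.smulRightL ℝ Plane Plane).continuous₂
    exact ContinuousAt.comp (f := fun y : Plane => (hessCoeff φ α g ‖y‖ • rieszMap y, y))
      h2.continuousAt (h1.prodMk continuousAt_id)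

lemma fderiv_pot_norm (hφ : Continuous φ) (hg : Continuous g) :
    fderiv ℝ (fun y : Plane => pot φ α g ‖y‖) = fun x => -rieszMap (fluxQuot φ α g ‖x‖ • x) := by
  funext x
  rw [(hasFDerivAt_pot_norm hφ hg x).fderiv, map_smul]

lemma contDiff_pot_norm (hφ : Continuous φ) (hg : Continuous g) :
    ContDiff ℝ 2 fun y : Plane => pot φ α g ‖y‖ := by
  rw [show (2 : WithTop ℕ∞) = 1 + 1 from (one_add_one_eq_two).symm, contDiff_succ_iff_fderiv]
  refine ⟨fun x => (hasFDerivAt_pot_norm hφ hg x).differentiableAt, by simp, ?_⟩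
  rw [fderiv_pot_norm hφ hg]
  refine ContDiff.neg (rieszMap.contDiff.comp ?_)
  exact contDiff_one_iff_hasFDerivAt.2
    ⟨negHess φ α g, continuous_negHess hφ hg, hasFDerivAt_fluxQuot_smul hφ hg⟩

lemma laplacian_pot_norm (hφ : Continuous φ) (hg : Continuous g) (x : Plane) :
    (Laplacian.laplacian fun y : Plane => pot φ α g ‖y‖) x
      = -(2 * fluxQuot φ α g ‖x‖ + hessCoeff φ α g ‖x‖ * ‖x‖ ^ 2) := by
  rw [InnerProductSpace.laplacian_eq_iteratedFDeriv_orthonormalBasis _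
    (EuclideanSpace.basisFun (Fin 2) ℝ)]
  simp only [iteratedFDeriv_two_apply, fderiv_pot_norm hφ hg]
  have h : fderiv ℝ (fun y : Plane => -rieszMap (fluxQuot φ α g ‖y‖ • y)) x
      = -(rieszMap.comp (negHess φ α g x)) :=
    (rieszMap.hasFDerivAt.comp x (hasFDerivAt_fluxQuot_smul hφ hg x)).neg.fderiv
  rw [h, EuclideanSpace.norm_sq_eq]
  simp [Fin.sum_univ_two, negHess, rieszMap_apply,
    EuclideanSpace.inner_single_right]
  ring

lemma equation_pot_norm (hφ : Continuous φ) (hg : Continuous g) (x : Plane) :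
    -(Laplacian.laplacian (fun y : Plane => pot φ α g ‖y‖)) x
      - α * φ ‖x‖ * fderiv ℝ (fun y : Plane => pot φ α g ‖y‖) x x = g ‖x‖ := by
  rw [laplacian_pot_norm hφ hg, fderiv_pot_norm hφ hg]
  simp only [neg_apply, map_smul, smul_apply, rieszMap_apply,
    real_inner_self_eq_norm_sq, smul_eq_mul]
  rcases eq_or_ne x 0 with rfl | hx
  · simp [fluxQuot_zero]
    ring
  · have : ‖x‖ ≠ 0 := norm_ne_zero_iff.2 hx
    rw [hessCoeff]
    field_simp
    ring

end radial

/-! ### Maximum and comparison principle in the disk. -/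

/-- A negative second derivative would make the point a local maximum as well, hence the function
locally constant, which contradicts the sign. -/
lemma deriv_deriv_nonneg_of_isLocalMin {z : ℝ → ℝ} {a : ℝ} (hmin : IsLocalMin z a)
    (hc : ContinuousAt z a) : 0 ≤ deriv (deriv z) a := by
  by_contra! hneg
  have hmax := isLocalMax_of_deriv_deriv_neg hneg hmin.deriv_eq_zero hc
  have heq : z =ᶠ[𝓝 a] fun _ => z a := by
    filter_upwards [hmin, hmax] with y h1 h2 using le_antisymm h2 h1
  have h2 : deriv (deriv z) a = 0 := by
    rw [heq.deriv.deriv_eq]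
    simp
  linarith

lemma laplacian_nonneg_of_isLocalMin {z : Plane → ℝ} {a : Plane} (hz : ContDiffAt ℝ 2 z a)
    (hmin : IsLocalMin z a) : 0 ≤ (Laplacian.laplacian z : Plane → ℝ) a := by
  rw [InnerProductSpace.laplacian_eq_iteratedFDeriv_orthonormalBasis _
    (EuclideanSpace.basisFun (Fin 2) ℝ)]
  refine Finset.sum_nonneg fun i _ => ?_
  rw [iteratedFDeriv_two_apply]
  set e : Plane := EuclideanSpace.basisFun (Fin 2) ℝ i
  have hline : ∀ t : ℝ, HasDerivAt (fun t : ℝ => a + t • e) e t := fun t => by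
    simpa using ((hasDerivAt_id t).smul_const e).const_add a
  have hcont : ContinuousAt (fun t : ℝ => a + t • e) 0 := (hline 0).continuousAt
  have ht0 : Tendsto (fun t : ℝ => a + t • e) (𝓝 0) (𝓝 a) := by
    simpa [ContinuousAt] using hcont
  have hev : ∀ᶠ y in 𝓝 a, DifferentiableAt ℝ z y := by
    filter_upwards [hz.eventually (by simp)] with y hy using hy.differentiableAt (by simp)
  have hd1 : deriv (fun t : ℝ => z (a + t • e)) =ᶠ[𝓝 0] fun t => fderiv ℝ z (a + t • e) e := by
    filter_upwards [ht0.eventually hev] with t ht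
    exact (ht.hasFDerivAt.comp_hasDerivAt t (hline t)).deriv
  have hz1 : DifferentiableAt ℝ (fderiv ℝ z) a :=
    (hz.fderiv_right (m := 1) (by norm_num)).differentiableAt (by simp)
  have hd2 : HasDerivAt (fun t : ℝ => fderiv ℝ z (a + t • e) e) (fderiv ℝ (fderiv ℝ z) a e e) 0 := by
    have h1 : HasFDerivAt (fderiv ℝ z) (fderiv ℝ (fderiv ℝ z) a) (a + (0 : ℝ) • e) := by
      simpa using hz1.hasFDerivAt
    have h2 := h1.comp_hasDerivAt (0 : ℝ) (hline 0)
    simpa using h2.clm_apply (hasDerivAt_const (0 : ℝ) e)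
  have hmin' : IsLocalMin (fun t : ℝ => z (a + t • e)) 0 := by
    have := ht0.eventually hmin
    simpa [IsLocalMin, IsMinFilter] using this
  have h := deriv_deriv_nonneg_of_isLocalMin hmin' (by
    have h0 : ContinuousAt z (a + (0 : ℝ) • e) := by simpa using hz.continuousAt
    exact ContinuousAt.comp (f := fun t : ℝ => a + t • e) h0 hcont)
  rw [hd1.deriv_eq, hd2.deriv] at h
  simpa using h

/-- Comparison principle for the linear operator `-Δ - α φ(|x|) x · ∇` in the unit disk. -/
lemma le_of_subsolution_of_supersolution {φ : ℝ → ℝ} {α : ℝ} (hφ : Continuous φ)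
    {U w : Plane → ℝ} (hU : ContDiffOn ℝ 2 U (Metric.ball 0 1))
    (hw : ContDiffOn ℝ 2 w (Metric.ball 0 1)) (hUc : ContinuousOn U (Metric.closedBall 0 1))
    (hwc : ContinuousOn w (Metric.closedBall 0 1))
    (hle : ∀ x ∈ Metric.ball (0 : Plane) 1,
      -(Laplacian.laplacian U : Plane → ℝ) x - α * φ ‖x‖ * fderiv ℝ U x x ≤
        -(Laplacian.laplacian w : Plane → ℝ) x - α * φ ‖x‖ * fderiv ℝ w x x)
    (hbd : ∀ x ∈ Metric.sphere (0 : Plane) 1, U x ≤ w x) :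
    ∀ x ∈ Metric.closedBall (0 : Plane) 1, U x ≤ w x := by
  -- `P` has right-hand side `1` and vanishes on the boundary. Adding `ε • P` to `w - U` makes the
  -- differential inequality strict, which rules out a negative interior minimum; then `ε` tends to
  -- `0`.
  set P : Plane → ℝ := fun y => pot φ α (fun _ => 1) ‖y‖ with hP
  have hPd : ContDiff ℝ 2 P := contDiff_pot_norm hφ continuous_const
  have hkey : ∀ ε > 0, ∀ x ∈ Metric.closedBall (0 : Plane) 1, 0 ≤ w x - U x + ε * P x := by
    intro ε hε
    set z : Plane → ℝ := w - U + ε • P with hz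
    have hzc : ContinuousOn z (Metric.closedBall 0 1) :=
      (hwc.sub hUc).add (hPd.continuous.const_smul ε).continuousOn
    obtain ⟨a, ha, hmin⟩ := (isCompact_closedBall (0 : Plane) 1).exists_isMinOn
      ⟨0, by simp⟩ hzc
    have hza : 0 ≤ z a := by
      by_contra! hneg
      have hab : a ∈ Metric.ball (0 : Plane) 1 := by
        rcases (Metric.mem_closedBall.1 ha).lt_or_eq with h | h
        · exact h
        · exfalso
          have h1 := hbd a h
          have h2 : ‖a‖ = 1 := by simpa using h
          simp only [hz, hP, Pi.add_apply, Pi.sub_apply, Pi.smul_apply, h2, pot_one,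
            smul_zero] at hneg
          linarith
      have hnhds := Metric.isOpen_ball.mem_nhds hab
      have hUa := hU.contDiffAt hnhds
      have hwa := hw.contDiffAt hnhds
      have hPa : ContDiffAt ℝ 2 P a := hPd.contDiffAt
      have hza2 : ContDiffAt ℝ 2 z a := (hwa.sub hUa).add (hPa.const_smul ε)
      have hloc : IsLocalMin z a := by
        filter_upwards [hnhds] with y hy
        exact hmin (Metric.ball_subset_closedBall hy)
      have h1 := laplacian_nonneg_of_isLocalMin hza2 hloc
      have h2 := hloc.fderiv_eq_zero
      have h3 : (Laplacian.laplacian z : Plane → ℝ) a = (Laplacian.laplacian w : Plane → ℝ) a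
          - (Laplacian.laplacian U : Plane → ℝ) a + ε * (Laplacian.laplacian P : Plane → ℝ) a := by
        have e1 : ContDiffAt ℝ 2 (w - U) a := hwa.sub hUa
        have e2 : ContDiffAt ℝ 2 (ε • P) a := hPa.const_smul ε
        rw [hz, e1.laplacian_add e2, hwa.laplacian_sub hUa,
          InnerProductSpace.laplacian_smul ε hPa, smul_eq_mul]
      have h4 : fderiv ℝ z a = fderiv ℝ w a - fderiv ℝ U a + ε • fderiv ℝ P a := by
        have d1 := hwa.differentiableAt (by simp)
        have d2 := hUa.differentiableAt (by simp)
        have d3 := hPa.differentiableAt (by simp)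
        rw [hz, fderiv_add (d1.sub d2) (d3.const_smul ε), fderiv_sub d1 d2,
          fderiv_const_smul d3]
      have h5 := equation_pot_norm (φ := φ) (α := α) (g := fun _ => 1) hφ continuous_const a
      have h6 := hle a hab
      have h7 : fderiv ℝ z a a = 0 := by rw [h2]; simp
      rw [h4] at h7
      simp only [add_apply, sub_apply,
        smul_apply, smul_eq_mul] at h7
      rw [h3] at h1
      have h8 : fderiv ℝ w a a - fderiv ℝ U a a = -(ε * fderiv ℝ P a a) := by linarith
      have h9 : α * φ ‖a‖ * (fderiv ℝ w a a) - α * φ ‖a‖ * (fderiv ℝ U a a)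
          = -(ε * (α * φ ‖a‖ * fderiv ℝ P a a)) := by
        rw [← mul_sub, h8]; ring
      have h10 : ε * (-(Laplacian.laplacian P : Plane → ℝ) a
          - α * φ ‖a‖ * fderiv ℝ P a a) = ε := by rw [hP, h5, mul_one]
      nlinarith
    intro x hx
    have := hza.trans (hmin hx)
    simpa [hz] using this
  intro x hx
  have hlim : Tendsto (fun ε : ℝ => w x - U x + ε * P x) (𝓝[>] 0) (𝓝 (w x - U x + 0 * P x)) := by
    refine Tendsto.mono_left ?_ nhdsWithin_le_nhds
    exact (by fun_prop : Continuous fun ε : ℝ => w x - U x + ε * P x).tendsto 0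
  have := ge_of_tendsto hlim (by
    filter_upwards [self_mem_nhdsWithin] with ε hε using hkey ε hε x hx)
  linarith

/-- Admissible data for the radial problem, extended to functions on the whole real line. -/
structure RadialData (f φ ψ : ℝ → ℝ) : Prop where
  φ_cont : Continuous φ
  φ_anti : Antitone φ
  φ_nonneg : ∀ r, 0 ≤ φ r
  φ_pos : ∀ r < 1, 0 < φ r
  φ_zero : φ 0 = 1
  ψ_cont : Continuous ψ
  ψ_anti : Antitone ψ
  ψ_nonneg : ∀ r, 0 ≤ ψ r
  ψ_zero : ψ 0 = 1
  f_cont : Continuous f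
  f_mono : Monotone f
  f_pos : ∀ s, 0 < f s
  f_convex : ConvexOn ℝ univ f
  f_diff : ContDiffOn ℝ 1 f (Ioi 0)
  f_int : IntegrableOn (fun s => 1 / f s) (Ioi 0)
  M_int : IntegrableOn (maxRatio φ ψ) (Ioo 0 1)

/-- The right-hand side `lam ψ f(u)`. -/
def source (f ψ : ℝ → ℝ) (lam : ℝ) (u : ℝ → ℝ) (s : ℝ) : ℝ := lam * ψ s * f (u s)

/-- The truncation of a real number to `[0, 1]`. -/
def clamp (r : ℝ) : ℝ := max 0 (min r 1)

lemma clamp_mem (r : ℝ) : clamp r ∈ Icc (0 : ℝ) 1 :=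
  ⟨le_max_left _ _, max_le zero_le_one (min_le_right _ _)⟩

lemma clamp_of_mem {r : ℝ} (hr : r ∈ Icc (0 : ℝ) 1) : clamp r = r := by
  rw [clamp, min_eq_left hr.2, max_eq_right hr.1]

lemma continuous_clamp : Continuous clamp := by unfold clamp; fun_prop

lemma clamp_mono : Monotone clamp := fun _ _ h => max_le_max le_rfl (min_le_min h le_rfl)

lemma clamp_sub_le {r s : ℝ} (h : r ≤ s) : clamp s - clamp r ≤ s - r := by
  unfold clamp
  rcases max_cases 0 (min r 1) with h1 | h1 <;> rcases max_cases 0 (min s 1) with h2 | h2 <;>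
  rcases min_cases r 1 with h3 | h3 <;> rcases min_cases s 1 with h4 | h4 <;> linarith

/-- One step of the monotone iteration. -/
noncomputable def picard (f φ ψ : ℝ → ℝ) (α lam : ℝ) (u : ℝ → ℝ) (r : ℝ) : ℝ :=
  pot φ α (source f ψ lam u) (clamp r)

/-- Profiles of radial classical solutions, constant outside `[0, 1]`. -/
structure IsRadialSolution (f φ ψ : ℝ → ℝ) (α lam : ℝ) (u : ℝ → ℝ) : Prop where
  cont : Continuous u
  fixed : ∀ r, u r = picard f φ ψ α lam u r

lemma exists_half_le {g : ℝ → ℝ} (hg : Continuous g) (h0 : 0 < g 0) {t : ℝ} (ht : 0 < t) :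
    ∃ b, 0 < b ∧ b ≤ t ∧ ∀ s ∈ Icc 0 b, g 0 / 2 ≤ g s := by
  have h1 : ∀ᶠ s in 𝓝 (0 : ℝ), g 0 / 2 < g s :=
    hg.continuousAt.eventually (lt_mem_nhds (by linarith))
  obtain ⟨ε, hε, hball⟩ := Metric.eventually_nhds_iff.1 h1
  refine ⟨min (ε / 2) t, lt_min (by positivity) ht, min_le_right _ _, fun s hs => ?_⟩
  refine (hball ?_).le
  rw [Real.dist_eq, sub_zero, abs_of_nonneg hs.1]
  linarith [hs.2, min_le_left (ε / 2) t]

lemma mass_pos {φ g : ℝ → ℝ} {α : ℝ} (hφ : Continuous φ) (h0 : ∀ r, 0 ≤ φ r) (hα : 0 ≤ α)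
    (hg : Continuous g) {t : ℝ} (ht : 0 < t) (hg0 : 0 < g 0) (hg1 : ∀ s ∈ Icc 0 t, 0 ≤ g s) :
    0 < mass φ α g t := by
  obtain ⟨b, hb, hbt, h⟩ := exists_half_le hg hg0 ht
  have h1 := le_mass_of_le (α := α) hφ h0 hα hg (by linarith : 0 ≤ g 0 / 2) hb.le h
  have h2 := mass_mono_right (α := α) hφ hg hb.le hbt hg1
  have : 0 < g 0 / 2 * (b ^ 2 / 2) := by positivity
  linarith

lemma pot_pos {φ g : ℝ → ℝ} {α : ℝ} (hφ : Continuous φ) (h0 : ∀ r, 0 ≤ φ r) (hα : 0 ≤ α)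
    (hg : Continuous g) {r : ℝ} (hr0 : 0 ≤ r) (hr : r < 1) (hg0 : 0 < g 0)
    (hg1 : ∀ s ∈ Icc (0 : ℝ) 1, 0 ≤ g s) : 0 < pot φ α g r := by
  refine intervalIntegral.intervalIntegral_pos_of_pos_on
    ((continuous_flux hφ hg).intervalIntegrable _ _) (fun t ht => ?_) hr
  have ht0 : 0 < t := hr0.trans_lt ht.1
  exact div_pos (mass_pos hφ h0 hα hg ht0 hg0 fun s hs => hg1 s ⟨hs.1, hs.2.trans ht.2.le⟩)
    (mul_pos ht0 (weight_pos t))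

/-! ### Monotone iteration and radial minimal solutions. -/

section data

variable {f φ ψ : ℝ → ℝ} {α lam mu : ℝ} {u v : ℝ → ℝ}

lemma RadialData.φ_le_one (D : RadialData f φ ψ) {r : ℝ} (hr : 0 ≤ r) : φ r ≤ 1 := by
  rw [← D.φ_zero]; exact D.φ_anti hr

lemma RadialData.ψ_le_one (D : RadialData f φ ψ) {r : ℝ} (hr : 0 ≤ r) : ψ r ≤ 1 := by
  rw [← D.ψ_zero]; exact D.ψ_anti hr

lemma RadialData.continuous_source (D : RadialData f φ ψ) (hu : Continuous u) :
    Continuous (source f ψ lam u) :=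
  (continuous_const.mul D.ψ_cont).mul (D.f_cont.comp hu)

lemma RadialData.source_nonneg (D : RadialData f φ ψ) (hl : 0 ≤ lam) (s : ℝ) :
    0 ≤ source f ψ lam u s :=
  mul_nonneg (mul_nonneg hl (D.ψ_nonneg s)) (D.f_pos _).le

lemma RadialData.source_le (D : RadialData f φ ψ) (hl : 0 ≤ lam) {s B : ℝ} (hs : 0 ≤ s)
    (hu : u s ≤ B) : source f ψ lam u s ≤ lam * f B := by
  have h1 : lam * ψ s ≤ lam := mul_le_of_le_one_right hl (D.ψ_le_one hs)
  exact mul_le_mul h1 (D.f_mono hu) (D.f_pos _).le hl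

lemma RadialData.source_le_source (D : RadialData f φ ψ) (hl : 0 ≤ lam) (hlm : lam ≤ mu) {s : ℝ}
    (huv : u s ≤ v s) : source f ψ lam u s ≤ source f ψ mu v s :=
  mul_le_mul (mul_le_mul_of_nonneg_right hlm (D.ψ_nonneg s)) (D.f_mono huv) (D.f_pos _).le
    (mul_nonneg (hl.trans hlm) (D.ψ_nonneg s))

lemma RadialData.source_zero_pos (D : RadialData f φ ψ) (hl : 0 < lam) :
    0 < source f ψ lam u 0 := by
  rw [source, D.ψ_zero, mul_one]
  exact mul_pos hl (D.f_pos _)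

lemma RadialData.continuous_picard (D : RadialData f φ ψ) (hu : Continuous u) :
    Continuous (picard f φ ψ α lam u) :=
  (continuous_pot D.φ_cont (D.continuous_source hu)).comp continuous_clamp

lemma RadialData.picard_nonneg (D : RadialData f φ ψ) (hl : 0 ≤ lam) (hu : Continuous u) (r : ℝ) :
    0 ≤ picard f φ ψ α lam u r :=
  pot_nonneg D.φ_cont (D.continuous_source hu) (clamp_mem r) fun s _ => D.source_nonneg hl s

lemma RadialData.picard_le_picard (D : RadialData f φ ψ) (hl : 0 ≤ lam) (hlm : lam ≤ mu)
    (hu : Continuous u) (hv : Continuous v) (huv : ∀ s ∈ Icc (0 : ℝ) 1, u s ≤ v s) (r : ℝ) :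
    picard f φ ψ α lam u r ≤ picard f φ ψ α mu v r :=
  pot_le_pot D.φ_cont (D.continuous_source hu) (D.continuous_source hv) (clamp_mem r)
    fun s hs => D.source_le_source hl hlm (huv s hs)

/-- The Lipschitz constant depends on `u` only through an upper bound, so it survives pointwise
limits and takes the place of a compactness argument. -/
lemma RadialData.abs_picard_sub_le (D : RadialData f φ ψ) (hα : 0 ≤ α) (hl : 0 ≤ lam)
    (hu : Continuous u) {B : ℝ} (hB : ∀ s ∈ Icc (0 : ℝ) 1, u s ≤ B) (r s : ℝ) :
    |picard f φ ψ α lam u r - picard f φ ψ α lam u s| ≤ lam * f B * |r - s| := by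
  wlog hrs : r ≤ s generalizing r s
  · rw [abs_sub_comm, abs_sub_comm r]
    exact this s r (le_of_not_ge hrs)
  have hs := D.continuous_source (lam := lam) hu
  have h0 : 0 ≤ lam * f B := mul_nonneg hl (D.f_pos B).le
  have h1 : picard f φ ψ α lam u s ≤ picard f φ ψ α lam u r :=
    pot_anti D.φ_cont hs (clamp_mem r).1 (clamp_mono hrs) fun t _ => D.source_nonneg hl t
  have h2 := pot_sub_le_of_le D.φ_cont D.φ_nonneg hα hs h0 (clamp_mem r).1
    (clamp_mono hrs) (clamp_mem s).2 fun t ht => D.source_le hl ht.1 (hB t ht)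
  rw [abs_of_nonneg (sub_nonneg.2 h1), abs_sub_comm, abs_of_nonneg (sub_nonneg.2 hrs)]
  exact h2.trans (mul_le_mul_of_nonneg_left (clamp_sub_le hrs) h0)

/-- Pointwise limits of uniformly bounded Picard steps are radial solutions. -/
lemma RadialData.isRadialSolution_of_tendsto (D : RadialData f φ ψ) (hα : 0 ≤ α) {ι : Type*}
    {l : Filter ι} [l.NeBot] [l.IsCountablyGenerated] {L : ι → ℝ} {U : ι → ℝ → ℝ} {B Λ : ℝ}
    (hU : ∀ i, Continuous (U i)) (hL0 : ∀ᶠ i in l, 0 ≤ L i) (hLΛ : ∀ᶠ i in l, L i ≤ Λ)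
    (hB : ∀ᶠ i in l, ∀ s ∈ Icc (0 : ℝ) 1, U i s ≤ B)
    (hL : Tendsto L l (𝓝 lam)) (hlim : ∀ r, Tendsto (fun i => U i r) l (𝓝 (u r)))
    (hlim' : ∀ r, Tendsto (fun i => picard f φ ψ α (L i) (U i) r) l (𝓝 (u r))) :
    IsRadialSolution f φ ψ α lam u := by
  have hΛ : 0 ≤ Λ := by
    obtain ⟨i, h1, h2⟩ := (hL0.and hLΛ).exists
    exact h1.trans h2
  have hC : 0 ≤ Λ * f B := mul_nonneg hΛ (D.f_pos B).le
  have hlip : ∀ r s, |u r - u s| ≤ Λ * f B * |r - s| := by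
    intro r s
    refine le_of_tendsto ((hlim' r).sub (hlim' s)).abs ?_
    filter_upwards [hL0, hLΛ, hB] with i h1 h2 h3
    refine (D.abs_picard_sub_le hα h1 (hU i) h3 r s).trans ?_
    exact mul_le_mul_of_nonneg_right (mul_le_mul_of_nonneg_right h2 (D.f_pos B).le)
      (abs_nonneg _)
  have hcont : Continuous u :=
    (LipschitzWith.of_dist_le_mul (K := ⟨Λ * f B, hC⟩) fun r s => hlip r s).continuous
  -- The same Picard steps converge to `u` by assumption and to the Picard step of `u` by dominated
  -- convergence.
  refine ⟨hcont, fun r => tendsto_nhds_unique (hlim' r) ?_⟩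
  refine tendsto_pot (C := Λ * f B) D.φ_cont D.φ_nonneg hα (fun i => D.continuous_source (hU i))
    ?_ ?_ hC (fun s _ => ?_) (clamp_mem r)
  · filter_upwards [hL0] with i h1 s _ using D.source_nonneg h1 s
  · filter_upwards [hL0, hLΛ, hB] with i h1 h2 h3 s hs
    exact (D.source_le h1 hs.1 (h3 s hs)).trans
      (mul_le_mul_of_nonneg_right h2 (D.f_pos B).le)
  · exact (hL.mul_const _).mul ((D.f_cont.tendsto _).comp (hlim s))

/-- The monotone iteration started at `0`. -/
noncomputable def picardIter (f φ ψ : ℝ → ℝ) (α lam : ℝ) : ℕ → ℝ → ℝ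
  | 0 => fun _ => 0
  | n + 1 => picard f φ ψ α lam (picardIter f φ ψ α lam n)

/-- The limit of the monotone iteration, the profile of the minimal solution. -/
noncomputable def minProfile (f φ ψ : ℝ → ℝ) (α lam : ℝ) (r : ℝ) : ℝ :=
  ⨆ n, picardIter f φ ψ α lam n r

lemma RadialData.continuous_picardIter (D : RadialData f φ ψ) (n : ℕ) :
    Continuous (picardIter f φ ψ α lam n) := by
  induction n with
  | zero => exact continuous_const
  | succ n ih => exact D.continuous_picard ih

lemma RadialData.picardIter_le_succ (D : RadialData f φ ψ) (hl : 0 ≤ lam) (n : ℕ) (r : ℝ) :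
    picardIter f φ ψ α lam n r ≤ picardIter f φ ψ α lam (n + 1) r := by
  induction n generalizing r with
  | zero => exact D.picard_nonneg hl continuous_const r
  | succ n ih =>
    exact D.picard_le_picard hl le_rfl (D.continuous_picardIter n)
      (D.continuous_picardIter (n + 1)) (fun s _ => ih s) r

lemma RadialData.picardIter_mono (D : RadialData f φ ψ) (hl : 0 ≤ lam) (r : ℝ) :
    Monotone fun n => picardIter f φ ψ α lam n r :=
  monotone_nat_of_le_succ fun n => D.picardIter_le_succ hl n r

lemma picardIter_clamp (n : ℕ) (r : ℝ) :
    picardIter f φ ψ α lam n (clamp r) = picardIter f φ ψ α lam n r := by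
  cases n with
  | zero => rfl
  | succ n => simp only [picardIter, picard, clamp_of_mem (clamp_mem r)]

lemma RadialData.tendsto_minProfile (D : RadialData f φ ψ) (hl : 0 ≤ lam) {B : ℝ}
    (hB : ∀ n, ∀ r ∈ Icc (0 : ℝ) 1, picardIter f φ ψ α lam n r ≤ B) (r : ℝ) :
    Tendsto (fun n => picardIter f φ ψ α lam n r) atTop (𝓝 (minProfile f φ ψ α lam r)) := by
  refine tendsto_atTop_ciSup (D.picardIter_mono hl r) ⟨B, ?_⟩
  rintro _ ⟨n, rfl⟩
  change picardIter f φ ψ α lam n r ≤ B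
  rw [← picardIter_clamp]
  exact hB n _ (clamp_mem r)

lemma RadialData.isRadialSolution_minProfile (D : RadialData f φ ψ) (hα : 0 ≤ α) (hl : 0 ≤ lam)
    {B : ℝ} (hB : ∀ n, ∀ r ∈ Icc (0 : ℝ) 1, picardIter f φ ψ α lam n r ≤ B) :
    IsRadialSolution f φ ψ α lam (minProfile f φ ψ α lam) := by
  have h := D.tendsto_minProfile hl hB
  exact D.isRadialSolution_of_tendsto (Λ := lam) (L := fun _ => lam) hα
    (fun n => D.continuous_picardIter n)
    (Eventually.of_forall fun _ => hl) (Eventually.of_forall fun _ => le_rfl)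
    (Eventually.of_forall hB) tendsto_const_nhds h fun r => (h r).comp (tendsto_add_atTop_nat 1)

lemma RadialData.picardIter_le_of_supersolution (D : RadialData f φ ψ) (hl : 0 ≤ lam)
    (hv : Continuous v) (hv0 : ∀ r ∈ Icc (0 : ℝ) 1, 0 ≤ v r)
    (hsup : ∀ r ∈ Icc (0 : ℝ) 1, pot φ α (source f ψ lam v) r ≤ v r) (n : ℕ) :
    ∀ r ∈ Icc (0 : ℝ) 1, picardIter f φ ψ α lam n r ≤ v r := by
  induction n with
  | zero => exact hv0
  | succ n ih =>
    intro r hr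
    refine (D.picard_le_picard hl le_rfl (D.continuous_picardIter n) hv ih r).trans ?_
    rw [picard, clamp_of_mem hr]
    exact hsup r hr

lemma RadialData.exists_isRadialSolution_of_supersolution (D : RadialData f φ ψ) (hα : 0 ≤ α)
    (hl : 0 ≤ lam) (hv : Continuous v) (hv0 : ∀ r ∈ Icc (0 : ℝ) 1, 0 ≤ v r)
    (hsup : ∀ r ∈ Icc (0 : ℝ) 1, pot φ α (source f ψ lam v) r ≤ v r) :
    ∃ u, IsRadialSolution f φ ψ α lam u := by
  obtain ⟨B, hB⟩ := (isCompact_Icc (a := (0 : ℝ)) (b := 1)).bddAbove_image hv.continuousOn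
  exact ⟨_, D.isRadialSolution_minProfile (B := B) hα hl fun n r hr =>
    (D.picardIter_le_of_supersolution hl hv hv0 hsup n r hr).trans (hB ⟨r, hr, rfl⟩)⟩

lemma IsRadialSolution.eq_pot (hu : IsRadialSolution f φ ψ α lam u) {r : ℝ}
    (hr : r ∈ Icc (0 : ℝ) 1) : u r = pot φ α (source f ψ lam u) r := by
  have := hu.fixed r
  rwa [picard, clamp_of_mem hr] at this

lemma IsRadialSolution.apply_clamp (hu : IsRadialSolution f φ ψ α lam u) (r : ℝ) :
    u (clamp r) = u r := by
  rw [hu.fixed, hu.fixed r, picard, picard, clamp_of_mem (clamp_mem r)]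

lemma IsRadialSolution.nonneg (hu : IsRadialSolution f φ ψ α lam u) (D : RadialData f φ ψ)
    (hl : 0 ≤ lam) (r : ℝ) : 0 ≤ u r := by
  rw [hu.fixed]
  exact D.picard_nonneg hl hu.cont r

lemma IsRadialSolution.antitone (hu : IsRadialSolution f φ ψ α lam u) (D : RadialData f φ ψ)
    (hl : 0 ≤ lam) : Antitone u := fun r s hrs => by
  rw [hu.fixed, hu.fixed r]
  exact pot_anti D.φ_cont (D.continuous_source hu.cont) (clamp_mem r).1 (clamp_mono hrs)
    fun t _ => D.source_nonneg hl t

lemma IsRadialSolution.apply_one (hu : IsRadialSolution f φ ψ α lam u) : u 1 = 0 := by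
  rw [hu.eq_pot ⟨zero_le_one, le_rfl⟩, pot_one]

lemma IsRadialSolution.pos (hu : IsRadialSolution f φ ψ α lam u) (D : RadialData f φ ψ)
    (hα : 0 ≤ α) (hl : 0 < lam) {r : ℝ} (hr0 : 0 ≤ r) (hr : r < 1) : 0 < u r := by
  rw [hu.eq_pot ⟨hr0, hr.le⟩]
  exact pot_pos D.φ_cont D.φ_nonneg hα (D.continuous_source hu.cont) hr0 hr
    (D.source_zero_pos hl) fun s _ => D.source_nonneg hl.le s

lemma IsRadialSolution.hasDerivAt (hu : IsRadialSolution f φ ψ α lam u) (D : RadialData f φ ψ)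
    {r : ℝ} (hr : r ∈ Ioo (0 : ℝ) 1) : HasDerivAt u (-flux φ α (source f ψ lam u) r) r := by
  refine (hasDerivAt_pot D.φ_cont (D.continuous_source hu.cont) r).congr_of_eventuallyEq ?_
  filter_upwards [Icc_mem_nhds hr.1 hr.2] with s hs using hu.eq_pot hs

lemma norm_mem_Icc {x : Plane} (hx : x ∈ Metric.closedBall (0 : Plane) 1) :
    ‖x‖ ∈ Icc (0 : ℝ) 1 :=
  ⟨norm_nonneg x, by simpa using hx⟩

lemma IsRadialSolution.isClassicalSolution (hu : IsRadialSolution f φ ψ α lam u)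
    (D : RadialData f φ ψ) (hα : 0 ≤ α) (hl : 0 < lam) :
    IsClassicalSolution f φ ψ α lam fun x => u ‖x‖ := by
  have hs := D.continuous_source (lam := lam) hu.cont
  have heq : ∀ x ∈ Metric.ball (0 : Plane) 1,
      u ‖x‖ = pot φ α (source f ψ lam u) ‖x‖ := fun x hx =>
    hu.eq_pot (norm_mem_Icc (Metric.ball_subset_closedBall hx))
  refine ⟨?_, (hu.cont.comp continuous_norm).continuousOn, fun x hx => ?_, fun x hx => ?_,
    fun x hx => ?_⟩
  · exact (contDiff_pot_norm D.φ_cont hs).contDiffOn.congr heq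
  · have hev : (fun x : Plane => u ‖x‖) =ᶠ[𝓝 x] fun x => pot φ α (source f ψ lam u) ‖x‖ := by
      filter_upwards [Metric.isOpen_ball.mem_nhds hx] with y hy using heq y hy
    rw [(InnerProductSpace.laplacian_congr_nhds hev).eq_of_nhds, hev.fderiv_eq]
    exact equation_pot_norm D.φ_cont hs x
  · exact hu.pos D hα hl (norm_nonneg x) (by simpa using hx)
  · have : ‖x‖ = 1 := by simpa using hx
    simp only [this, hu.apply_one]

lemma IsClassicalSolution.nonneg {w : Plane → ℝ} (hw : IsClassicalSolution f φ ψ α lam w)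
    {x : Plane} (hx : x ∈ Metric.closedBall (0 : Plane) 1) : 0 ≤ w x := by
  rcases (Metric.mem_closedBall.1 hx).lt_or_eq with h | h
  · exact (hw.pos x h).le
  · exact (hw.boundary x h).ge

/-- The comparison principle acts on the whole disk, so `w` need not be radial. Allowing `lam ≤ mu`
makes one induction serve both minimality and monotonicity in the parameter. -/
lemma IsClassicalSolution.picardIter_le {w : Plane → ℝ} (hw : IsClassicalSolution f φ ψ α mu w)
    (D : RadialData f φ ψ) (hl : 0 ≤ lam) (hlm : lam ≤ mu) (n : ℕ) :
    ∀ x ∈ Metric.closedBall (0 : Plane) 1, picardIter f φ ψ α lam n ‖x‖ ≤ w x := by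
  induction n with
  | zero => exact fun x hx => hw.nonneg hx
  | succ n ih =>
    have hs := D.continuous_source (lam := lam) (D.continuous_picardIter (α := α) (lam := lam) n)
    have hU := contDiff_pot_norm (α := α) D.φ_cont hs
    have h := le_of_subsolution_of_supersolution (α := α) D.φ_cont hU.contDiffOn hw.contDiffOn
      hU.continuous.continuousOn hw.continuousOn (fun x hx => ?_) (fun x hx => ?_)
    · intro x hx
      have := h x hx
      rwa [picardIter, picard, clamp_of_mem (norm_mem_Icc hx)]
    · rw [equation_pot_norm D.φ_cont hs, hw.equation x hx]
      exact D.source_le_source (v := fun _ => w x) hl hlm (ih x (Metric.ball_subset_closedBall hx))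
    · have : ‖x‖ = 1 := by simpa using hx
      simp only [this, pot_one]
      exact (hw.boundary x hx).ge

lemma IsClassicalSolution.exists_picardIter_le {w : Plane → ℝ}
    (hw : IsClassicalSolution f φ ψ α mu w) (D : RadialData f φ ψ) (hl : 0 ≤ lam)
    (hlm : lam ≤ mu) : ∃ B, ∀ n, ∀ r ∈ Icc (0 : ℝ) 1, picardIter f φ ψ α lam n r ≤ B := by
  obtain ⟨B, hB⟩ := (isCompact_closedBall (0 : Plane) 1).bddAbove_image hw.continuousOn
  refine ⟨B, fun n r hr => ?_⟩
  set x : Plane := EuclideanSpace.single 0 r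
  have hx : ‖x‖ = r := by simp [x, abs_of_nonneg hr.1]
  have hxb : x ∈ Metric.closedBall (0 : Plane) 1 := by simpa [hx] using hr.2
  have := hw.picardIter_le D hl hlm n x hxb
  rw [hx] at this
  exact this.trans (hB ⟨x, hxb, rfl⟩)

lemma IsClassicalSolution.isRadialSolution_minProfile {w : Plane → ℝ}
    (hw : IsClassicalSolution f φ ψ α mu w) (D : RadialData f φ ψ) (hα : 0 ≤ α) (hl : 0 ≤ lam)
    (hlm : lam ≤ mu) : IsRadialSolution f φ ψ α lam (minProfile f φ ψ α lam) := by
  obtain ⟨B, hB⟩ := hw.exists_picardIter_le D hl hlm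
  exact D.isRadialSolution_minProfile hα hl hB

lemma IsClassicalSolution.minProfile_le {w : Plane → ℝ}
    (hw : IsClassicalSolution f φ ψ α mu w) (D : RadialData f φ ψ) (hl : 0 ≤ lam)
    (hlm : lam ≤ mu) : ∀ x ∈ Metric.closedBall (0 : Plane) 1, minProfile f φ ψ α lam ‖x‖ ≤ w x :=
  fun x hx => ciSup_le fun n => hw.picardIter_le D hl hlm n x hx

lemma IsClassicalSolution.isMinimalSolution_minProfile {w : Plane → ℝ}
    (hw : IsClassicalSolution f φ ψ α mu w) (D : RadialData f φ ψ) (hα : 0 ≤ α) (hl : 0 < lam)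
    (hlm : lam ≤ mu) :
    IsMinimalSolution f φ ψ α lam fun x => minProfile f φ ψ α lam ‖x‖ :=
  ⟨(hw.isRadialSolution_minProfile D hα hl.le hlm).isClassicalSolution D hα hl,
    fun _ hw' => hw'.minProfile_le D hl.le le_rfl⟩

lemma IsMinimalSolution.eqOn {u₁ u₂ : Plane → ℝ} (h₁ : IsMinimalSolution f φ ψ α lam u₁)
    (h₂ : IsMinimalSolution f φ ψ α lam u₂) : EqOn u₁ u₂ (Metric.closedBall 0 1) := fun x hx =>
  le_antisymm (h₁.le_of_isSolution u₂ h₂.isSolution x hx)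
    (h₂.le_of_isSolution u₁ h₁.isSolution x hx)

end data

/-! ### Growth of the nonlinearity and its time map. -/

section nonlinearity

variable {f φ ψ : ℝ → ℝ} {α lam mu : ℝ} {u v : ℝ → ℝ}

/-- The time map `s ↦ ∫₀ˢ dt / f(t)`. -/
noncomputable def timeMap (f : ℝ → ℝ) (s : ℝ) : ℝ := ∫ t in (0 : ℝ)..s, 1 / f t

lemma RadialData.hasDerivAt_timeMap (D : RadialData f φ ψ) (s : ℝ) :
    HasDerivAt (timeMap f) (1 / f s) s :=
  (Continuous.integral_hasStrictDerivAt
    (continuous_const.div D.f_cont fun t => (D.f_pos t).ne') 0 s).hasDerivAt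

lemma RadialData.strictMono_timeMap (D : RadialData f φ ψ) : StrictMono (timeMap f) := by
  refine strictMono_of_deriv_pos fun s => ?_
  rw [(D.hasDerivAt_timeMap s).deriv]
  exact one_div_pos.2 (D.f_pos s)

lemma timeMap_zero : timeMap f 0 = 0 := by simp [timeMap]

lemma RadialData.tendsto_timeMap (D : RadialData f φ ψ) :
    Tendsto (timeMap f) atTop (𝓝 (∫ t in Ioi 0, 1 / f t)) :=
  intervalIntegral_tendsto_integral_Ioi 0 D.f_int tendsto_id

lemma RadialData.timeMap_lt (D : RadialData f φ ψ) (s : ℝ) :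
    timeMap f s < ∫ t in Ioi 0, 1 / f t :=
  (D.strictMono_timeMap (lt_add_one s)).trans_le
    (D.strictMono_timeMap.monotone.ge_of_tendsto D.tendsto_timeMap _)

/-- On $[1,S]$ convexity puts $f$ below its chord, so $f(\sigma)\le\kappa\sigma$ with
$\kappa=f(0)+f(S)/S$, and $\int_{\sqrt S}^S 1/f\ge \log S/(2\kappa)$. This piece of a convergent
integral tends to $0$, which forces $\kappa$ to exceed any multiple of $\log S$. -/
lemma RadialData.superlinear_log (D : RadialData f φ ψ) {C : ℝ} (hC : 0 ≤ C) :
    ∀ᶠ s in atTop, C * (s * Real.log s) ≤ f s := by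
  have hf0 := D.f_pos 0
  set F := ∫ t in Ioi 0, 1 / f t with hF
  have hε : 0 < 1 / (2 * (C + f 0)) := by positivity
  have h1 : ∀ᶠ s : ℝ in atTop, F - 1 / (2 * (C + f 0)) < timeMap f (√s) :=
    (D.tendsto_timeMap.comp Real.tendsto_sqrt_atTop).eventually (lt_mem_nhds (by linarith))
  filter_upwards [h1, eventually_ge_atTop 3] with S hS hS3
  have hS0 : 0 < S := by linarith
  have hsq1 : 1 ≤ √S := Real.one_le_sqrt.2 (by linarith)
  have hsqS : √S ≤ S := by
    nlinarith [Real.sq_sqrt hS0.le]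
  have hlog : 1 ≤ Real.log S := by
    rw [Real.le_log_iff_exp_le hS0]
    linarith [Real.exp_one_lt_d9]
  set κ := f 0 + f S / S with hκ
  have hfS := D.f_pos S
  have hκ0 : 0 < κ := by positivity
  have hle : ∀ σ ∈ Icc 1 S, f σ ≤ κ * σ := by
    intro σ hσ
    have hc := D.f_convex.2 (mem_univ (0 : ℝ)) (mem_univ S)
      (sub_nonneg.2 ((div_le_one hS0).2 hσ.2)) (div_nonneg (by linarith [hσ.1]) hS0.le)
      (sub_add_cancel 1 (σ / S))
    simp only [smul_eq_mul, mul_zero, zero_add] at hc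
    rw [div_mul_cancel₀ _ hS0.ne'] at hc
    have h2 : (1 - σ / S) * f 0 ≤ σ * f 0 := by
      have : 0 ≤ σ / S := div_nonneg (by linarith [hσ.1]) hS0.le
      nlinarith [hσ.1]
    have h3 : σ / S * f S = σ * (f S / S) := by ring
    rw [hκ]
    linarith
  have hmono : timeMap f (√S) - Real.log (√S) / κ ≤ timeMap f S - Real.log S / κ := by
    have hd : ∀ t, 0 < t → HasDerivAt (fun t => timeMap f t - Real.log t / κ)
        (1 / f t - t⁻¹ / κ) t := fun t ht =>
      (D.hasDerivAt_timeMap t).sub ((Real.hasDerivAt_log ht.ne').div_const κ)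
    refine le_of_hasDerivAt_nonneg hsqS
      (fun t ht => (hd t (by linarith [ht.1])).continuousAt.continuousWithinAt)
      (fun t ht => hd t (by linarith [ht.1])) fun t ht => ?_
    have ht0 : 0 < t := by linarith [ht.1]
    have h5 := hle t ⟨by linarith [ht.1], ht.2.le⟩
    have h6 : t⁻¹ / κ = 1 / (κ * t) := by field_simp
    rw [h6]
    exact sub_nonneg.2 (one_div_le_one_div_of_le (D.f_pos t) h5)
  rw [Real.log_sqrt hS0.le] at hmono
  have h7 := D.timeMap_lt S
  rw [← hF] at h7
  have h8 : Real.log S / κ - Real.log S / 2 / κ < 1 / (2 * (C + f 0)) := by linarith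
  have h9 : Real.log S / κ - Real.log S / 2 / κ = Real.log S / (2 * κ) := by field_simp; ring
  rw [h9, div_lt_div_iff₀ (by positivity) (by positivity)] at h8
  have h10 : C * Real.log S ≤ f S / S := by
    have : (C + f 0) * Real.log S ≤ κ := by linarith
    have : f 0 * 1 ≤ f 0 * Real.log S := by gcongr
    linarith
  rw [le_div_iff₀ hS0] at h10
  linarith

lemma RadialData.superlinear (D : RadialData f φ ψ) {C : ℝ} (hC : 0 ≤ C) :
    ∀ᶠ s in atTop, C * s < f s := by
  filter_upwards [D.superlinear_log (C := C + 1) (by linarith), eventually_ge_atTop 3] with s h1 h2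
  have hlog : 1 ≤ Real.log s := by
    rw [Real.le_log_iff_exp_le (by linarith)]
    linarith [Real.exp_one_lt_d9]
  have h3 : (C + 1) * (s * 1) ≤ (C + 1) * (s * Real.log s) := by
    have : 0 ≤ s := by linarith
    gcongr
  linarith

lemma RadialData.hasDerivAt_f (D : RadialData f φ ψ) {s : ℝ} (hs : 0 < s) :
    HasDerivAt f (deriv f s) s :=
  ((D.f_diff.contDiffAt (Ioi_mem_nhds hs)).differentiableAt (by simp)).hasDerivAt

lemma RadialData.continuousOn_deriv_f (D : RadialData f φ ψ) : ContinuousOn (deriv f) (Ioi 0) :=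
  D.f_diff.continuousOn_deriv_of_isOpen isOpen_Ioi (by simp)

lemma RadialData.deriv_f_nonneg (D : RadialData f φ ψ) (s : ℝ) : 0 ≤ deriv f s :=
  D.f_mono.deriv_nonneg

lemma RadialData.deriv_f_mono (D : RadialData f φ ψ) {s t : ℝ} (hs : 0 < s) (hst : s ≤ t) :
    deriv f s ≤ deriv f t := by
  have h : MonotoneOn (deriv f) (Ioi 0) :=
    (D.f_convex.subset (subset_univ _) (convex_Ioi 0)).monotoneOn_deriv
      fun x hx => (D.hasDerivAt_f hx).differentiableAt
  exact h hs (hs.trans_le hst) hst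

lemma RadialData.tangent_le (D : RadialData f φ ψ) {s t : ℝ} (hs : 0 < s) (hst : s ≤ t) :
    deriv f s * (t - s) ≤ f t - f s := by
  rcases hst.eq_or_lt with rfl | h
  · simp
  · have := D.f_convex.le_slope_of_hasDerivAt (mem_univ s) (mem_univ t) h (D.hasDerivAt_f hs)
    rw [slope_def_field, le_div_iff₀ (sub_pos.2 h)] at this
    exact this

end nonlinearity

/-! ### A priori estimates for radial solutions. -/

section estimates

variable {f φ ψ : ℝ → ℝ} {α lam mu : ℝ} {u v : ℝ → ℝ}

lemma RadialData.pot_ψ_pos (D : RadialData f φ ψ) (hα : 0 ≤ α) : 0 < pot φ α ψ 0 :=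
  pot_pos D.φ_cont D.φ_nonneg hα D.ψ_cont le_rfl one_pos (by rw [D.ψ_zero]; exact one_pos)
    fun s _ => D.ψ_nonneg s

/-- Along a radial solution the time map decreases at least as fast as the torsion profile. -/
lemma IsRadialSolution.le_timeMap_sub (hu : IsRadialSolution f φ ψ α lam u)
    (D : RadialData f φ ψ) (hl : 0 ≤ lam) {r : ℝ} (hr : r ∈ Icc (0 : ℝ) 1) :
    lam * (pot φ α ψ 0 - pot φ α ψ r) ≤ timeMap f (u 0) - timeMap f (u r) := by
  have hs := D.continuous_source (lam := lam) hu.cont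
  have hd : ∀ t ∈ Ioo 0 r, HasDerivAt (fun t => lam * pot φ α ψ t - timeMap f (u t))
      (lam * -flux φ α ψ t - 1 / f (u t) * -flux φ α (source f ψ lam u) t) t := fun t ht =>
    ((hasDerivAt_pot D.φ_cont D.ψ_cont t).const_mul lam).sub
      ((D.hasDerivAt_timeMap (u t)).comp t (hu.hasDerivAt D ⟨ht.1, ht.2.trans_le hr.2⟩))
  have hc : Continuous fun t => lam * pot φ α ψ t - timeMap f (u t) := by
    have h1 := continuous_pot (α := α) D.φ_cont D.ψ_cont
    have h2 : Continuous (timeMap f) :=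
      continuous_iff_continuousAt.2 fun s => (D.hasDerivAt_timeMap s).continuousAt
    exact (h1.const_mul lam).sub (h2.comp hu.cont)
  have h := le_of_hasDerivAt_nonneg hr.1 hc.continuousOn hd fun t ht => ?_
  · linarith
  -- Since `u` decreases, `f (u s)` is at least `f (u t)` throughout `[0, t]` and the latter can be
  -- taken out of the flux.
  · have h1 : lam * f (u t) * flux φ α ψ t ≤ flux φ α (source f ψ lam u) t := by
      rw [← flux_const_mul]
      refine flux_le_flux D.φ_cont (D.ψ_cont.const_mul _) hs ht.1.le fun s hs => ?_
      have h2 : f (u t) ≤ f (u s) := D.f_mono (hu.antitone D hl hs.2)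
      calc lam * f (u t) * ψ s = lam * ψ s * f (u t) := by ring
        _ ≤ lam * ψ s * f (u s) :=
          mul_le_mul_of_nonneg_left h2 (mul_nonneg hl (D.ψ_nonneg s))
    have h3 := D.f_pos (u t)
    have h4 : lam * flux φ α ψ t ≤ 1 / f (u t) * flux φ α (source f ψ lam u) t := by
      rw [one_div, inv_mul_eq_div, le_div_iff₀ h3]
      linarith
    linarith

lemma IsRadialSolution.mul_pot_lt (hu : IsRadialSolution f φ ψ α lam u)
    (D : RadialData f φ ψ) (hl : 0 ≤ lam) :
    lam * pot φ α ψ 0 < ∫ t in Ioi 0, 1 / f t := by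
  have h := hu.le_timeMap_sub D hl (r := 1) ⟨zero_le_one, le_rfl⟩
  rw [pot_one, hu.apply_one, timeMap_zero] at h
  have := D.timeMap_lt (u 0)
  linarith

/-- The constant `1` is a supersolution for such parameters; this also provides the lower bound on
the extremal parameter. -/
lemma RadialData.exists_isRadialSolution_of_le (D : RadialData f φ ψ) (hα : 0 ≤ α)
    (hl : 0 ≤ lam) (h : lam * f 1 * pot φ α ψ 0 ≤ 1) : ∃ u, IsRadialSolution f φ ψ α lam u := by
  refine D.exists_isRadialSolution_of_supersolution (v := fun _ => 1) hα hl continuous_const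
    (fun _ _ => zero_le_one) fun r hr => ?_
  have h1 : source f ψ lam (fun _ => 1) = fun s => lam * f 1 * ψ s := by
    funext s
    simp only [source]
    ring
  rw [h1, pot_const_mul]
  refine le_trans (mul_le_mul_of_nonneg_left ?_ (mul_nonneg hl (D.f_pos 1).le)) h
  exact pot_anti D.φ_cont D.ψ_cont le_rfl hr.1 fun t _ => D.ψ_nonneg t

/-- The mass only grows outwards, so the flux on $[b,2b]$ is at least $m/(2bA(2b))$. Its integral
there is $u(b)-u(2b)\le u(b)$. -/
lemma IsRadialSolution.mass_le (hu : IsRadialSolution f φ ψ α lam u) (D : RadialData f φ ψ)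
    (hα : 0 ≤ α) (hl : 0 ≤ lam) {b : ℝ} (hb : 0 < b) (hb1 : 2 * b ≤ 1) :
    mass φ α (source f ψ lam u) b ≤ 2 * weight φ α (2 * b) * u b := by
  have hs := D.continuous_source (lam := lam) hu.cont
  set m := mass φ α (source f ψ lam u) b
  set A := weight φ α (2 * b)
  have hA : 0 < A := weight_pos _
  have hm : 0 ≤ m := mass_nonneg hb.le fun s _ => D.source_nonneg hl s
  have h1 : u b - u (2 * b) = ∫ t in b..2 * b, flux φ α (source f ψ lam u) t := by
    rw [hu.eq_pot ⟨hb.le, by linarith⟩, hu.eq_pot ⟨by linarith, hb1⟩, pot_sub_eq D.φ_cont hs]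
  have h2 : ∫ t in b..2 * b, m / (2 * b * A) ≤ ∫ t in b..2 * b, flux φ α (source f ψ lam u) t := by
    refine intervalIntegral.integral_mono_on (by linarith) (by simp)
      ((continuous_flux D.φ_cont hs).intervalIntegrable _ _) fun t ht => ?_
    have ht0 : 0 < t := hb.trans_le ht.1
    refine div_le_div₀ (mass_nonneg ht0.le fun s _ => D.source_nonneg hl s)
      (mass_mono_right D.φ_cont hs hb.le ht.1 fun s _ => D.source_nonneg hl s)
      (mul_pos ht0 (weight_pos t)) ?_
    exact mul_le_mul ht.2 (weight_mono D.φ_cont D.φ_nonneg hα ht0.le ht.2) (weight_pos t).le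
      (by linarith)
  rw [intervalIntegral.integral_const, smul_eq_mul, ← h1] at h2
  have h3 : (2 * b - b) * (m / (2 * b * A)) = m / (2 * A) := by field_simp; ring
  have h4 := hu.nonneg D hl (2 * b)
  rw [h3, div_le_iff₀ (by positivity)] at h2
  nlinarith

/-- Stability estimate, from a Riccati inequality for the quotient of the flux and the values of
the difference of two ordered solutions. -/
lemma IsRadialSolution.mass_deriv_le (hu : IsRadialSolution f φ ψ α lam u)
    (hv : IsRadialSolution f φ ψ α mu v) (D : RadialData f φ ψ) (hα : 0 ≤ α) (hl : 0 < lam)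
    (hlm : lam < mu) (huv : ∀ r, u r ≤ v r) {t b : ℝ} (ht : 0 < t) (htb : t < b) (hb : b < 1)
    {g : ℝ → ℝ} (hg : Continuous g) (hgu : ∀ s ∈ Icc 0 b, g s = deriv f (u s)) :
    mass φ α (fun s => lam * ψ s * g s) t * Real.log (b / t) ≤ weight φ α b := by
  have hsu := D.continuous_source (lam := lam) hu.cont
  have hsv := D.continuous_source (lam := mu) hv.cont
  set q : ℝ → ℝ := fun s => mass φ α (source f ψ mu v) s - mass φ α (source f ψ lam u) s with hq
  set w : ℝ → ℝ := fun s => v s - u s with hw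
  have hqd : ∀ s, HasDerivAt q (s * weight φ α s * source f ψ mu v s
      - s * weight φ α s * source f ψ lam u s) s := fun s =>
    (hasDerivAt_mass D.φ_cont hsv s).sub (hasDerivAt_mass D.φ_cont hsu s)
  have hwd : ∀ s ∈ Ioo (0 : ℝ) 1, HasDerivAt w (-(q s / (s * weight φ α s))) s := fun s hs => by
    refine ((hv.hasDerivAt D hs).sub (hu.hasDerivAt D hs)).congr_deriv ?_
    simp only [flux, hq]
    ring
  have hqpos : ∀ s, 0 < s → 0 < q s := by
    intro s hs
    have hc : Continuous fun r => source f ψ mu v r - source f ψ lam u r := hsv.sub hsu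
    have h1 := mass_pos (α := α) D.φ_cont D.φ_nonneg hα hc hs (by
      simp only [source, D.ψ_zero, mul_one]
      have h2 := D.f_mono (huv 0)
      have h3 := D.f_pos (u 0)
      nlinarith) fun r _ => sub_nonneg.2 (D.source_le_source hl.le hlm.le (huv r))
    have h2 : mass φ α (fun r => source f ψ mu v r - source f ψ lam u r) s = q s := by
      simp only [hq, mass]
      rw [← intervalIntegral.integral_sub
        ((continuous_mass_integrand D.φ_cont hsv).intervalIntegrable _ _)
        ((continuous_mass_integrand D.φ_cont hsu).intervalIntegrable _ _)]
      congr 1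
      ext r
      ring
    rwa [h2] at h1
  have hwc : Continuous w := hv.cont.sub hu.cont
  have hwpos : ∀ s ∈ Ico (0 : ℝ) 1, 0 < w s := by
    have hanti : StrictAntiOn w (Icc 0 1) := by
      refine strictAntiOn_of_deriv_neg (convex_Icc 0 1) hwc.continuousOn fun s hs => ?_
      rw [interior_Icc] at hs
      rw [(hwd s hs).deriv]
      exact neg_neg_of_pos (div_pos (hqpos s hs.1) (mul_pos hs.1 (weight_pos s)))
    intro s hs
    have := hanti ⟨hs.1, hs.2.le⟩ ⟨zero_le_one, le_rfl⟩ hs.2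
    simp only [hw, hu.apply_one, hv.apply_one, sub_zero] at this
    exact this
  -- Here $q=-sAw'$, so `θ` is minus the weighted logarithmic derivative of the difference `w`.
  -- Convexity of $f$ then gives $\theta'\ge sA\lambda\psi f'(u)+\theta^2/(sA)$.
  set θ : ℝ → ℝ := fun s => q s / w s with hθ
  have hθpos : ∀ s ∈ Ioo (0 : ℝ) 1, 0 < θ s := fun s hs =>
    div_pos (hqpos s hs.1) (hwpos s ⟨hs.1.le, hs.2⟩)
  set θ' : ℝ → ℝ := fun s => (s * weight φ α s * source f ψ mu v s
      - s * weight φ α s * source f ψ lam u s) / w s + θ s ^ 2 / (s * weight φ α s) with hθ'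
  have hθd : ∀ s ∈ Ioo (0 : ℝ) 1, HasDerivAt θ (θ' s) s := fun s hs => by
    have hw0 := (hwpos s ⟨hs.1.le, hs.2⟩).ne'
    refine ((hqd s).fun_div (hwd s hs) hw0).congr_deriv ?_
    simp only [hθ', hθ]
    have := (weight_pos (φ := φ) (α := α) s).ne'
    have := hs.1.ne'
    field_simp
    ring
  have hgu' : ∀ s ∈ Ioo (0 : ℝ) b, s * weight φ α s * (lam * ψ s * g s)
      + θ s ^ 2 / (s * weight φ α s) ≤ θ' s := by
    intro s hs
    have hs1 : s < 1 := hs.2.trans hb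
    have hw0 := hwpos s ⟨hs.1.le, hs1⟩
    have hup := hu.pos D hα hl hs.1.le hs1
    rw [hgu s ⟨hs.1.le, hs.2.le⟩]
    have h1 := D.tangent_le hup (huv s)
    refine add_le_add_left ?_ _
    rw [le_div_iff₀ hw0, ← mul_sub, mul_assoc]
    refine mul_le_mul_of_nonneg_left ?_ (mul_nonneg hs.1.le (weight_pos s).le)
    have h2 := mul_le_mul_of_nonneg_left h1 (mul_nonneg hl.le (D.ψ_nonneg s))
    have h3 : lam * ψ s * f (v s) ≤ source f ψ mu v s :=
      D.source_le_source hl.le hlm.le le_rfl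
    simp only [source, hw] at *
    linarith
  -- Integrating the linear term of the Riccati inequality from `0`, where `θ` vanishes, bounds `θ
  -- t` below.
  have hθ0 : mass φ α (fun s => lam * ψ s * g s) t ≤ θ t := by
    have hcg : Continuous fun s => lam * ψ s * g s := (D.ψ_cont.const_mul lam).mul hg
    have h := le_of_hasDerivAt_nonneg (F := fun s => θ s - mass φ α (fun s => lam * ψ s * g s) s)
      ht.le ?_ (fun s hs => (hθd s ⟨hs.1, hs.2.trans (htb.trans hb)⟩).sub
        (hasDerivAt_mass D.φ_cont hcg s)) fun s hs => ?_
    · simp only [hθ, hq, mass_zero, sub_self, zero_div] at h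
      linarith
    · refine ContinuousOn.sub (ContinuousOn.div ?_ hwc.continuousOn fun s hs => ?_)
        (continuous_mass D.φ_cont hcg).continuousOn
      · exact (continuous_iff_continuousAt.2 fun s => (hqd s).continuousAt).continuousOn
      · exact (hwpos s ⟨hs.1, hs.2.trans_lt (htb.trans hb)⟩).ne'
    · have h1 := hgu' s ⟨hs.1, hs.2.trans htb⟩
      have h2 : 0 ≤ θ s ^ 2 / (s * weight φ α s) :=
        div_nonneg (sq_nonneg _) (mul_nonneg hs.1.le (weight_pos s).le)
      linarith
  have hB : 0 < weight φ α b := weight_pos b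
  have hd2 : ∀ s ∈ Ioo (0 : ℝ) 1, HasDerivAt (fun s => -(θ s)⁻¹ - Real.log s / weight φ α b)
      (-(-θ' s / θ s ^ 2) - s⁻¹ / weight φ α b) s := fun s hs =>
    ((hθd s hs).fun_inv (hθpos s hs).ne').fun_neg.sub
      ((Real.hasDerivAt_log hs.1.ne').div_const _)
  -- The quadratic term bounds `θ t` above: $(-1/\theta)'\ge1/(sA)\ge1/(sA(b))$, integrated over
  -- $[t,b]$. The logarithm is the two-dimensional feature.
  have h := le_of_hasDerivAt_nonneg (F := fun s => -(θ s)⁻¹ - Real.log s / weight φ α b)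
    htb.le (fun s hs => (hd2 s ⟨ht.trans_le hs.1, hs.2.trans_lt hb⟩).continuousAt.continuousWithinAt)
    (fun s hs => hd2 s ⟨ht.trans hs.1, hs.2.trans hb⟩) fun s hs => ?_
  · have hθb := hθpos b ⟨ht.trans htb, hb⟩
    have hθt := hθpos t ⟨ht, htb.trans hb⟩
    have h1 : Real.log (b / t) / weight φ α b ≤ (θ t)⁻¹ := by
      rw [Real.log_div (ht.trans htb).ne' ht.ne', sub_div]
      have := inv_pos.2 hθb
      linarith
    have hlog : 0 ≤ Real.log (b / t) := Real.log_nonneg ((one_le_div ht).2 htb.le)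
    rw [div_le_iff₀ hB, inv_mul_eq_div, le_div_iff₀ hθt] at h1
    nlinarith
  · have hs0 : 0 < s := ht.trans hs.1
    have h1 := hgu' s ⟨hs0, hs.2⟩
    have hθs := hθpos s ⟨hs0, hs.2.trans hb⟩
    have hws := weight_pos (φ := φ) (α := α) s
    have h2 : 0 ≤ s * weight φ α s * (lam * ψ s * g s) := by
      rw [hgu s ⟨hs0.le, hs.2.le⟩]
      exact mul_nonneg (mul_nonneg hs0.le hws.le)
        (mul_nonneg (mul_nonneg hl.le (D.ψ_nonneg s)) (D.deriv_f_nonneg _))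
    have h3 : θ s ^ 2 / (s * weight φ α s) ≤ θ' s := by linarith
    have h4 : 1 / (s * weight φ α s) ≤ θ' s / θ s ^ 2 := by
      rw [le_div_iff₀ (by positivity)]
      calc _ = θ s ^ 2 / (s * weight φ α s) := by ring
        _ ≤ _ := h3
    have h5 : s⁻¹ / weight φ α b ≤ 1 / (s * weight φ α s) := by
      rw [inv_eq_one_div, div_div]
      exact one_div_le_one_div_of_le (by positivity)
        (mul_le_mul_of_nonneg_left (weight_mono D.φ_cont D.φ_nonneg hα hs0.le hs.2.le) hs0.le)
    rw [neg_div, neg_neg]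
    linarith

end estimates

/-! ### Uniform bounds and the extremal solution at fixed drift. -/

section extremal

variable {f φ ψ : ℝ → ℝ} {α lam mu : ℝ} {u v : ℝ → ℝ}

/-- The mass on `[0, t]` is bounded above by `IsRadialSolution.mass_le` and below through
monotonicity of `u`. Superlinear growth of `f` turns the resulting inequality into a bound for `u
t`. -/
lemma IsRadialSolution.apply_le_of_superlinear (hu : IsRadialSolution f φ ψ α lam u)
    (D : RadialData f φ ψ) (hα : 0 ≤ α) (hl : 0 < lam) {t : ℝ} (ht : 0 < t) (ht1 : 2 * t ≤ 1)
    (hψ : 1 / 2 ≤ ψ t) :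
    f (u t) * (lam * t ^ 2) ≤ 8 * weight φ α (2 * t) * u t := by
  have h1 := hu.mass_le D hα hl.le ht ht1
  have h2 := le_mass_of_le (α := α) D.φ_cont D.φ_nonneg hα
    (D.continuous_source (lam := lam) hu.cont) (c := lam * (1 / 2) * f (u t))
    (mul_nonneg (by positivity) (D.f_pos _).le) ht.le fun s hs => by
      have h3 : 1 / 2 ≤ ψ s := hψ.trans (D.ψ_anti hs.2)
      exact mul_le_mul (mul_le_mul_of_nonneg_left h3 hl.le)
        (D.f_mono (hu.antitone D hl.le hs.2)) (D.f_pos _).le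
        (mul_nonneg hl.le (D.ψ_nonneg s))
  nlinarith

/-- The larger solution `v` serves only to make `u` stable. Stability makes the mass of `f'(u)`
small on `[0, t₀]`; two differential inequalities then control the slope of `u` there by its value
at `t₀`, which superlinearity bounds. -/
lemma RadialData.exists_apply_zero_le (D : RadialData f φ ψ) (hα : 0 ≤ α) {l₀ : ℝ} (Λ : ℝ)
    (hl₀ : 0 < l₀) :
    ∃ K, ∀ lam mu u v, l₀ ≤ lam → lam ≤ Λ → lam < mu → IsRadialSolution f φ ψ α lam u →
      IsRadialSolution f φ ψ α mu v → (∀ r, u r ≤ v r) → u 0 ≤ K := by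
  set a := weight φ α 1 with ha
  have ha1 : 1 ≤ a := one_le_weight D.φ_cont D.φ_nonneg hα zero_le_one
  have ha0 : 0 < a := by linarith
  have hwle : ∀ s ∈ Icc (0 : ℝ) 1, weight φ α s ≤ a := fun s hs =>
    weight_mono D.φ_cont D.φ_nonneg hα hs.1 hs.2
  have hwge : ∀ s, 0 ≤ s → 1 ≤ weight φ α s := fun s hs =>
    one_le_weight D.φ_cont D.φ_nonneg hα hs
  obtain ⟨b, hb, hb2, hψ⟩ := exists_half_le D.ψ_cont (by rw [D.ψ_zero]; exact one_pos)
    (t := 1 / 2) (by norm_num)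
  rw [D.ψ_zero] at hψ
  -- Chosen so that $\log(b/t_0)=8a^2$: with $\psi\ge1/2$ the stability estimate becomes $a\lambda
  -- N(t_0)\le1/4$.
  set t₀ := b * Real.exp (-(8 * a ^ 2)) with ht₀
  have ht₀0 : 0 < t₀ := by positivity
  have ht₀b : t₀ < b := by
    have : Real.exp (-(8 * a ^ 2)) < 1 := by
      rw [Real.exp_lt_one_iff]
      have : 0 < 8 * a ^ 2 := by positivity
      linarith
    nlinarith
  have hlog : Real.log (b / t₀) = 8 * a ^ 2 := by
    rw [ht₀, div_mul_cancel_left₀ hb.ne', Real.log_inv, Real.log_exp, neg_neg]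
  obtain ⟨S, hS⟩ := eventually_atTop.1 (D.superlinear (C := 8 * a / (l₀ * t₀ ^ 2)) (by positivity))
  refine ⟨S + Λ * a * t₀ ^ 2 * f S, fun lam mu u v hl₀l hlΛ hlm hu hv huv => ?_⟩
  have hl : 0 < lam := hl₀.trans_le hl₀l
  have hub : 0 < u b := hu.pos D hα hl hb.le (by linarith)
  -- The cutoff keeps the argument away from `0`, where `f'` may fail to be continuous, and changes
  -- nothing on `[0, b]`.
  set g : ℝ → ℝ := fun s => deriv f (max (u s) (u b)) with hg
  have hgc : Continuous g :=
    D.continuousOn_deriv_f.comp_continuous (hu.cont.max continuous_const)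
      fun s => lt_max_of_lt_right hub
  have hg0 : ∀ s, 0 ≤ g s := fun s => D.deriv_f_nonneg _
  have hgu : ∀ s ∈ Icc 0 b, g s = deriv f (u s) := fun s hs => by
    simp only [hg]
    rw [max_eq_left (hu.antitone D hl.le hs.2)]
  have hganti : ∀ s t, s ≤ t → g t ≤ g s := fun s t hst =>
    D.deriv_f_mono (lt_max_of_lt_right hub) (max_le_max (hu.antitone D hl.le hst) le_rfl)
  set N : ℝ → ℝ := mass φ α g with hN
  have hNsmall : ∀ t ∈ Ioc 0 t₀, a * (lam * N t) ≤ 1 / 4 := by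
    intro t ht
    have h1 := hu.mass_deriv_le hv D hα hl hlm huv ht₀0 ht₀b (by linarith) hgc hgu
    have hcψ : Continuous fun s => lam * ψ s * g s := (D.ψ_cont.const_mul lam).mul hgc
    have h2 : mass φ α (fun s => lam / 2 * g s) t₀ ≤ mass φ α (fun s => lam * ψ s * g s) t₀ := by
      refine mass_le_mass D.φ_cont (hgc.const_mul _) hcψ ht₀0.le fun s hs => ?_
      have h3 := hψ s ⟨hs.1, hs.2.trans ht₀b.le⟩
      refine mul_le_mul_of_nonneg_right ?_ (hg0 s)
      nlinarith
    rw [mass_const_mul] at h2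
    have h3 : N t ≤ N t₀ := mass_mono_right D.φ_cont hgc ht.1.le ht.2 fun s _ => hg0 s
    have h4 : weight φ α b ≤ a := hwle b ⟨hb.le, by linarith⟩
    rw [hlog] at h1
    have h5 : a * (a * (lam * N t₀)) ≤ a * (1 / 4) := by nlinarith
    have h6 := le_of_mul_le_mul_left h5 ha0
    have h7 : a * (lam * N t) ≤ a * (lam * N t₀) := by gcongr
    linarith
  have hs := D.continuous_source (lam := lam) hu.cont
  set P : ℝ → ℝ := mass φ α (source f ψ lam u) with hP
  have hP0 : ∀ t, 0 ≤ t → 0 ≤ P t := fun t ht => mass_nonneg ht fun s _ => D.source_nonneg hl.le s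
  have hPd : ∀ t, HasDerivAt P (t * weight φ α t * source f ψ lam u t) t :=
    hasDerivAt_mass D.φ_cont hs
  set y : ℝ → ℝ := fun t => f (u t) with hy
  have hyc : Continuous y := D.f_cont.comp hu.cont
  have hy0 : ∀ t, 0 < y t := fun t => D.f_pos _
  have hyd : ∀ t ∈ Ioo 0 t₀, HasDerivAt y (g t * -(P t / (t * weight φ α t))) t := by
    intro t ht
    have ht1 : t < 1 := by linarith [ht.2]
    rw [hgu t ⟨ht.1.le, (ht.2.trans ht₀b).le⟩]
    exact (D.hasDerivAt_f (hu.pos D hα hl ht.1.le ht1)).comp t (hu.hasDerivAt D ⟨ht.1, ht1⟩)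
  -- The function $\lambda a(s^2y/2+PN/2)-P$ is nondecreasing: the terms in $gP$ add up to a
  -- multiple of $A-1/A\ge0$, and $P'\le\lambda asy$. Smallness of `N` absorbs the product `P * N`
  -- into `P`.
  have hPle : ∀ t ∈ Ioc 0 t₀, P t ≤ lam * a * t ^ 2 * y t := by
    intro t ht
    have h := le_of_hasDerivAt_nonneg
      (F := fun s => lam * a * (s ^ 2 / 2 * y s) + lam * a / 2 * (P s * N s) - P s) ht.1.le
      (by
        have := continuous_mass (α := α) D.φ_cont hs
        have := continuous_mass (α := α) D.φ_cont hgc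
        fun_prop)
      (fun s hs' => ((((((hasDerivAt_id s).fun_pow 2).div_const 2).fun_mul
        (hyd s ⟨hs'.1, hs'.2.trans_le ht.2⟩)).const_mul (lam * a)).add
        (((hPd s).fun_mul (hasDerivAt_mass D.φ_cont hgc s)).const_mul (lam * a / 2))).sub (hPd s))
      fun s hs' => ?_
    · simp only [hP, hN, mass_zero] at h
      have h1 := hNsmall t ht
      have h2 := hP0 t ht.1.le
      have h3 : lam * a / 2 * (P t * N t) ≤ P t / 8 := by nlinarith
      have h4 : 0 ≤ lam * a * t ^ 2 * y t :=
        mul_nonneg (by positivity) (hy0 t).le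
      nlinarith
    · have hs1 : s ≤ 1 := by linarith [hs'.2, ht.2]
      have hA1 := hwge s hs'.1.le
      have hA2 := hwle s ⟨hs'.1.le, hs1⟩
      set A := weight φ α s
      have hsp := hs'.1
      have hPs := hP0 s hsp.le
      have hNs : 0 ≤ mass φ α g s := mass_nonneg hsp.le fun r _ => hg0 r
      have hgs := hg0 s
      have hys := hy0 s
      have hsrc : s * A * source f ψ lam u s ≤ lam * a * (s * y s) := by
        have h1 : ψ s ≤ 1 := D.ψ_le_one hsp.le
        have h2 : A * ψ s ≤ a * 1 := mul_le_mul hA2 h1 (D.ψ_nonneg s) ha0.le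
        calc s * A * source f ψ lam u s = lam * s * y s * (A * ψ s) := by
              simp only [source, hy]; ring
          _ ≤ lam * s * y s * (a * 1) := mul_le_mul_of_nonneg_left h2 (by positivity)
          _ = _ := by ring
      have hsrc0 : 0 ≤ s * A * source f ψ lam u s :=
        mul_nonneg (by positivity) (D.source_nonneg hl.le s)
      have h5 : s ^ 2 / 2 * (g s * -(P s / (s * A))) + 1 / 2 * (P s * (s * A * g s))
          = s * g s * P s / 2 * (A - 1 / A) := by
        field_simp
        ring
      have h6 : 0 ≤ A - 1 / A := by
        rw [sub_nonneg, div_le_iff₀ (by linarith)]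
        nlinarith
      have h7 : 0 ≤ lam * a * (s * g s * P s / 2 * (A - 1 / A)) := by positivity
      have h8 : 0 ≤ lam * a / 2 * (s * A * source f ψ lam u s * mass φ α g s) := by positivity
      rw [← h5] at h7
      simp only [id]
      norm_num
      nlinarith
  -- The derivative of $sy^2$ is $y^2-2ygP/A$, nonnegative because $2gP\le y$. Thus $f(u)$ is at
  -- most of order $s^{-1/2}$ at the origin, and the slope of `u`, at most $\lambda asy$, stays
  -- bounded.
  have hZ : ∀ s ∈ Ioo 0 t₀, s * y s ^ 2 ≤ t₀ * y t₀ ^ 2 := by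
    intro s hs'
    refine le_of_hasDerivAt_nonneg (F := fun s => s * y s ^ 2) hs'.2.le (by fun_prop)
      (fun r hr => (hasDerivAt_id r).fun_mul ((hyd r ⟨hs'.1.trans hr.1, hr.2⟩).fun_pow 2))
      fun r hr => ?_
    have hr0 : 0 < r := hs'.1.trans hr.1
    have h1 := hPle r ⟨hr0, hr.2.le⟩
    have h2 := hNsmall r ⟨hr0, hr.2.le⟩
    have h3 : g r * (r ^ 2 / 2) ≤ N r :=
      le_mass_of_le D.φ_cont D.φ_nonneg hα hgc (hg0 r) hr0.le fun x hx => hganti x r hx.2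
    have hA1 := hwge r hr0.le
    set A := weight φ α r
    have hyr := hy0 r
    have hPr := hP0 r hr0.le
    have h4 : 2 * (g r * P r) ≤ y r := by
      calc 2 * (g r * P r) ≤ 2 * (g r * (lam * a * r ^ 2 * y r)) := by
            have := hg0 r
            gcongr
        _ = 4 * lam * a * y r * (g r * (r ^ 2 / 2)) := by ring
        _ ≤ 4 * lam * a * y r * N r := by gcongr
        _ = 4 * (a * (lam * N r)) * y r := by ring
        _ ≤ 4 * (1 / 4) * y r := by gcongr
        _ = y r := by ring
    have h5 : g r * P r / A ≤ g r * P r :=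
      div_le_self (mul_nonneg (hg0 r) hPr) hA1
    have h6 : id r * (((2 : ℕ) : ℝ) * y r ^ (2 - 1) * (g r * -(P r / (r * A))))
        = -(2 * y r * (g r * P r / A)) := by
      simp only [id]
      field_simp
      norm_num
      ring
    rw [h6]
    nlinarith
  have hfin : u 0 ≤ u t₀ + lam * a * (t₀ * y t₀) * t₀ := by
    have h := le_of_hasDerivAt_nonneg (F := fun s => u s + lam * a * (t₀ * y t₀) * s) ht₀0.le
      (by have := hu.cont; fun_prop)
      (fun s hs' => (hu.hasDerivAt D ⟨hs'.1, by linarith [hs'.2]⟩).add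
        ((hasDerivAt_id s).const_mul (lam * a * (t₀ * y t₀)))) fun s hs' => ?_
    · simpa using h
    · have h1 := hPle s ⟨hs'.1, hs'.2.le⟩
      have hA1 := hwge s hs'.1.le
      have hsp := hs'.1
      have h2 : s * y s ≤ t₀ * y t₀ := by
        have h3 := hZ s hs'
        refine le_of_sq_le_sq ?_ (mul_nonneg ht₀0.le (hy0 t₀).le)
        calc (s * y s) ^ 2 = s * (s * y s ^ 2) := by ring
          _ ≤ t₀ * (t₀ * y t₀ ^ 2) := mul_le_mul hs'.2.le h3 (by positivity) ht₀0.le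
          _ = _ := by ring
      have h4 : flux φ α (source f ψ lam u) s ≤ lam * a * (s * y s) := by
        rw [flux, div_le_iff₀ (by positivity)]
        have h5 : 0 ≤ lam * a * (s * y s) * s := by
          have := (hy0 s).le
          positivity
        calc P s ≤ lam * a * (s * y s) * s * 1 := by linarith
          _ ≤ lam * a * (s * y s) * s * weight φ α s := mul_le_mul_of_nonneg_left hA1 h5
          _ = _ := by ring
      have h6 : lam * a * (s * y s) ≤ lam * a * (t₀ * y t₀) := by gcongr
      linarith
  have hut : u t₀ ≤ S := by
    by_contra! hlt
    have h1 := hS _ hlt.le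
    have h2 := hu.apply_le_of_superlinear D hα hl ht₀0 (by linarith)
      (hψ t₀ ⟨ht₀0.le, ht₀b.le⟩)
    have h3 : weight φ α (2 * t₀) ≤ a := hwle _ ⟨by linarith, by linarith⟩
    have h4 := hu.nonneg D hl.le t₀
    rw [div_mul_eq_mul_div, div_lt_iff₀ (by positivity)] at h1
    have h5 : f (u t₀) * (l₀ * t₀ ^ 2) ≤ f (u t₀) * (lam * t₀ ^ 2) := by
      have := (D.f_pos (u t₀)).le
      gcongr
    have h6 : 8 * weight φ α (2 * t₀) * u t₀ ≤ 8 * a * u t₀ := by gcongr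
    linarith
  have h1 : y t₀ ≤ f S := D.f_mono hut
  have h2 := hy0 t₀
  calc u 0 ≤ u t₀ + lam * a * (t₀ * y t₀) * t₀ := hfin
    _ = u t₀ + lam * a * t₀ ^ 2 * y t₀ := by ring
    _ ≤ S + Λ * a * t₀ ^ 2 * f S := by
      have : 0 ≤ Λ := by linarith
      gcongr

/-- The minimal profiles increase with the parameter and are uniformly bounded by stability, so they
converge, and the limit inherits the fixed point equation. -/
lemma RadialData.exists_extremal (D : RadialData f φ ψ) (hα : 0 ≤ α) :
    ∃ L u, 0 < L ∧ IsExtremalParameter f φ ψ α L ∧ IsRadialSolution f φ ψ α L u ∧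
      ∀ r, Tendsto (fun lam => minProfile f φ ψ α lam r) (𝓝[<] L) (𝓝 (u r)) := by
  set S := {lam : ℝ | 0 < lam ∧ ∃ u : Plane → ℝ, IsClassicalSolution f φ ψ α lam u} with hS
  have hC := D.pot_ψ_pos hα
  have hf1 := D.f_pos 1
  set l₁ := 1 / (f 1 * pot φ α ψ 0) with hl₁
  have hl₁0 : 0 < l₁ := by positivity
  have hl₁S : l₁ ∈ S := by
    obtain ⟨u, hu⟩ := D.exists_isRadialSolution_of_le hα hl₁0.le (by
      rw [hl₁, mul_assoc, one_div, inv_mul_cancel₀ (by positivity)])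
    exact ⟨hl₁0, _, hu.isClassicalSolution D hα hl₁0⟩
  have hbdd : BddAbove S := by
    refine ⟨(∫ t in Ioi 0, 1 / f t) / pot φ α ψ 0, fun lam hlam => ?_⟩
    obtain ⟨hl, w, hw⟩ := hlam
    rw [le_div_iff₀ hC]
    exact ((hw.isRadialSolution_minProfile D hα hl.le le_rfl).mul_pot_lt D hl.le).le
  set L := sSup S with hL
  have hLub : IsLUB S L := isLUB_csSup ⟨l₁, hl₁S⟩ hbdd
  have hL0 : 0 < L := hl₁0.trans_le (hLub.1 hl₁S)
  -- The supremum might be attained only by `L` itself; a midpoint supplies a second parameter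
  -- strictly below `L`.
  have hex : ∀ lam ∈ Ioo 0 L, ∃ mu, lam < mu ∧ mu < L ∧
      ∃ w, IsClassicalSolution f φ ψ α mu w := by
    intro lam hlam
    obtain ⟨mu, hmu, h1, -⟩ := hLub.exists_between hlam.2
    obtain ⟨w, hw⟩ := hmu.2
    have h2 : (lam + mu) / 2 < mu := by linarith
    refine ⟨(lam + mu) / 2, by linarith, h2.trans_le (hLub.1 hmu), _,
      (hw.isMinimalSolution_minProfile D hα (by linarith [hlam.1]) h2.le).isSolution⟩
  have hrad : ∀ lam ∈ Ioo 0 L, IsRadialSolution f φ ψ α lam (minProfile f φ ψ α lam) := by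
    intro lam hlam
    obtain ⟨mu, h1, -, w, hw⟩ := hex lam hlam
    exact hw.isRadialSolution_minProfile D hα hlam.1.le h1.le
  have hmono : ∀ lam ∈ Ioo 0 L, ∀ mu ∈ Ioo 0 L, lam ≤ mu → ∀ r,
      minProfile f φ ψ α lam r ≤ minProfile f φ ψ α mu r := by
    intro lam hlam mu hmu hle r
    have h := ((hrad mu hmu).isClassicalSolution D hα hmu.1).minProfile_le D hlam.1.le hle
    rw [← (hrad lam hlam).apply_clamp r, ← (hrad mu hmu).apply_clamp r]
    have h0 := clamp_mem r
    have hn : ‖(EuclideanSpace.single 0 (clamp r) : Plane)‖ = clamp r := by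
      simp [abs_of_nonneg h0.1]
    have := h (EuclideanSpace.single 0 (clamp r)) (by simpa [abs_of_nonneg h0.1] using h0.2)
    simpa only [hn] using this
  obtain ⟨K, hK⟩ := D.exists_apply_zero_le hα L (half_pos hL0)
  have hnear : ∀ᶠ lam in 𝓝[<] L, lam ∈ Ioo (L / 2) L :=
    Ioo_mem_nhdsLT (half_lt_self hL0)
  have hKle : ∀ lam ∈ Ioo 0 L, ∀ r, minProfile f φ ψ α lam r ≤ K := by
    intro lam hlam r
    -- The bound `K` is uniform only for parameters bounded away from `0`; smaller ones are handled
    -- by monotonicity.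
    set nu := max lam (L / 2)
    have hnu : nu ∈ Ioo 0 L := ⟨lt_max_of_lt_left hlam.1, max_lt hlam.2 (half_lt_self hL0)⟩
    obtain ⟨mu, h1, h2, -⟩ := hex nu hnu
    have hmu : mu ∈ Ioo 0 L := ⟨hnu.1.trans h1, h2⟩
    have h3 := hK nu mu _ _ (le_max_right _ _) hnu.2.le h1 (hrad nu hnu) (hrad mu hmu)
      (hmono nu hnu mu hmu h1.le)
    have h4 := hmono lam hlam nu hnu (le_max_left _ _) r
    have h5 : minProfile f φ ψ α nu r ≤ minProfile f φ ψ α nu 0 := by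
      rw [← (hrad nu hnu).apply_clamp r]
      exact (hrad nu hnu).antitone D hnu.1.le (clamp_mem r).1
    exact h4.trans (h5.trans h3)
  have hlim : ∀ r, Tendsto (fun lam => minProfile f φ ψ α lam r) (𝓝[<] L)
      (𝓝 (sSup ((fun lam => minProfile f φ ψ α lam r) '' Ioo 0 L))) := by
    intro r
    refine MonotoneOn.tendsto_nhdsWithin_Ioo_left ⟨L / 2, half_pos hL0, half_lt_self hL0⟩
      (fun lam hlam mu hmu hle => hmono lam hlam mu hmu hle r) ⟨K, ?_⟩
    rintro _ ⟨lam, hlam, rfl⟩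
    exact hKle lam hlam r
  refine ⟨L, fun r => sSup ((fun lam => minProfile f φ ψ α lam r) '' Ioo 0 L), hL0, hLub, ?_, hlim⟩
  have hne : Nonempty (Ioo 0 L) := ⟨⟨L / 2, half_pos hL0, half_lt_self hL0⟩⟩
  -- Passing to the subtype `Ioo 0 L` makes every index carry a genuine, continuous solution, not
  -- merely eventually.
  have hcomap : Tendsto (fun lam : Ioo 0 L => (lam : ℝ)) (comap (fun lam : Ioo 0 L => (lam : ℝ))
      (𝓝[<] L)) (𝓝[<] L) := tendsto_comap
  have hbot : (comap (fun lam : Ioo 0 L => (lam : ℝ)) (𝓝[<] L)).NeBot := by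
    refine comap_neBot_iff_frequently.2 (Eventually.frequently ?_)
    filter_upwards [Ioo_mem_nhdsLT hL0] with lam hlam using ⟨⟨lam, hlam⟩, rfl⟩
  refine D.isRadialSolution_of_tendsto (ι := Ioo 0 L) (B := K) (Λ := L) hα
    (L := fun lam => lam) (U := fun lam => minProfile f φ ψ α lam)
    (l := comap (fun lam : Ioo 0 L => (lam : ℝ)) (𝓝[<] L))
    (fun lam => (hrad lam lam.2).cont) (Eventually.of_forall fun lam => lam.2.1.le)
    (Eventually.of_forall fun lam => lam.2.2.le)
    (Eventually.of_forall fun lam r _ => hKle lam lam.2 r)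
    (hcomap.mono_right nhdsWithin_le_nhds) (fun r => (hlim r).comp hcomap) fun r => ?_
  refine ((hlim r).comp hcomap).congr fun lam => ?_
  exact (hrad lam lam.2).fixed r

/-- Extremal solutions are radial, with a profile solving the fixed point equation at the extremal
parameter. -/
lemma IsExtremalSolution.exists_profile {L : ℝ} {w : Plane → ℝ}
    (hw : IsExtremalSolution f φ ψ α L w) (D : RadialData f φ ψ) (hα : 0 ≤ α) :
    0 < L ∧ ∃ u, IsRadialSolution f φ ψ α L u ∧
      ∀ x ∈ Metric.closedBall (0 : Plane) 1, w x = u ‖x‖ := by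
  obtain ⟨L', u, hL', hLub, hu, hlim⟩ := D.exists_extremal hα
  obtain rfl : L = L' := hw.1.unique hLub
  refine ⟨hL', u, hu, fun x hx => ?_⟩
  obtain ⟨v, hv, hvlim⟩ := hw.2
  refine tendsto_nhds_unique (hvlim x hx) ((hlim ‖x‖).congr' ?_)
  filter_upwards [Ioo_mem_nhdsLT hL'] with lam hlam
  obtain ⟨mu, hmu, h1, -⟩ := hLub.exists_between hlam.2
  obtain ⟨w', hw'⟩ := hmu.2
  exact (hw'.isMinimalSolution_minProfile D hα hlam.1 h1.le).eqOn (hv lam hlam) hx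

lemma RadialData.exists_isExtremalSolution (D : RadialData f φ ψ) (hα : 0 ≤ α) :
    ∃ (L : ℝ) (w : Plane → ℝ), IsExtremalSolution f φ ψ α L w := by
  obtain ⟨L, u, hL, hLub, hu, hlim⟩ := D.exists_extremal hα
  refine ⟨L, fun x => u ‖x‖, hLub, fun lam x => minProfile f φ ψ α lam ‖x‖, fun lam hlam => ?_,
    fun x _ => hlim ‖x‖⟩
  obtain ⟨mu, hmu, h1, -⟩ := hLub.exists_between hlam.2
  obtain ⟨w', hw'⟩ := hmu.2
  exact hw'.isMinimalSolution_minProfile D hα hlam.1 h1.le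

lemma IsClassicalSolution.congr {w₁ w₂ : Plane → ℝ} (h : IsClassicalSolution f φ ψ α lam w₁)
    (heq : EqOn w₂ w₁ (Metric.closedBall 0 1)) : IsClassicalSolution f φ ψ α lam w₂ := by
  have hb := heq.mono Metric.ball_subset_closedBall
  refine ⟨h.contDiffOn.congr hb, h.continuousOn.congr heq, fun x hx => ?_, fun x hx => ?_,
    fun x hx => ?_⟩
  · have hev : w₂ =ᶠ[𝓝 x] w₁ := by
      filter_upwards [Metric.isOpen_ball.mem_nhds hx] with y hy using hb hy
    rw [(InnerProductSpace.laplacian_congr_nhds hev).eq_of_nhds, hev.fderiv_eq, hb hx]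
    exact h.equation x hx
  · rw [hb hx]
    exact h.pos x hx
  · rw [heq (Metric.sphere_subset_closedBall hx)]
    exact h.boundary x hx

end extremal

/-! ### Logarithmic asymptotics of the potential of `ψ`. -/

section torsion

variable {f φ ψ : ℝ → ℝ} {α lam mu : ℝ} {u v : ℝ → ℝ}

lemma RadialData.bddAbove_ratio (D : RadialData f φ ψ) {s : ℝ} (hs : s < 1) :
    BddAbove ((fun r => ψ r / φ r) '' Icc 0 s) :=
  isCompact_Icc.bddAbove_image (D.ψ_cont.continuousOn.div D.φ_cont.continuousOn
    fun r hr => (D.φ_pos r (hr.2.trans_lt hs)).ne')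

lemma RadialData.ratio_le_maxRatio (D : RadialData f φ ψ) {r s : ℝ} (hr : 0 ≤ r) (hrs : r ≤ s)
    (hs : s < 1) : ψ r / φ r ≤ maxRatio φ ψ s :=
  le_csSup (D.bddAbove_ratio hs) ⟨r, ⟨hr, hrs⟩, rfl⟩

lemma RadialData.maxRatio_mono (D : RadialData f φ ψ) {s t : ℝ} (hs : 0 ≤ s) (hst : s ≤ t)
    (ht : t < 1) : maxRatio φ ψ s ≤ maxRatio φ ψ t :=
  csSup_le_csSup (D.bddAbove_ratio ht) ⟨_, 0, ⟨le_rfl, hs⟩, rfl⟩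
    (image_mono (Icc_subset_Icc_right hst))

lemma RadialData.one_le_maxRatio (D : RadialData f φ ψ) {s : ℝ} (hs : 0 ≤ s) (hs1 : s < 1) :
    1 ≤ maxRatio φ ψ s := by
  have := D.ratio_le_maxRatio le_rfl hs hs1
  rwa [D.φ_zero, D.ψ_zero, div_one] at this

/-- Since $A'=\alpha s\varphi A$, the mass of `φ` is explicit; every gain of a factor $1/\alpha$
comes from this identity. -/
lemma RadialData.mul_mass_φ (D : RadialData f φ ψ) (t : ℝ) :
    α * mass φ α φ t = weight φ α t - 1 := by
  have h := intervalIntegral.integral_eq_sub_of_hasDerivAt (a := 0) (b := t)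
    (fun s _ => hasDerivAt_weight (α := α) D.φ_cont s)
    (Continuous.intervalIntegrable (by
      have := continuous_weight (α := α) D.φ_cont
      have := D.φ_cont
      fun_prop) _ _)
  rw [weight_zero] at h
  rw [← h, mass, ← intervalIntegral.integral_const_mul]
  congr 1
  ext s
  ring

/-- On $[0,t]$ one has $\psi\le M(t)\varphi$, and $\alpha$ times the mass of $\varphi$ is $A-1\le
A$. -/
lemma RadialData.flux_ψ_le (D : RadialData f φ ψ) (hα : 0 < α) {t : ℝ} (ht : 0 < t) (ht1 : t < 1) :
    flux φ α ψ t ≤ maxRatio φ ψ t / (α * t) := by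
  have hM := D.one_le_maxRatio ht.le ht1
  have h1 : mass φ α ψ t ≤ maxRatio φ ψ t * mass φ α φ t := by
    rw [← mass_const_mul]
    refine mass_le_mass D.φ_cont D.ψ_cont (D.φ_cont.const_mul _) ht.le fun s hs => ?_
    have := D.ratio_le_maxRatio hs.1 hs.2 ht1
    rwa [div_le_iff₀ (D.φ_pos s (hs.2.trans_lt ht1))] at this
  have hw := weight_pos (φ := φ) (α := α) t
  rw [flux, div_le_div_iff₀ (by positivity) (by positivity)]
  have h2 := D.mul_mass_φ (α := α) t
  calc mass φ α ψ t * (α * t) ≤ maxRatio φ ψ t * mass φ α φ t * (α * t) := by gcongr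
    _ = maxRatio φ ψ t * (t * (α * mass φ α φ t)) := by ring
    _ ≤ maxRatio φ ψ t * (t * weight φ α t) := by
      rw [h2]
      gcongr
      linarith

lemma RadialData.flux_ψ_le_half (D : RadialData f φ ψ) (hα : 0 ≤ α) {t : ℝ} (ht : 0 ≤ t) :
    flux φ α ψ t ≤ t / 2 := by
  have := flux_le_of_le (α := α) D.φ_cont D.φ_nonneg hα D.ψ_cont zero_le_one ht
    fun s hs => D.ψ_le_one hs.1
  linarith

/-- The ratio $\psi/\varphi$ may blow up at the boundary; integrability of $M$ is what allows the
flux bound to be integrated up to `1`. -/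
lemma RadialData.pot_ψ_le (D : RadialData f φ ψ) (hα : 0 < α) {d : ℝ} (hd : 0 < d) (hd1 : d < 1) :
    pot φ α ψ d ≤ (∫ t in Ioo 0 1, maxRatio φ ψ t) / (α * d) := by
  have hMd : IntegrableOn (maxRatio φ ψ) (Ioo d 1) :=
    D.M_int.mono_set (Ioo_subset_Ioo_left hd.le)
  have h1 : pot φ α ψ d ≤ ∫ t in d..1, maxRatio φ ψ t / (α * d) := by
    refine intervalIntegral.integral_mono_on_of_le_Ioo hd1.le
      ((continuous_flux D.φ_cont D.ψ_cont).intervalIntegrable _ _)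
      (((intervalIntegrable_iff_integrableOn_Ioo_of_le hd1.le).2 hMd).div_const _) fun t ht => ?_
    have ht0 : 0 < t := hd.trans ht.1
    refine (D.flux_ψ_le hα ht0 ht.2).trans ?_
    have := D.one_le_maxRatio ht0.le ht.2
    exact div_le_div_of_nonneg_left (by linarith) (by positivity)
      (mul_le_mul_of_nonneg_left ht.1.le hα.le)
  rw [intervalIntegral.integral_div] at h1
  refine h1.trans (div_le_div_of_nonneg_right ?_ (by positivity))
  rw [intervalIntegral.integral_of_le hd1.le, integral_Ioc_eq_integral_Ioo]
  refine setIntegral_mono_set D.M_int ?_ (Ioo_subset_Ioo_left hd.le).eventuallyLE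
  refine (ae_restrict_iff' measurableSet_Ioo).2 (Eventually.of_forall fun t ht => ?_)
  exact zero_le_one.trans (D.one_le_maxRatio ht.1.le ht.2)

/-- Three ranges contribute: up to $1/\sqrt\alpha$ the flux is at most $t/2$, up to $1/2$ it is at
most $M(1/2)/(\alpha t)$ and yields the logarithm, and beyond $1/2$ the integral of $M$ is used. -/
lemma RadialData.exists_pot_ψ_zero_le (D : RadialData f φ ψ) :
    ∃ C, 0 < C ∧ ∀ᶠ α in atTop, α * pot φ α ψ 0 ≤ C * Real.log α := by
  set m := ∫ t in Ioo 0 1, maxRatio φ ψ t with hm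
  set M := maxRatio φ ψ (1 / 2) with hM
  have hM1 : 1 ≤ M := D.one_le_maxRatio (by norm_num) (by norm_num)
  have hm0 : 0 ≤ m := setIntegral_nonneg measurableSet_Ioo fun t ht =>
    zero_le_one.trans (D.one_le_maxRatio ht.1.le ht.2)
  refine ⟨1 + M + 2 * m, by positivity, ?_⟩
  filter_upwards [eventually_ge_atTop 4] with α hα4
  have hα : 0 < α := by linarith
  have hlog : 1 ≤ Real.log α := by
    rw [Real.le_log_iff_exp_le hα]
    linarith [Real.exp_one_lt_d9]
  have hsq : 0 < √α := Real.sqrt_pos.2 hα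
  have hsq2 : 2 ≤ √α := Real.le_sqrt_of_sq_le (by linarith)
  have hss : √α * √α = α := Real.mul_self_sqrt hα.le
  set ρ := 1 / √α with hρ
  have hρ0 : 0 < ρ := by positivity
  have hρ2 : ρ ≤ 1 / 2 := one_div_le_one_div_of_le (by norm_num) hsq2
  have hρρ : α * ρ ^ 2 = 1 := by
    rw [hρ, div_pow, one_pow, Real.sq_sqrt hα.le]
    field_simp
  have hpc := continuous_pot (α := α) D.φ_cont D.ψ_cont
  have h1 := le_of_hasDerivAt_nonneg (F := fun t => pot φ α ψ t + t ^ 2) hρ0.le (by fun_prop)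
    (fun t _ => (hasDerivAt_pot D.φ_cont D.ψ_cont t).add ((hasDerivAt_id t).fun_pow 2))
    fun t ht => by
      have := D.flux_ψ_le_half hα.le ht.1.le
      have := ht.1
      simp only [id]
      norm_num
      linarith
  have h2 := le_of_hasDerivAt_nonneg (F := fun t => pot φ α ψ t + M / α * Real.log t) hρ2
    (fun t ht => ((hasDerivAt_pot D.φ_cont D.ψ_cont t).add
      ((Real.hasDerivAt_log (hρ0.trans_le ht.1).ne').const_mul
        (M / α))).continuousAt.continuousWithinAt)
    (fun t ht => (hasDerivAt_pot D.φ_cont D.ψ_cont t).add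
      ((Real.hasDerivAt_log (hρ0.trans ht.1).ne').const_mul (M / α)))
    fun t ht => by
      have ht0 := hρ0.trans ht.1
      have h3 := D.flux_ψ_le hα ht0 (by linarith [ht.2])
      have h4 : maxRatio φ ψ t ≤ M := D.maxRatio_mono ht0.le ht.2.le (by norm_num)
      have h5 : maxRatio φ ψ t / (α * t) ≤ M / α * t⁻¹ := by
        rw [show M / α * t⁻¹ = M / (α * t) by field_simp]
        gcongr
      linarith
  have h3 := D.pot_ψ_le hα (d := 1 / 2) (by norm_num) (by norm_num)
  rw [← hm] at h3
  have h4 : pot φ α ψ 0 ≤ ρ ^ 2 + M / α * (Real.log (1 / 2) - Real.log ρ) + m / (α * (1 / 2)) := by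
    linarith
  have h5 : Real.log ρ = -(Real.log α / 2) := by
    rw [hρ, one_div, Real.log_inv, Real.log_sqrt hα.le]
  have h6 : Real.log (1 / 2) ≤ 0 := Real.log_nonpos (by norm_num) (by norm_num)
  calc α * pot φ α ψ 0
      ≤ α * (ρ ^ 2 + M / α * (Real.log (1 / 2) - Real.log ρ) + m / (α * (1 / 2))) := by gcongr
    _ = α * ρ ^ 2 + M * (Real.log (1 / 2) - Real.log ρ) + 2 * m := by field_simp
    _ = 1 + M * (Real.log (1 / 2) + Real.log α / 2) + 2 * m := by rw [hρρ, h5]; ring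
    _ ≤ 1 * Real.log α + M * Real.log α + 2 * m * Real.log α := by
      have h7 : M * (Real.log (1 / 2) + Real.log α / 2) ≤ M * Real.log α := by
        apply mul_le_mul_of_nonneg_left _ (by linarith)
        linarith
      have h8 : 2 * m * 1 ≤ 2 * m * Real.log α := by gcongr
      linarith
    _ = _ := by ring

/-- Near the origin $\psi\ge\varphi/2$, and $A\ge2$ once $t\ge2/\sqrt\alpha$. Hence $\alpha$ times
the mass of $\psi$ is at least $(A-1)/2\ge A/4$, and the flux is at least $1/(4\alpha t)$. -/
lemma RadialData.exists_le_pot_ψ_sub (D : RadialData f φ ψ) :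
    ∃ δ, 0 < δ ∧ δ < 1 ∧ ∀ α > 0, ∀ r, 2 / √α ≤ r → r ≤ δ →
      Real.log (r * √α / 2) ≤ 4 * α * (pot φ α ψ 0 - pot φ α ψ r) := by
  obtain ⟨δ₁, hδ₁, hδ₁', hφ⟩ := exists_half_le D.φ_cont (by rw [D.φ_zero]; exact one_pos)
    (t := 1 / 2) (by norm_num)
  obtain ⟨δ, hδ, hδ', hψ⟩ := exists_half_le D.ψ_cont (by rw [D.ψ_zero]; exact one_pos) hδ₁
  rw [D.φ_zero] at hφ
  rw [D.ψ_zero] at hψ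
  refine ⟨δ, hδ, by linarith, fun α hα r hr1 hr2 => ?_⟩
  have hsq : 0 < √α := Real.sqrt_pos.2 hα
  set ρ := 2 / √α with hρ
  have hρ0 : 0 < ρ := by positivity
  have hρρ : α * ρ ^ 2 = 4 := by
    rw [hρ, div_pow, Real.sq_sqrt hα.le]
    field_simp
    norm_num
  have hw : ∀ t, ρ ≤ t → t ≤ δ → 2 ≤ weight φ α t := by
    intro t ht1 ht2
    have ht0 : 0 < t := hρ0.trans_le ht1
    have h1 : ∫ s in (0 : ℝ)..t, s * (1 / 2) ≤ ∫ s in (0 : ℝ)..t, s * φ s := by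
      refine intervalIntegral.integral_mono_on ht0.le
        ((by fun_prop : Continuous _).intervalIntegrable _ _)
        ((continuous_id.mul D.φ_cont).intervalIntegrable _ _) fun s hs => ?_
      exact mul_le_mul_of_nonneg_left (hφ s ⟨hs.1, by linarith [hs.2]⟩) hs.1
    rw [intervalIntegral.integral_mul_const, integral_id] at h1
    have h2 : 1 ≤ α * ∫ s in (0 : ℝ)..t, s * φ s := by
      have h3 : ρ ^ 2 ≤ t ^ 2 := by gcongr
      have h4 : α * ρ ^ 2 ≤ α * t ^ 2 := by gcongr
      nlinarith
    have h5 := Real.add_one_le_exp (α * ∫ s in (0 : ℝ)..t, s * φ s)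
    rw [weight]
    linarith
  have hd : ∀ t ∈ Icc ρ r, HasDerivAt (fun t => -(4 * α * pot φ α ψ t) - Real.log t)
      (-(4 * α * -flux φ α ψ t) - t⁻¹) t := fun t ht =>
    ((hasDerivAt_pot D.φ_cont D.ψ_cont t).const_mul (4 * α)).fun_neg.sub
      (Real.hasDerivAt_log (hρ0.trans_le ht.1).ne')
  have h := le_of_hasDerivAt_nonneg hr1
    (fun t ht => (hd t ht).continuousAt.continuousWithinAt)
    (fun t ht => hd t ⟨ht.1.le, ht.2.le⟩) fun t ht => ?_
  · have h1 : pot φ α ψ ρ ≤ pot φ α ψ 0 :=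
      pot_anti D.φ_cont D.ψ_cont le_rfl hρ0.le fun s _ => D.ψ_nonneg s
    have h2 : Real.log (r * √α / 2) = Real.log r - Real.log ρ := by
      rw [← Real.log_div (hρ0.trans_le hr1).ne' hρ0.ne', hρ]
      congr 1
      field_simp
    rw [h2]
    nlinarith
  · have ht0 : 0 < t := hρ0.trans ht.1
    have h2 := hw t ht.1.le (by linarith [ht.2])
    have h3 : mass φ α (fun s => 1 / 2 * φ s) t ≤ mass φ α ψ t := by
      refine mass_le_mass D.φ_cont (D.φ_cont.const_mul _) D.ψ_cont ht0.le fun s hs => ?_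
      have := D.φ_le_one hs.1
      have := hψ s ⟨hs.1, by linarith [hs.2, ht.2]⟩
      linarith
    rw [mass_const_mul] at h3
    have h4 := D.mul_mass_φ (α := α) t
    have h5 : t⁻¹ ≤ 4 * α * flux φ α ψ t := by
      rw [flux, mul_div_assoc', inv_eq_one_div, div_le_div_iff₀ ht0 (by positivity)]
      have h6 : weight φ α t ≤ 4 * α * mass φ α ψ t := by
        have : 4 * α * (1 / 2 * mass φ α φ t) ≤ 4 * α * mass φ α ψ t := by gcongr
        nlinarith
      nlinarith
    linarith

lemma RadialData.tendsto_mul_pot_ψ (D : RadialData f φ ψ) :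
    Tendsto (fun α => α * pot φ α ψ 0) atTop atTop := by
  obtain ⟨δ, hδ, hδ1, h⟩ := D.exists_le_pot_ψ_sub
  have hsq := Real.tendsto_sqrt_atTop
  have h1 : Tendsto (fun α : ℝ => Real.log (δ * √α / 2) / 4) atTop atTop := by
    refine Tendsto.atTop_div_const (by norm_num) (Real.tendsto_log_atTop.comp ?_)
    exact (hsq.const_mul_atTop hδ).atTop_div_const (by norm_num)
  refine tendsto_atTop_mono' _ ?_ h1
  filter_upwards [hsq.eventually_ge_atTop (2 / δ), eventually_gt_atTop 0] with α h2 hα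
  have hs : 0 < √α := Real.sqrt_pos.2 hα
  have h3 := h α hα δ (by rwa [div_le_iff₀ hs, mul_comm, ← div_le_iff₀ hδ]) le_rfl
  have h4 : 0 ≤ pot φ α ψ δ :=
    pot_nonneg D.φ_cont D.ψ_cont ⟨hδ.le, hδ1.le⟩ fun s _ => D.ψ_nonneg s
  nlinarith

end torsion

/-! ### Supersolutions with nearly optimal parameter at large drift. -/

section supersolution

/-- An upper bound on $f$ makes the time map grow at least linearly in both directions, hence
surjective, so its inverse is a global solution of $h'=f(h)$. -/
lemma exists_inverse_timeMap {f : ℝ → ℝ} (hf : Continuous f) (hpos : ∀ s, 0 < f s) {B : ℝ}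
    (hB : ∀ s, f s ≤ B) :
    ∃ h : ℝ → ℝ, StrictMono h ∧ (∀ s, h (timeMap f s) = s) ∧ ∀ y, HasDerivAt h (f (h y)) y := by
  have hB0 : 0 < B := (hpos 0).trans_le (hB 0)
  have hd : ∀ s, HasDerivAt (timeMap f) (1 / f s) s := fun s =>
    (Continuous.integral_hasStrictDerivAt
      (continuous_const.div hf fun t => (hpos t).ne') 0 s).hasDerivAt
  have hmono : StrictMono (timeMap f) := strictMono_of_deriv_pos fun s => by
    rw [(hd s).deriv]
    exact one_div_pos.2 (hpos s)
  have hcont : Continuous (timeMap f) :=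
    continuous_iff_continuousAt.2 fun s => (hd s).continuousAt
  have hle : ∀ s t, s ≤ t → timeMap f s - s / B ≤ timeMap f t - t / B := fun s t hst => by
    refine le_of_hasDerivAt_nonneg (F := fun s => timeMap f s - s / B) hst (by fun_prop)
      (fun r _ => (hd r).sub ((hasDerivAt_id r).div_const B)) fun r _ => ?_
    exact sub_nonneg.2 (one_div_le_one_div_of_le (hpos r) (hB r))
  have hdiv : Tendsto (fun s : ℝ => s / B) atTop atTop := tendsto_id.atTop_div_const hB0
  have hdiv' : Tendsto (fun s : ℝ => s / B) atBot atBot := tendsto_id.atBot_div_const hB0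
  have hsurj : Function.Surjective (timeMap f) := by
    refine hcont.surjective (tendsto_atTop_mono' _ ?_ hdiv) (tendsto_atBot_mono' _ ?_ hdiv')
    · filter_upwards [eventually_ge_atTop 0] with s hs
      have := hle 0 s hs
      simp only [timeMap_zero, zero_div, sub_zero] at this
      linarith
    · filter_upwards [eventually_le_atBot 0] with s hs
      have := hle s 0 hs
      simp only [timeMap_zero, zero_div, sub_zero] at this
      linarith
  set e := hmono.orderIsoOfSurjective _ hsurj with he
  refine ⟨e.symm, e.symm.strictMono, fun s => e.symm_apply_apply s, fun y => ?_⟩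
  have h := HasDerivAt.of_local_left_inverse (a := y) e.symm.continuous.continuousAt
    (hd (e.symm y)) (one_div_pos.2 (hpos _)).ne'
    (Eventually.of_forall fun z => e.apply_symm_apply z)
  simpa using h

variable {f φ ψ : ℝ → ℝ} {α lam mu : ℝ} {u v : ℝ → ℝ}

/-- For large drift there are solutions for parameters close to the upper bound given by the time
map. -/
lemma RadialData.eventually_exists_isRadialSolution (D : RadialData f φ ψ) {K ε : ℝ}
    (hK : 0 < K) (hε : 0 < ε) (hεK : ε < timeMap f K) :
    ∀ᶠ α in atTop, ∃ u, IsRadialSolution f φ ψ α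
      ((timeMap f K - ε) / ((1 + ε) * pot φ α ψ 0)) u := by
  obtain ⟨δ, hδ, hδ2, hψ⟩ := exists_half_le D.ψ_cont (by rw [D.ψ_zero]; exact one_pos)
    (t := 1 / 2) (by norm_num)
  rw [D.ψ_zero] at hψ
  have hδ1 : δ < 1 := by linarith
  set M := maxRatio φ ψ δ with hM
  have hM1 : 1 ≤ M := D.one_le_maxRatio hδ.le hδ1
  set m := ∫ t in Ioo 0 1, maxRatio φ ψ t with hm
  -- Truncation at `K` makes the nonlinearity bounded; the supersolution takes values in `[0, K]`,
  -- where nothing is changed.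
  set fK : ℝ → ℝ := fun s => f (min s K) with hfK
  obtain ⟨h, hmono, hinv, hder⟩ := exists_inverse_timeMap (f := fK)
    (D.f_cont.comp (continuous_id.min continuous_const)) (fun s => D.f_pos _) (B := f K)
    fun s => D.f_mono (min_le_right _ _)
  have htK : timeMap fK K = timeMap f K := by
    refine intervalIntegral.integral_congr fun s hs => ?_
    rw [uIcc_of_le hK.le] at hs
    simp only [hfK, min_eq_left hs.2]
  have hhK : h (timeMap f K) = K := by rw [← htK, hinv]
  have hh0 : h 0 = 0 := by
    have := hinv 0
    rwa [timeMap_zero] at this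
  have hhε : 0 < h ε := by
    rw [← hh0]
    exact hmono hε
  set c := (timeMap f K - ε) / (1 + ε) with hc
  have hc0 : 0 < c := div_pos (by linarith) (by linarith)
  have hsmall : Tendsto (fun α => c / (α * pot φ α ψ 0)) atTop (𝓝 0) :=
    tendsto_const_nhds.div_atTop D.tendsto_mul_pot_ψ
  -- Both smallness conditions say that $\lambda/\alpha$ is small, as follows from $\alpha
  -- p(0)\to\infty$. The first serves near the origin, the second away from it.
  have hs1 : ∀ᶠ α in atTop,
      (1 + ε) ^ 2 * (c / (α * pot φ α ψ 0) * (deriv f K * M)) < ε / 2 := by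
    have := (hsmall.mul_const (deriv f K * M)).const_mul ((1 + ε) ^ 2)
    rw [zero_mul, mul_zero] at this
    exact this.eventually (gt_mem_nhds (by linarith))
  have hs2 : ∀ᶠ α in atTop, c / (α * pot φ α ψ 0) * (f K * m / δ) < h ε := by
    have := hsmall.mul_const (f K * m / δ)
    rw [zero_mul] at this
    exact this.eventually (gt_mem_nhds hhε)
  filter_upwards [hs1, hs2, eventually_gt_atTop 0] with α hs1 hs2 hα
  have hp := D.pot_ψ_pos hα.le
  set p := pot φ α ψ 0 with hp'
  have hlam : (timeMap f K - ε) / ((1 + ε) * p) = c / p := by rw [hc, div_div]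
  rw [hlam]
  set lam := c / p with hlam'
  have hl : 0 < lam := div_pos hc0 hp
  have hlα : c / (α * p) = lam / α := by rw [hlam']; field_simp
  rw [hlα] at hs1 hs2
  -- The parameter is chosen so that `W 0 = timeMap f K`, hence `V 0 = K` for `V = h ∘ W`. The
  -- offset `ε` gives room at the boundary, the factor `1 + ε` room in the interior.
  set W : ℝ → ℝ := fun r => ε + (1 + ε) * lam * pot φ α ψ r with hW
  have hWge : ∀ r ∈ Icc (0 : ℝ) 1, ε ≤ W r := fun r hr => by
    have h1 := pot_nonneg (α := α) D.φ_cont D.ψ_cont hr fun s _ => D.ψ_nonneg s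
    have : 0 ≤ (1 + ε) * lam * pot φ α ψ r := by positivity
    simp only [hW]
    linarith
  have hWle : ∀ r ∈ Icc (0 : ℝ) 1, W r ≤ timeMap f K := fun r hr => by
    have h1 : pot φ α ψ r ≤ p :=
      pot_anti D.φ_cont D.ψ_cont le_rfl hr.1 fun s _ => D.ψ_nonneg s
    have h2 : (1 + ε) * lam * pot φ α ψ r ≤ (1 + ε) * lam * p := by gcongr
    have h3 : (1 + ε) * lam * p = timeMap f K - ε := by
      rw [hlam', hc]
      field_simp
    simp only [hW]
    linarith
  have hWd : ∀ r, HasDerivAt W ((1 + ε) * lam * -flux φ α ψ r) r := fun r =>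
    ((hasDerivAt_pot D.φ_cont D.ψ_cont r).const_mul ((1 + ε) * lam)).const_add ε
  set V : ℝ → ℝ := fun r => h (W r) with hV
  have hVge : ∀ r ∈ Icc (0 : ℝ) 1, h ε ≤ V r := fun r hr => hmono.monotone (hWge r hr)
  have hVle : ∀ r ∈ Icc (0 : ℝ) 1, V r ≤ K := fun r hr => by
    rw [← hhK]
    exact hmono.monotone (hWle r hr)
  have hVd : ∀ r ∈ Icc (0 : ℝ) 1,
      HasDerivAt V (f (V r) * ((1 + ε) * lam * -flux φ α ψ r)) r := fun r hr => by
    have h1 := (hder (W r)).comp r (hWd r)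
    have h2 : fK (h (W r)) = f (V r) := congrArg f (min_eq_left (hVle r hr))
    rwa [h2] at h1
  have hVc : Continuous V := by
    have h1 : Continuous h := continuous_iff_continuousAt.2 fun y => (hder y).continuousAt
    have h2 : Continuous W := continuous_iff_continuousAt.2 fun y => (hWd y).continuousAt
    exact h1.comp h2
  have hfVc : Continuous fun s => ψ s * f (V s) := D.ψ_cont.mul (D.f_cont.comp hVc)
  have hsrc : source f ψ lam V = fun s => lam * (ψ s * f (V s)) := by
    funext s
    simp only [source, mul_assoc]
  have hsc := D.continuous_source (lam := lam) hVc
  -- The difference of the two sides has derivative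
  -- $sAf(V)\,(\varepsilon\psi-(1+\varepsilon)^2\lambda f'(V)\,\mathrm{flux}^2)$. Multiplying the
  -- bounds $t$ and $M/(\alpha t)$ for the flux gives $\mathrm{flux}^2\le M/\alpha$, so
  -- $\lambda/\alpha$ small makes this nonnegative.
  have hmass : ∀ t ∈ Icc 0 δ,
      mass φ α (fun s => ψ s * f (V s)) t ≤ (1 + ε) * (f (V t) * mass φ α ψ t) := by
    intro t ht
    have hfd : ∀ s ∈ Ioo 0 t, HasDerivAt (fun s => f (V s))
        (deriv f (V s) * (f (V s) * ((1 + ε) * lam * -flux φ α ψ s))) s := fun s hs => by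
      have hs' : s ∈ Icc (0 : ℝ) 1 := ⟨hs.1.le, by linarith [hs.2, ht.2]⟩
      exact (D.hasDerivAt_f (hhε.trans_le (hVge s hs'))).comp s (hVd s hs')
    have h1 := le_of_hasDerivAt_nonneg
      (F := fun s => (1 + ε) * (f (V s) * mass φ α ψ s) - mass φ α (fun s => ψ s * f (V s)) s) ht.1
      (by
        have := continuous_mass (α := α) D.φ_cont D.ψ_cont
        have := continuous_mass (α := α) D.φ_cont hfVc
        have := D.f_cont
        fun_prop)
      (fun s hs => (((hfd s hs).fun_mul (hasDerivAt_mass D.φ_cont D.ψ_cont s)).const_mul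
        (1 + ε)).sub (hasDerivAt_mass D.φ_cont hfVc s)) fun s hs => ?_
    · simp only [mass_zero, mul_zero, sub_zero] at h1
      linarith
    · have hs0 := hs.1
      have hsδ : s ≤ δ := by linarith [hs.2, ht.2]
      have hs1' : s < 1 := by linarith
      have hs' : s ∈ Icc (0 : ℝ) 1 := ⟨hs0.le, hs1'.le⟩
      have hA := weight_pos (φ := φ) (α := α) s
      have hfV := D.f_pos (V s)
      have hfl0 : 0 ≤ flux φ α ψ s := flux_nonneg hs0.le fun r _ => D.ψ_nonneg r
      have hfl1 := D.flux_ψ_le_half hα.le hs0.le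
      have hfl2 : flux φ α ψ s ≤ M / (α * s) :=
        (D.flux_ψ_le hα hs0 hs1').trans
          (div_le_div_of_nonneg_right (D.maxRatio_mono hs0.le hsδ hδ1) (by positivity))
      have hsq : flux φ α ψ s ^ 2 ≤ M / α := by
        calc flux φ α ψ s ^ 2 = flux φ α ψ s * flux φ α ψ s := sq _
          _ ≤ s * (M / (α * s)) := mul_le_mul (by linarith) hfl2 hfl0 hs0.le
          _ = M / α := by field_simp
      have hdf : deriv f (V s) ≤ deriv f K :=
        D.deriv_f_mono (hhε.trans_le (hVge s hs')) (hVle s hs')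
      have hψs := hψ s ⟨hs0.le, hsδ⟩
      have hkey : (1 + ε) ^ 2 * (lam * (deriv f (V s) * flux φ α ψ s ^ 2)) ≤ ε * ψ s := by
        calc (1 + ε) ^ 2 * (lam * (deriv f (V s) * flux φ α ψ s ^ 2))
            ≤ (1 + ε) ^ 2 * (lam * (deriv f K * (M / α))) := by
              have := D.deriv_f_nonneg (V s)
              have := D.deriv_f_nonneg K
              gcongr
          _ = (1 + ε) ^ 2 * (lam / α * (deriv f K * M)) := by ring
          _ ≤ ε / 2 := hs1.le
          _ ≤ ε * ψ s := by nlinarith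
      rw [mass_eq_flux_mul hs0.ne']
      have h2 : 0 ≤ f (V s) * (s * weight φ α s) *
          (ε * ψ s - (1 + ε) ^ 2 * (lam * (deriv f (V s) * flux φ α ψ s ^ 2))) :=
        mul_nonneg (by positivity) (by linarith)
      convert h2 using 1
      ring
  have hfarle : ∀ r ∈ Icc δ 1, pot φ α (source f ψ lam V) r ≤ h ε := by
    intro r hr
    have hδ01 : δ ∈ Icc (0 : ℝ) 1 := ⟨hδ.le, hδ1.le⟩
    have h1 : pot φ α (source f ψ lam V) r ≤ pot φ α (source f ψ lam V) δ :=
      pot_anti D.φ_cont hsc hδ.le hr.1 fun s _ => D.source_nonneg hl.le s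
    have h2 : pot φ α (source f ψ lam V) δ ≤ pot φ α (fun s => lam * f K * ψ s) δ := by
      refine pot_le_pot D.φ_cont hsc (D.ψ_cont.const_mul _) hδ01 fun s hs => ?_
      calc lam * ψ s * f (V s) ≤ lam * ψ s * f K :=
            mul_le_mul_of_nonneg_left (D.f_mono (hVle s hs))
              (mul_nonneg hl.le (D.ψ_nonneg s))
        _ = lam * f K * ψ s := by ring
    rw [pot_const_mul] at h2
    have h3 := D.pot_ψ_le hα hδ hδ1
    rw [← hm] at h3
    have h4 : lam * f K * pot φ α ψ δ ≤ lam * f K * (m / (α * δ)) := by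
      have := (D.f_pos K).le
      gcongr
    have h5 : lam * f K * (m / (α * δ)) = lam / α * (f K * m / δ) := by field_simp
    linarith
  -- On `[δ, 1]` the potential lies below `h ε ≤ V`; on `[0, δ]` the slopes are compared starting
  -- from `δ`.
  refine D.exists_isRadialSolution_of_supersolution hα.le hl.le hVc
    (fun r hr => hhε.le.trans (hVge r hr)) fun r hr => ?_
  rcases le_total δ r with hrδ | hrδ
  · exact (hfarle r ⟨hrδ, hr.2⟩).trans (hVge r hr)
  · have h1 := le_of_hasDerivAt_nonneg
      (F := fun t => pot φ α (source f ψ lam V) t - V t) hrδ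
      ((continuous_pot D.φ_cont hsc).sub hVc).continuousOn
      (fun t ht => (hasDerivAt_pot D.φ_cont hsc t).sub
        (hVd t ⟨hr.1.trans ht.1.le, by linarith [ht.2]⟩)) fun t ht => ?_
    · have h2 := hfarle δ ⟨le_rfl, hδ1.le⟩
      have h3 := hVge δ ⟨hδ.le, hδ1.le⟩
      linarith
    · have ht0 : 0 < t := hr.1.trans_lt ht.1
      have h2 := hmass t ⟨ht0.le, ht.2.le⟩
      have hA := weight_pos (φ := φ) (α := α) t
      have h3 : flux φ α (source f ψ lam V) t ≤ f (V t) * ((1 + ε) * lam * flux φ α ψ t) := by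
        rw [hsrc, flux_const_mul]
        simp only [flux]
        rw [mul_div_assoc', mul_div_assoc', mul_div_assoc']
        refine div_le_div_of_nonneg_right ?_ (by positivity)
        calc lam * mass φ α (fun s => ψ s * f (V s)) t
            ≤ lam * ((1 + ε) * (f (V t) * mass φ α ψ t)) := by gcongr
          _ = _ := by ring
      linarith

end supersolution

/-- A choice, for every drift parameter `α > 0`, of the extremal parameter and of the profile of
the extremal solution. -/
structure IsExtremalFamily (f φ ψ : ℝ → ℝ) (L : ℝ → ℝ) (U : ℝ → ℝ → ℝ) : Prop where
  pos : ∀ α > 0, 0 < L α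
  isExtremalParameter : ∀ α > 0, IsExtremalParameter f φ ψ α (L α)
  isRadialSolution : ∀ α > 0, IsRadialSolution f φ ψ α (L α) (U α)

lemma tendsto_sqrt_sqrt : Tendsto (fun α : ℝ => √(√α)) atTop atTop :=
  Real.tendsto_sqrt_atTop.comp Real.tendsto_sqrt_atTop

lemma log_eq_four_mul_log_sqrt_sqrt {α : ℝ} (hα : 0 ≤ α) :
    Real.log α = 4 * Real.log (√(√α)) := by
  rw [Real.log_sqrt (Real.sqrt_nonneg α), Real.log_sqrt hα]
  ring

lemma tendsto_log_div_sqrt_sqrt :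
    Tendsto (fun α : ℝ => Real.log α / √(√α)) atTop (𝓝 0) := by
  have h1 : Tendsto (fun q : ℝ => Real.log q / q) atTop (𝓝 0) :=
    Real.isLittleO_log_id_atTop.tendsto_div_nhds_zero
  have h2 := (h1.comp tendsto_sqrt_sqrt).const_mul 4
  rw [mul_zero] at h2
  refine h2.congr' ?_
  filter_upwards [eventually_ge_atTop 0] with α hα
  rw [log_eq_four_mul_log_sqrt_sqrt hα]
  simp only [Function.comp_apply]
  ring

/-! ### Asymptotics of the extremal profiles. -/

section asymptotics

variable {f φ ψ : ℝ → ℝ} {L : ℝ → ℝ} {U : ℝ → ℝ → ℝ}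

lemma IsExtremalFamily.le_param (hF : IsExtremalFamily f φ ψ L U) (D : RadialData f φ ψ)
    {α lam : ℝ} {u : ℝ → ℝ} (hα : 0 < α) (hl : 0 < lam) (hu : IsRadialSolution f φ ψ α lam u) :
    lam ≤ L α :=
  (hF.isExtremalParameter α hα).1 ⟨hl, _, hu.isClassicalSolution D hα.le hl⟩

lemma IsExtremalFamily.tendsto_param_div (hF : IsExtremalFamily f φ ψ L U)
    (D : RadialData f φ ψ) : Tendsto (fun α => L α / α) atTop (𝓝 0) := by
  have h : Tendsto (fun α => (∫ t in Ioi 0, 1 / f t) / (α * pot φ α ψ 0)) atTop (𝓝 0) :=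
    tendsto_const_nhds.div_atTop D.tendsto_mul_pot_ψ
  refine tendsto_of_tendsto_of_tendsto_of_le_of_le' tendsto_const_nhds h ?_ ?_
  · filter_upwards [eventually_gt_atTop 0] with α hα using (div_pos (hF.pos α hα) hα).le
  · filter_upwards [eventually_gt_atTop 0] with α hα
    have hp := D.pot_ψ_pos hα.le
    have := (hF.isRadialSolution α hα).mul_pot_lt D (hF.pos α hα).le
    rw [div_le_div_iff₀ hα (by positivity)]
    nlinarith

lemma IsExtremalFamily.exists_div_param_le (hF : IsExtremalFamily f φ ψ L U)
    (D : RadialData f φ ψ) :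
    ∃ C, 0 < C ∧ ∀ᶠ α in atTop, α / L α ≤ C * Real.log α := by
  obtain ⟨C, hC, h⟩ := D.exists_pot_ψ_zero_le
  have hf := D.f_pos 1
  refine ⟨f 1 * C, by positivity, ?_⟩
  filter_upwards [h, eventually_gt_atTop 0] with α h hα
  have hp := D.pot_ψ_pos hα.le
  have hl : 0 < 1 / (f 1 * pot φ α ψ 0) := by positivity
  obtain ⟨u, hu⟩ := D.exists_isRadialSolution_of_le hα.le hl.le (by
    rw [mul_assoc, one_div, inv_mul_cancel₀ (by positivity)])
  have h1 := hF.le_param D hα hl hu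
  have hL := hF.pos α hα
  rw [div_le_iff₀ (by positivity)] at h1
  rw [div_le_iff₀ hL]
  calc α ≤ α * (L α * (f 1 * pot φ α ψ 0)) := le_mul_of_one_le_right hα.le h1
    _ = f 1 * L α * (α * pot φ α ψ 0) := by ring
    _ ≤ f 1 * L α * (C * Real.log α) := by gcongr
    _ = _ := by ring

/-- The supersolution bounds $\lambda^*p(0)$ below by almost $F(K+1)$, while the time map inequality
bounds it above by $F(u^*(0))$. -/
lemma IsExtremalFamily.tendsto_apply_zero (hF : IsExtremalFamily f φ ψ L U)
    (D : RadialData f φ ψ) : Tendsto (fun α => U α 0) atTop atTop := by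
  refine tendsto_atTop.2 fun K' => ?_
  set K := max K' 0 with hK
  have hK0 : 0 ≤ timeMap f K := by
    rw [← timeMap_zero (f := f)]
    exact D.strictMono_timeMap.monotone (le_max_right _ _)
  have hK1 : timeMap f K < timeMap f (K + 1) := D.strictMono_timeMap (lt_add_one K)
  set a := timeMap f K
  set b := timeMap f (K + 1)
  -- If $F(u^*(0))\le a$, the two bounds give $b-\varepsilon\le(1+\varepsilon)a$, that is
  -- $b-a\le\varepsilon(1+a)=(b-a)/2$, which is absurd.
  set ε := (b - a) / (2 * (1 + a)) with hε
  have hε0 : 0 < ε := div_pos (by linarith) (by linarith)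
  have hεe : ε * (1 + a) = (b - a) / 2 := by
    rw [hε]
    field_simp
  have hεb : ε < b := by nlinarith
  filter_upwards [D.eventually_exists_isRadialSolution (K := K + 1)
    (by linarith [le_max_right K' 0]) hε0 hεb, eventually_gt_atTop 0] with α ⟨u, hu⟩ hα
  have hp := D.pot_ψ_pos hα.le
  have h1 := hF.le_param D hα (div_pos (by linarith) (by positivity)) hu
  rw [div_le_iff₀ (by positivity)] at h1
  have h2 := (hF.isRadialSolution α hα).le_timeMap_sub D (hF.pos α hα).le (r := 1)
    ⟨zero_le_one, le_rfl⟩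
  rw [pot_one, (hF.isRadialSolution α hα).apply_one, timeMap_zero, sub_zero, sub_zero] at h2
  have h3 : a < timeMap f (U α 0) := by
    by_contra! hcon
    have h4 : L α * ((1 + ε) * pot φ α ψ 0) ≤ (1 + ε) * a := by nlinarith
    change b - ε ≤ _ at h1
    nlinarith
  have h4 := D.strictMono_timeMap.lt_iff_lt.1 h3
  exact (le_max_left _ _).trans h4.le

/-- Up to radius $\alpha^{-1/4}$ the potential of $\psi$ has already dropped by at least a multiple
of $\log\alpha/\alpha$. As $\lambda^*\ge\alpha/(C\log\alpha)$, the time map drops by at least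
$1/(32C)$, so $F(u^*)$ stays a fixed distance below $F(\infty)$. -/
lemma IsExtremalFamily.exists_apply_le (hF : IsExtremalFamily f φ ψ L U)
    (D : RadialData f φ ψ) :
    ∃ K, 0 < K ∧ ∀ᶠ α in atTop, ∀ r ∈ Icc (1 / √(√α)) 1, U α r ≤ K := by
  obtain ⟨C, hC, hCle⟩ := hF.exists_div_param_le D
  obtain ⟨δ, hδ, hδ1, hδle⟩ := D.exists_le_pot_ψ_sub
  set F := ∫ t in Ioi 0, 1 / f t with hFdef
  have hc : 0 < 1 / (32 * C) := by positivity
  obtain ⟨K, hK⟩ := ((D.tendsto_timeMap.eventually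
    (lt_mem_nhds (by linarith : F - 1 / (32 * C) < F))).and (eventually_gt_atTop 0)).exists
  refine ⟨K, hK.2, ?_⟩
  filter_upwards [hCle, eventually_gt_atTop 0, tendsto_sqrt_sqrt.eventually_ge_atTop (1 / δ),
    tendsto_sqrt_sqrt.eventually_ge_atTop 2,
    Real.tendsto_log_atTop.eventually_ge_atTop (8 * Real.log 2)] with α h1 hα hq1 hq2 hlog r hr
  have hq0 : 0 < √(√α) := by linarith
  have hqq : √(√α) * √(√α) = √α := Real.mul_self_sqrt (Real.sqrt_nonneg α)
  set q := √(√α)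
  have hL := hF.pos α hα
  have hu := hF.isRadialSolution α hα
  have h2 := hδle α hα (1 / q) (by
    rw [← hqq, div_le_div_iff₀ (by positivity) hq0]
    nlinarith) (by rwa [one_div_le hq0 hδ])
  have h3 : 1 / q * √α / 2 = q / 2 := by
    rw [← hqq]
    field_simp
  rw [h3, Real.log_div hq0.ne' (by norm_num)] at h2
  have h4 : Real.log α = 4 * Real.log q := log_eq_four_mul_log_sqrt_sqrt hα.le
  have hq1' : 1 / q ≤ 1 := by
    rw [div_le_one hq0]
    linarith
  have h5 := hu.le_timeMap_sub D hL.le (r := 1 / q) ⟨by positivity, hq1'⟩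
  have h6 := D.timeMap_lt (U α 0)
  rw [← hFdef] at h6
  set p := pot φ α ψ 0 - pot φ α ψ (1 / q)
  have h7 : 1 / (32 * C) ≤ L α * p := by
    have hlog2 : 0 < Real.log 2 := Real.log_pos (by norm_num)
    have hlogα : 0 < Real.log α := by linarith
    have h8 : Real.log α / 8 ≤ 4 * α * p := by linarith
    rw [div_le_iff₀ hL] at h1
    rw [div_le_iff₀ (by positivity)]
    have hp0 : 0 < p := by
      by_contra! hcon
      have : α * p ≤ 0 := mul_nonpos_of_nonneg_of_nonpos hα.le hcon
      linarith
    have h9 : α * p ≤ C * Real.log α * L α * p := by gcongr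
    have h10 : Real.log α * 1 ≤ Real.log α * (L α * p * (32 * C)) := by
      calc Real.log α * 1 ≤ 32 * (α * p) := by linarith
        _ ≤ 32 * (C * Real.log α * L α * p) := by gcongr
        _ = _ := by ring
    exact le_of_mul_le_mul_left h10 hlogα
  have h8 : timeMap f (U α (1 / q)) < timeMap f K := by linarith [hK.1]
  have h9 := (D.strictMono_timeMap.lt_iff_lt.1 h8).le
  exact (hu.antitone D hL.le hr.1).trans h9

/-- Splitting the mass at $\delta=r/3$, the inner part is at most $2A(2\delta)K$, negligible against
$A(t)$ for $t\ge3\delta$. The outer part has source at most $\lambda^*f(K)\psi$ and contributes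
$O(\lambda^*/\alpha)$. -/
lemma IsExtremalFamily.tendsto_apply (hF : IsExtremalFamily f φ ψ L U) (D : RadialData f φ ψ)
    {r : ℝ} (hr : r ∈ Ioo (0 : ℝ) 1) : Tendsto (fun α => U α r) atTop (𝓝 0) := by
  obtain ⟨K, hK, hKle⟩ := hF.exists_apply_le D
  obtain ⟨δ, rfl⟩ : ∃ δ, r = 3 * δ := ⟨r / 3, by ring⟩
  have hδ : 0 < δ := by linarith [hr.1]
  have hδ1 : 3 * δ < 1 := hr.2
  set m := ∫ t in Ioo 0 1, maxRatio φ ψ t with hm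
  set c := ∫ s in 2 * δ..3 * δ, s * φ s with hc
  have hc0 : 0 < c := by
    refine intervalIntegral.intervalIntegral_pos_of_pos_on
      ((continuous_id.mul D.φ_cont).intervalIntegrable _ _) (fun t ht => ?_) (by linarith)
    exact mul_pos (by linarith [ht.1]) (D.φ_pos t (by linarith [ht.2]))
  have hfK := D.f_pos K
  have hbound : ∀ᶠ α in atTop, U α (3 * δ) ≤
      2 * K / (3 * δ) * Real.exp (-(c * α)) + L α / α * (f K * m / (3 * δ)) := by
    filter_upwards [hKle, eventually_gt_atTop 0,
      tendsto_sqrt_sqrt.eventually_ge_atTop (1 / δ)] with α h1 hα hq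
    have hL := hF.pos α hα
    have hu := hF.isRadialSolution α hα
    have hq0 : 0 < √(√α) := (one_div_pos.2 hδ).trans_le hq
    have hqδ : 1 / √(√α) ≤ δ := by rwa [one_div_le hq0 hδ]
    have hs := D.continuous_source (lam := L α) hu.cont
    have hfψ : Continuous fun s => L α * f K * ψ s := D.ψ_cont.const_mul _
    have hmδ : mass φ α (source f ψ (L α) (U α)) δ ≤ 2 * weight φ α (2 * δ) * K := by
      refine (hu.mass_le D hα.le hL.le hδ (by linarith)).trans ?_
      have := weight_pos (φ := φ) (α := α) (2 * δ)
      have := h1 δ ⟨hqδ, by linarith⟩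
      gcongr
    set B := 2 * weight φ α (2 * δ) * K with hB
    have hB0 : 0 < B := mul_pos (mul_pos two_pos (weight_pos _)) hK
    have hmass : ∀ t ∈ Icc δ 1, mass φ α (source f ψ (L α) (U α)) t ≤
        B + mass φ α (fun s => L α * f K * ψ s) t := by
      intro t ht
      have h2 := le_of_hasDerivAt_nonneg
        (F := fun t => mass φ α (fun s => L α * f K * ψ s) t
          - mass φ α (source f ψ (L α) (U α)) t) ht.1
        ((continuous_mass D.φ_cont hfψ).sub (continuous_mass D.φ_cont hs)).continuousOn
        (fun s _ => (hasDerivAt_mass D.φ_cont hfψ s).sub (hasDerivAt_mass D.φ_cont hs s))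
        fun s hs' => ?_
      · have h3 : 0 ≤ mass φ α (fun s => L α * f K * ψ s) δ :=
          mass_nonneg hδ.le fun s _ => mul_nonneg (by positivity) (D.ψ_nonneg s)
        linarith
      · rw [← mul_sub]
        have hs0 : 0 < s := hδ.trans hs'.1
        refine mul_nonneg (mul_nonneg hs0.le (weight_pos s).le) (sub_nonneg.2 ?_)
        have h3 : f (U α s) ≤ f K :=
          D.f_mono (h1 s ⟨hqδ.trans hs'.1.le, hs'.2.le.trans ht.2⟩)
        calc L α * ψ s * f (U α s) ≤ L α * ψ s * f K :=
              mul_le_mul_of_nonneg_left h3 (mul_nonneg hL.le (D.ψ_nonneg s))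
          _ = L α * f K * ψ s := by ring
    have hE : weight φ α (2 * δ) = weight φ α (3 * δ) * Real.exp (-(c * α)) := by
      rw [weight, weight, ← Real.exp_add]
      congr 1
      have h2 := intervalIntegral.integral_add_adjacent_intervals (f := fun s => s * φ s)
        ((continuous_id.mul D.φ_cont).intervalIntegrable (μ := volume) 0 (2 * δ))
        ((continuous_id.mul D.φ_cont).intervalIntegrable (μ := volume) (2 * δ) (3 * δ))
      rw [← h2, ← hc]
      ring
    have hpot := D.pot_ψ_le hα (d := 3 * δ) (by linarith) hδ1
    rw [← hm] at hpot
    set e := 2 * K / (3 * δ) * Real.exp (-(c * α)) with he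
    have he0 : 0 < e := by positivity
    have hflux : ∀ t ∈ Icc (3 * δ) 1, flux φ α (source f ψ (L α) (U α)) t ≤
        e + flux φ α (fun s => L α * f K * ψ s) t := by
      intro t ht
      have ht0 : 0 < t := by linarith [ht.1]
      have hw := weight_pos (φ := φ) (α := α) t
      have h2 := hmass t ⟨by linarith [ht.1], ht.2⟩
      have h3 : B / (t * weight φ α t) ≤ e := by
        rw [div_le_iff₀ (by positivity), hB, hE, he]
        have h4 : weight φ α (3 * δ) ≤ weight φ α t :=
          weight_mono D.φ_cont D.φ_nonneg hα.le (by linarith) ht.1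
        have h5 : 3 * δ * weight φ α (3 * δ) ≤ t * weight φ α t :=
          mul_le_mul ht.1 h4 (weight_pos _).le ht0.le
        calc 2 * (weight φ α (3 * δ) * Real.exp (-(c * α))) * K
            = 2 * K / (3 * δ) * Real.exp (-(c * α)) * (3 * δ * weight φ α (3 * δ)) := by
              field_simp
          _ ≤ _ := by gcongr
      calc flux φ α (source f ψ (L α) (U α)) t
          ≤ (B + mass φ α (fun s => L α * f K * ψ s) t) / (t * weight φ α t) :=
            div_le_div_of_nonneg_right h2 (by positivity)
        _ = B / (t * weight φ α t) + flux φ α (fun s => L α * f K * ψ s) t := add_div _ _ _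
        _ ≤ _ := by linarith
    have h2 : pot φ α (source f ψ (L α) (U α)) (3 * δ) ≤
        ∫ t in 3 * δ..1, (e + flux φ α (fun s => L α * f K * ψ s) t) :=
      intervalIntegral.integral_mono_on hδ1.le
        ((continuous_flux D.φ_cont hs).intervalIntegrable _ _)
        ((continuous_const.add (continuous_flux D.φ_cont hfψ)).intervalIntegrable _ _) hflux
    rw [intervalIntegral.integral_add (by simp)
      ((continuous_flux D.φ_cont hfψ).intervalIntegrable _ _), intervalIntegral.integral_const,
      smul_eq_mul] at h2
    have h3 : ∫ t in 3 * δ..1, flux φ α (fun s => L α * f K * ψ s) t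
        = L α * f K * pot φ α ψ (3 * δ) := pot_const_mul _ _
    rw [h3, ← hu.eq_pot ⟨by linarith, hδ1.le⟩] at h2
    have h4 : L α * f K * pot φ α ψ (3 * δ) ≤ L α * f K * (m / (α * (3 * δ))) := by gcongr
    have h5 : L α * f K * (m / (α * (3 * δ))) = L α / α * (f K * m / (3 * δ)) := by field_simp
    have h6 : (1 - 3 * δ) * e ≤ e := by nlinarith
    linarith
  have hlim : Tendsto (fun α => 2 * K / (3 * δ) * Real.exp (-(c * α))
      + L α / α * (f K * m / (3 * δ))) atTop (𝓝 0) := by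
    have h1 : Tendsto (fun α => Real.exp (-(c * α))) atTop (𝓝 0) :=
      Real.tendsto_exp_neg_atTop_nhds_zero.comp (tendsto_id.const_mul_atTop hc0)
    have h2 := (h1.const_mul (2 * K / (3 * δ))).add
      ((hF.tendsto_param_div D).mul_const (f K * m / (3 * δ)))
    simpa using h2
  refine tendsto_of_tendsto_of_tendsto_of_le_of_le' tendsto_const_nhds hlim ?_ hbound
  filter_upwards [eventually_gt_atTop 0] with α hα
  exact (hF.isRadialSolution α hα).nonneg D (hF.pos α hα).le _

/-- The nonlinearity does not concentrate at the origin. -/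
lemma IsExtremalFamily.tendsto_integral_inner (hF : IsExtremalFamily f φ ψ L U)
    (D : RadialData f φ ψ) :
    Tendsto (fun α => ∫ s in (0 : ℝ)..1 / √(√α), s * f (U α s)) atTop (𝓝 0) := by
  obtain ⟨C, hC, hCle⟩ := hF.exists_div_param_le D
  obtain ⟨δ, hδ, -, hψ⟩ := exists_half_le D.ψ_cont (by rw [D.ψ_zero]; exact one_pos) one_pos
  rw [D.ψ_zero] at hψ
  -- The upper bound below is $f(u(\rho))\le64C\log\alpha\,u(\rho)=256C\log q\,u(\rho)$ with
  -- $q=\alpha^{1/4}$. A larger constant here contradicts it as soon as $u(\rho)>q\ge S$.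
  obtain ⟨S, hS⟩ := eventually_atTop.1 (D.superlinear_log (C := 256 * C + 1) (by positivity))
  have hbound : ∀ᶠ α in atTop, ∫ s in (0 : ℝ)..1 / √(√α), s * f (U α s) ≤
      40 * C * (Real.log α / √(√α)) := by
    filter_upwards [hCle, eventually_gt_atTop 0, tendsto_sqrt_sqrt.eventually_ge_atTop (1 / δ),
      tendsto_sqrt_sqrt.eventually_ge_atTop 2, tendsto_sqrt_sqrt.eventually_ge_atTop S]
      with α h1 hα hqδ hq2 hqS
    have hq0 : 0 < √(√α) := by linarith
    have hqq : √(√α) * √(√α) = √α := Real.mul_self_sqrt (Real.sqrt_nonneg α)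
    have hss : √α * √α = α := Real.mul_self_sqrt hα.le
    have hlq : Real.log α = 4 * Real.log (√(√α)) := log_eq_four_mul_log_sqrt_sqrt hα.le
    set q := √(√α)
    have hq4 : α = q ^ 4 := by rw [← hss, ← hqq]; ring
    have hlogq : 0 < Real.log q := Real.log_pos (by linarith)
    have hL := hF.pos α hα
    have hu := hF.isRadialSolution α hα
    set u := U α
    -- This is $1/(2\sqrt\alpha)$, the radius up to which the drift is harmless: $A(2\rho)\le
    -- e^{1/2}\le2$.
    set ρ := 1 / (2 * q ^ 2) with hρ
    have hρ0 : 0 < ρ := by positivity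
    have hρ1 : 2 * ρ ≤ 1 := by
      rw [hρ, mul_one_div, div_le_one (by positivity)]
      nlinarith
    have hρq : ρ ≤ 1 / q := one_div_le_one_div_of_le hq0 (by nlinarith)
    have hqδ' : 1 / q ≤ δ := by rwa [one_div_le hq0 hδ]
    have hψρ : 1 / 2 ≤ ψ ρ := hψ ρ ⟨hρ0.le, hρq.trans hqδ'⟩
    have hw2 : weight φ α (2 * ρ) ≤ 2 := by
      have h2 : ∫ s in (0 : ℝ)..2 * ρ, s * φ s ≤ ∫ s in (0 : ℝ)..2 * ρ, s := by
        refine intervalIntegral.integral_mono_on (by positivity)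
          ((continuous_id.mul D.φ_cont).intervalIntegrable _ _)
          (continuous_id.intervalIntegrable _ _) fun s hs => ?_
        exact mul_le_of_le_one_right hs.1 (D.φ_le_one hs.1)
      rw [integral_id] at h2
      have h3 : α * ∫ s in (0 : ℝ)..2 * ρ, s * φ s ≤ 1 / 2 := by
        calc α * ∫ s in (0 : ℝ)..2 * ρ, s * φ s ≤ α * (((2 * ρ) ^ 2 - 0 ^ 2) / 2) := by gcongr
          _ = 1 / 2 := by
            rw [hρ, hq4]
            field_simp
            norm_num
      have h4 : Real.exp (1 / 2) ≤ 2 := by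
        have h5 : Real.exp (1 / 2) * Real.exp (1 / 2) = Real.exp 1 := by
          rw [← Real.exp_add]
          norm_num
        have h6 := Real.exp_one_lt_d9
        have h7 := Real.exp_pos (1 / 2)
        nlinarith
      exact (Real.exp_le_exp.2 h3).trans h4
    have hu0 : 0 ≤ u ρ := hu.nonneg D hL.le ρ
    have hfu : f (u ρ) ≤ 64 * C * Real.log α * u ρ := by
      have h2 := hu.apply_le_of_superlinear D hα.le hL hρ0 hρ1 hψρ
      have h3 : ρ ^ 2 = 1 / (4 * α) := by
        rw [hρ, hq4]
        field_simp
        norm_num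
      rw [h3] at h2
      have h4 : 8 * weight φ α (2 * ρ) * u ρ ≤ 8 * 2 * u ρ := by gcongr
      have h5 : f (u ρ) = f (u ρ) * (L α * (1 / (4 * α))) * (4 * (α / L α)) := by field_simp
      rw [h5]
      calc f (u ρ) * (L α * (1 / (4 * α))) * (4 * (α / L α))
          ≤ (8 * 2 * u ρ) * (4 * (C * Real.log α)) :=
            mul_le_mul (h2.trans h4) (by linarith) (by positivity) (by positivity)
        _ = _ := by ring
    have huq : u ρ ≤ q := by
      by_contra! hcon
      have h2 := hS (u ρ) (hqS.trans hcon.le)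
      have h3 : Real.log q ≤ Real.log (u ρ) := Real.log_le_log hq0 hcon.le
      have hup : 0 < u ρ := hq0.trans hcon
      have h4 : 64 * C * Real.log α * u ρ ≤ 256 * C * (u ρ * Real.log (u ρ)) := by
        rw [hlq]
        calc 64 * C * (4 * Real.log q) * u ρ = 256 * C * (u ρ * Real.log q) := by ring
          _ ≤ _ := by gcongr
      have h5 : 0 < u ρ * Real.log (u ρ) := mul_pos hup (hlogq.trans_le h3)
      nlinarith
    have hsf : Continuous fun s => s * f (u s) := continuous_id.mul (D.f_cont.comp hu.cont)
    -- Inside $\rho$ the mass bound gives at most $8q/\lambda^*$; between $\rho$ and $1/q$ the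
    -- integrand is controlled by $f(u(\rho))\le64C\log\alpha\,q$ and the area factor $q^{-2}/2$.
    -- Both are of order $\log\alpha/\alpha^{1/4}$.
    have hin : ∫ s in (0 : ℝ)..ρ, s * f (u s) ≤ 8 * C * (Real.log α / q) := by
      have h2 := hu.mass_le D hα.le hL.le hρ0 hρ1
      have h3 : ∫ s in (0 : ℝ)..ρ, L α / 2 * (s * f (u s)) ≤
          mass φ α (source f ψ (L α) u) ρ := by
        refine intervalIntegral.integral_mono_on hρ0.le
          ((hsf.const_mul _).intervalIntegrable _ _)
          ((continuous_mass_integrand D.φ_cont (D.continuous_source hu.cont)).intervalIntegrable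
            _ _) fun s hs => ?_
        have h4 := one_le_weight (α := α) D.φ_cont D.φ_nonneg hα.le hs.1
        have h5 := hψ s ⟨hs.1, hs.2.trans (hρq.trans hqδ')⟩
        have h6 : 1 * (1 / 2) ≤ weight φ α s * ψ s := by gcongr
        have h7 : 0 ≤ L α * (s * f (u s)) :=
          mul_nonneg hL.le (mul_nonneg hs.1 (D.f_pos _).le)
        calc L α / 2 * (s * f (u s)) = L α * (s * f (u s)) * (1 * (1 / 2)) := by ring
          _ ≤ L α * (s * f (u s)) * (weight φ α s * ψ s) := mul_le_mul_of_nonneg_left h6 h7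
          _ = _ := by simp only [source]; ring
      rw [intervalIntegral.integral_const_mul] at h3
      have h4 : 2 * weight φ α (2 * ρ) * u ρ ≤ 2 * 2 * q := by
        have := weight_pos (φ := φ) (α := α) (2 * ρ)
        gcongr
      have h5 : ∫ s in (0 : ℝ)..ρ, s * f (u s) ≤ 8 * q / L α := by
        rw [le_div_iff₀ hL]
        linarith
      refine h5.trans ?_
      calc 8 * q / L α = 8 * q / α * (α / L α) := by field_simp
        _ ≤ 8 * q / α * (C * Real.log α) := by gcongr
        _ = 8 * C * (Real.log α / q) * (q ^ 2 / α) := by field_simp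
        _ ≤ 8 * C * (Real.log α / q) * 1 := by
          have h6 : q ^ 2 / α ≤ 1 := by
            rw [hq4, div_le_one (by positivity)]
            exact pow_le_pow_right₀ (by linarith) (by norm_num)
          have : 0 ≤ Real.log α := by rw [hlq]; positivity
          gcongr
        _ = _ := mul_one _
    have hmid : ∫ s in ρ..1 / q, s * f (u s) ≤ 32 * C * (Real.log α / q) := by
      have h2 : ∫ s in ρ..1 / q, s * f (u s) ≤ ∫ s in ρ..1 / q, s * f (u ρ) := by
        refine intervalIntegral.integral_mono_on hρq (hsf.intervalIntegrable _ _)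
          ((by fun_prop : Continuous _).intervalIntegrable _ _) fun s hs => ?_
        exact mul_le_mul_of_nonneg_left (D.f_mono (hu.antitone D hL.le hs.1))
          (hρ0.le.trans hs.1)
      rw [intervalIntegral.integral_mul_const, integral_id] at h2
      have hlα : 0 < Real.log α := by rw [hlq]; positivity
      have h3 : f (u ρ) ≤ 64 * C * Real.log α * q := hfu.trans (by gcongr)
      have h4 : ((1 / q) ^ 2 - ρ ^ 2) / 2 ≤ (1 / q) ^ 2 / 2 := by
        have := sq_nonneg ρ
        linarith
      calc ∫ s in ρ..1 / q, s * f (u s) ≤ ((1 / q) ^ 2 - ρ ^ 2) / 2 * f (u ρ) := h2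
        _ ≤ (1 / q) ^ 2 / 2 * (64 * C * Real.log α * q) :=
          mul_le_mul h4 h3 (D.f_pos _).le (by positivity)
        _ = _ := by
          field_simp
          norm_num
    rw [← intervalIntegral.integral_add_adjacent_intervals (hsf.intervalIntegrable 0 ρ)
      (hsf.intervalIntegrable ρ (1 / q))]
    linarith
  have hlim := tendsto_log_div_sqrt_sqrt.const_mul (40 * C)
  rw [mul_zero] at hlim
  refine tendsto_of_tendsto_of_tendsto_of_le_of_le' tendsto_const_nhds hlim ?_ hbound
  exact Eventually.of_forall fun α => intervalIntegral.integral_nonneg (by positivity)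
    fun s hs => mul_nonneg hs.1 (D.f_pos _).le

/-- The interval is cut at $\alpha^{-1/4}$ and at a small fixed $\delta$: nonconcentration handles
the inner piece, the uniform bound `K` makes the middle one at most $G(K)\delta$, and
$u(\delta)\to0$ the outer one. -/
lemma IsExtremalFamily.tendsto_integral_comp (hF : IsExtremalFamily f φ ψ L U)
    (D : RadialData f φ ψ) {G : ℝ → ℝ} (hG : Continuous G) (hGm : Monotone G) (hG0 : G 0 = 0)
    {c : ℝ} (hGc : ∀ s, 0 ≤ s → G s ≤ c * f s) :
    Tendsto (fun α => ∫ s in (0 : ℝ)..1, s * G (U α s)) atTop (𝓝 0) := by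
  obtain ⟨K, hK, hKle⟩ := hF.exists_apply_le D
  have hGK : 0 ≤ G K := by
    rw [← hG0]
    exact hGm hK.le
  refine tendsto_order.2 ⟨fun a ha => ?_, fun ε hε => ?_⟩
  · filter_upwards [eventually_gt_atTop 0] with α hα
    refine ha.trans_le (intervalIntegral.integral_nonneg zero_le_one fun s hs => ?_)
    refine mul_nonneg hs.1 ?_
    rw [← hG0]
    exact hGm ((hF.isRadialSolution α hα).nonneg D (hF.pos α hα).le s)
  obtain ⟨δ, hδ0, hδ1, hδε⟩ : ∃ δ, 0 < δ ∧ δ < 1 ∧ G K * δ < ε / 2 := by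
    have h1 : Tendsto (fun δ : ℝ => G K * δ) (𝓝[>] 0) (𝓝 0) := by
      have : Tendsto (fun δ : ℝ => G K * δ) (𝓝 0) (𝓝 (G K * 0)) :=
        (by fun_prop : Continuous fun δ : ℝ => G K * δ).tendsto 0
      rw [mul_zero] at this
      exact this.mono_left nhdsWithin_le_nhds
    obtain ⟨δ, h2, h3⟩ := ((h1.eventually (gt_mem_nhds (half_pos hε))).and
      (Ioo_mem_nhdsGT (zero_lt_one' ℝ))).exists
    exact ⟨δ, h3.1, h3.2, h2⟩
  have hGδ : Tendsto (fun α => G (U α δ)) atTop (𝓝 0) := by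
    have := (hG.tendsto 0).comp (hF.tendsto_apply D ⟨hδ0, hδ1⟩)
    rwa [hG0] at this
  have hsum : Tendsto (fun α => c * (∫ s in (0 : ℝ)..1 / √(√α), s * f (U α s)) + G (U α δ))
      atTop (𝓝 0) := by
    simpa using ((hF.tendsto_integral_inner D).const_mul c).add hGδ
  filter_upwards [hKle, eventually_gt_atTop 0, tendsto_sqrt_sqrt.eventually_ge_atTop (1 / δ),
    hsum.eventually (gt_mem_nhds (half_pos hε))] with α h1 hα hq h2
  have hq0 : 0 < √(√α) := (one_div_pos.2 hδ0).trans_le hq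
  have hqδ : 1 / √(√α) ≤ δ := by rwa [one_div_le hq0 hδ0]
  set ρ := 1 / √(√α)
  have hρ0 : 0 < ρ := one_div_pos.2 hq0
  have hL := hF.pos α hα
  have hu := hF.isRadialSolution α hα
  have hsG : Continuous fun s => s * G (U α s) := continuous_id.mul (hG.comp hu.cont)
  have hsf : Continuous fun s => s * f (U α s) := continuous_id.mul (D.f_cont.comp hu.cont)
  have i1 : ∫ s in (0 : ℝ)..ρ, s * G (U α s) ≤ c * ∫ s in (0 : ℝ)..ρ, s * f (U α s) := by
    rw [← intervalIntegral.integral_const_mul]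
    refine intervalIntegral.integral_mono_on hρ0.le (hsG.intervalIntegrable _ _)
      ((hsf.const_mul c).intervalIntegrable _ _) fun s hs => ?_
    have := mul_le_mul_of_nonneg_left (hGc _ (hu.nonneg D hL.le s)) hs.1
    linarith
  have i2 : ∫ s in ρ..δ, s * G (U α s) ≤ ∫ s in ρ..δ, G K := by
    refine intervalIntegral.integral_mono_on hqδ (hsG.intervalIntegrable _ _) (by simp)
      fun s hs => ?_
    have h3 : G (U α s) ≤ G K := hGm (h1 s ⟨hs.1, hs.2.trans hδ1.le⟩)
    have h4 : s * G (U α s) ≤ s * G K := mul_le_mul_of_nonneg_left h3 (hρ0.le.trans hs.1)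
    have h5 : s ≤ 1 := hs.2.trans hδ1.le
    nlinarith
  have i3 : ∫ s in δ..1, s * G (U α s) ≤ ∫ s in δ..1, G (U α δ) := by
    refine intervalIntegral.integral_mono_on hδ1.le (hsG.intervalIntegrable _ _) (by simp)
      fun s hs => ?_
    have h3 : G (U α s) ≤ G (U α δ) := hGm (hu.antitone D hL.le hs.1)
    have h4 : s * G (U α s) ≤ s * G (U α δ) := mul_le_mul_of_nonneg_left h3 (hδ0.le.trans hs.1)
    have h5 : 0 ≤ G (U α δ) := by
      rw [← hG0]
      exact hGm (hu.nonneg D hL.le δ)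
    have h6 := hs.2
    nlinarith
  rw [intervalIntegral.integral_const, smul_eq_mul] at i2 i3
  have h5 : 0 ≤ G (U α δ) := by
    rw [← hG0]
    exact hGm (hu.nonneg D hL.le δ)
  rw [← intervalIntegral.integral_add_adjacent_intervals (hsG.intervalIntegrable 0 ρ)
    (hsG.intervalIntegrable ρ 1), ← intervalIntegral.integral_add_adjacent_intervals
    (hsG.intervalIntegrable ρ δ) (hsG.intervalIntegrable δ 1)]
  have h6 : (δ - ρ) * G K ≤ G K * δ := by nlinarith
  have h7 : (1 - δ) * G (U α δ) ≤ G (U α δ) := by nlinarith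
  linarith

end asymptotics

/-! ### Polar coordinates, extension of the data and conclusion. -/

lemma integral_ball_norm (h : ℝ → ℝ) :
    ∫ x in Metric.ball (0 : Plane) 1, h ‖x‖ =
      2 * volume.real (Metric.ball (0 : Plane) 1) * ∫ s in (0 : ℝ)..1, s * h s := by
  have h1 : ∫ x in Metric.ball (0 : Plane) 1, h ‖x‖ =
      ∫ x : Plane, (Iio (1 : ℝ)).indicator h ‖x‖ := by
    rw [← integral_indicator Metric.isOpen_ball.measurableSet]
    refine integral_congr_ae (Eventually.of_forall fun x => ?_)
    by_cases hx : ‖x‖ < 1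
    · simp [indicator, hx]
    · simp [indicator, hx]
  rw [h1, integral_fun_norm_addHaar, intervalIntegral.integral_of_le zero_le_one,
    integral_Ioc_eq_integral_Ioo]
  have h2 : ∫ y in Ioi (0 : ℝ), y ^ (Module.finrank ℝ Plane - 1) • (Iio (1 : ℝ)).indicator h y
      = ∫ s in Ioo (0 : ℝ) 1, s * h s := by
    have h3 : (fun y : ℝ => y ^ (Module.finrank ℝ Plane - 1) • (Iio (1 : ℝ)).indicator h y)
        = (Iio (1 : ℝ)).indicator fun s => s * h s := by
      funext y
      by_cases hy : y < 1
      · simp [indicator, hy]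
      · simp [indicator, hy]
    rw [h3, setIntegral_indicator measurableSet_Iio]
    rfl
  rw [h2]
  simp
  ring

section extension

variable {f φ ψ : ℝ → ℝ}

/-- The extension of a nonlinearity on `[0, ∞)` by its value at `0`. -/
def extendNonneg (f : ℝ → ℝ) (s : ℝ) : ℝ := f (max s 0)

lemma extendNonneg_of_nonneg {s : ℝ} (hs : 0 ≤ s) : extendNonneg f s = f s := by
  rw [extendNonneg, max_eq_left hs]

/-- The extension of a function on `[0, 1]` by constants. -/
def extendUnit (φ : ℝ → ℝ) (r : ℝ) : ℝ := φ (clamp r)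

lemma extendUnit_of_mem {r : ℝ} (hr : r ∈ Icc (0 : ℝ) 1) : extendUnit φ r = φ r := by
  rw [extendUnit, clamp_of_mem hr]

lemma maxRatio_extendUnit {s : ℝ} (hs : s ≤ 1) :
    maxRatio (extendUnit φ) (extendUnit ψ) s = maxRatio φ ψ s := by
  unfold maxRatio
  congr 1
  refine image_congr fun r hr => ?_
  have hr' : r ∈ Icc (0 : ℝ) 1 := ⟨hr.1, hr.2.trans hs⟩
  rw [extendUnit_of_mem hr', extendUnit_of_mem hr']

lemma continuous_extendUnit (h : ContinuousOn φ (Icc 0 1)) : Continuous (extendUnit φ) :=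
  h.comp_continuous continuous_clamp clamp_mem

lemma antitone_extendUnit (h : AntitoneOn φ (Icc 0 1)) : Antitone (extendUnit φ) :=
  fun _ _ hrs => h (clamp_mem _) (clamp_mem _) (clamp_mono hrs)

lemma isClassicalSolution_extend {α lam : ℝ} {u : Plane → ℝ} :
    IsClassicalSolution (extendNonneg f) (extendUnit φ) (extendUnit ψ) α lam u ↔
      IsClassicalSolution f φ ψ α lam u := by
  have hmem : ∀ x ∈ Metric.ball (0 : Plane) 1, ‖x‖ ∈ Icc (0 : ℝ) 1 := fun x hx =>
    norm_mem_Icc (Metric.ball_subset_closedBall hx)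
  constructor
  · intro h
    refine ⟨h.contDiffOn, h.continuousOn, fun x hx => ?_, h.pos, h.boundary⟩
    have := h.equation x hx
    rwa [extendUnit_of_mem (hmem x hx), extendUnit_of_mem (hmem x hx),
      extendNonneg_of_nonneg (h.pos x hx).le] at this
  · intro h
    refine ⟨h.contDiffOn, h.continuousOn, fun x hx => ?_, h.pos, h.boundary⟩
    rw [extendUnit_of_mem (hmem x hx), extendUnit_of_mem (hmem x hx),
      extendNonneg_of_nonneg (h.pos x hx).le]
    exact h.equation x hx

lemma isExtremalSolution_extend {α lam : ℝ} {u : Plane → ℝ} :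
    IsExtremalSolution (extendNonneg f) (extendUnit φ) (extendUnit ψ) α lam u ↔
      IsExtremalSolution f φ ψ α lam u := by
  have hmin : ∀ (lam : ℝ) (v : Plane → ℝ),
      IsMinimalSolution (extendNonneg f) (extendUnit φ) (extendUnit ψ) α lam v ↔
        IsMinimalSolution f φ ψ α lam v := fun lam v =>
    ⟨fun h => ⟨isClassicalSolution_extend.1 h.1,
      fun w hw => h.2 w (isClassicalSolution_extend.2 hw)⟩,
      fun h => ⟨isClassicalSolution_extend.2 h.1,
      fun w hw => h.2 w (isClassicalSolution_extend.1 hw)⟩⟩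
  simp only [IsExtremalSolution, IsExtremalParameter, isClassicalSolution_extend, hmin]

end extension

/-- The constant extension of `f` remains convex because `f` is nondecreasing. It may have a corner
at `0`, so `RadialData` asks for differentiability only on the open half-line. -/
lemma radialData_extend {f φ ψ : ℝ → ℝ}
    (hf_diff : ContDiffOn ℝ 1 f (Ici 0))
    (hf_convex : ConvexOn ℝ (Ici 0) f)
    (hf_mono : MonotoneOn f (Ici 0))
    (hf_pos : ∀ s ∈ Ici (0 : ℝ), 0 < f s)
    (hf_int : IntegrableOn (fun s => 1 / f s) (Ioi 0))
    (hφ_cont : ContinuousOn φ (Icc 0 1))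
    (hφ_anti : AntitoneOn φ (Icc 0 1))
    (hφ_nonneg : ∀ r ∈ Icc (0 : ℝ) 1, 0 ≤ φ r)
    (hφ_pos : ∀ r ∈ Ico (0 : ℝ) 1, 0 < φ r)
    (hφ_zero : φ 0 = 1)
    (hψ_cont : ContinuousOn ψ (Icc 0 1))
    (hψ_anti : AntitoneOn ψ (Icc 0 1))
    (hψ_nonneg : ∀ r ∈ Icc (0 : ℝ) 1, 0 ≤ ψ r)
    (hψ_zero : ψ 0 = 1)
    (hM : IntegrableOn (maxRatio φ ψ) (Ioo 0 1)) :
    RadialData (extendNonneg f) (extendUnit φ) (extendUnit ψ) where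
  φ_cont := continuous_extendUnit hφ_cont
  φ_anti := antitone_extendUnit hφ_anti
  φ_nonneg r := hφ_nonneg _ (clamp_mem r)
  φ_pos r hr := hφ_pos _ ⟨(clamp_mem r).1, max_lt one_pos ((min_le_left _ _).trans_lt hr)⟩
  φ_zero := by rw [extendUnit_of_mem ⟨le_rfl, zero_le_one⟩, hφ_zero]
  ψ_cont := continuous_extendUnit hψ_cont
  ψ_anti := antitone_extendUnit hψ_anti
  ψ_nonneg r := hψ_nonneg _ (clamp_mem r)
  ψ_zero := by rw [extendUnit_of_mem ⟨le_rfl, zero_le_one⟩, hψ_zero]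
  f_cont := hf_diff.continuousOn.comp_continuous (continuous_id.max continuous_const)
    fun s => mem_Ici.2 (le_max_right _ _)
  f_mono s t hst := hf_mono (le_max_right s 0) (le_max_right t 0) (max_le_max hst le_rfl)
  f_pos s := hf_pos _ (le_max_right s 0)
  f_convex := by
    refine ⟨convex_univ, fun x _ y _ a b ha hb hab => ?_⟩
    have h1 : max (a • x + b • y) 0 ≤ a • max x 0 + b • max y 0 := by
      simp only [smul_eq_mul]
      refine max_le ?_ (by positivity)
      have := mul_le_mul_of_nonneg_left (le_max_left x 0) ha
      have := mul_le_mul_of_nonneg_left (le_max_left y 0) hb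
      linarith
    exact (hf_mono (mem_Ici.2 (le_max_right _ 0)) (mem_Ici.2 ((le_max_right _ 0).trans h1)) h1).trans
      (hf_convex.2 (le_max_right x 0) (le_max_right y 0) ha hb hab)
  f_diff := (hf_diff.mono Ioi_subset_Ici_self).congr fun s hs =>
    extendNonneg_of_nonneg (mem_Ioi.1 hs).le
  f_int := hf_int.congr_fun (fun s hs => by
    simp only [extendNonneg_of_nonneg (mem_Ioi.1 hs).le]) measurableSet_Ioi
  M_int := hM.congr_fun (fun s hs => (maxRatio_extendUnit hs.2.le).symm) measurableSet_Ioo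

/-- The large drift asymptotics of the extremal solutions, for data extended to the real line. -/
lemma RadialData.extremal_asymptotics {f φ ψ : ℝ → ℝ} (D : RadialData f φ ψ) {lamStar : ℝ → ℝ}
    {uStar : ℝ → Plane → ℝ}
    (h : ∀ α : ℝ, 0 < α → IsExtremalSolution f φ ψ α (lamStar α) (uStar α)) :
    (∀ α : ℝ, 0 < α → IsClassicalSolution f φ ψ α (lamStar α) (uStar α)) ∧
      (∀ x ∈ Metric.ball (0 : Plane) 1, x ≠ 0 →
        Tendsto (fun α => uStar α x) atTop (𝓝 0)) ∧
      Tendsto (fun α => uStar α 0) atTop atTop ∧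
      Tendsto (fun α => ∫ x in Metric.ball (0 : Plane) 1, uStar α x) atTop (𝓝 0) ∧
      Tendsto (fun α => ∫ x in Metric.ball (0 : Plane) 1, ψ ‖x‖ * f (uStar α x)) atTop
        (𝓝 (f 0 * ∫ x in Metric.ball (0 : Plane) 1, ψ ‖x‖)) := by
  have hex : ∀ α : ℝ, ∃ u : ℝ → ℝ, 0 < α → 0 < lamStar α ∧
      IsRadialSolution f φ ψ α (lamStar α) u ∧
        ∀ x ∈ Metric.closedBall (0 : Plane) 1, uStar α x = u ‖x‖ := by
    intro α
    by_cases hα : 0 < α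
    · obtain ⟨h1, u, h2, h3⟩ := (h α hα).exists_profile D hα.le
      exact ⟨u, fun _ => ⟨h1, h2, h3⟩⟩
    · exact ⟨0, fun h => absurd h hα⟩
  choose U hU using hex
  have hF : IsExtremalFamily f φ ψ lamStar U :=
    ⟨fun α hα => (hU α hα).1, fun α hα => (h α hα).1, fun α hα => (hU α hα).2.1⟩
  have heq : ∀ α > 0, ∀ x ∈ Metric.closedBall (0 : Plane) 1, uStar α x = U α ‖x‖ :=
    fun α hα => (hU α hα).2.2
  have heqb : ∀ α > 0, ∀ x ∈ Metric.ball (0 : Plane) 1, uStar α x = U α ‖x‖ :=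
    fun α hα x hx => heq α hα x (Metric.ball_subset_closedBall hx)
  refine ⟨fun α hα => ?_, fun x hx hx0 => ?_, ?_, ?_, ?_⟩
  · exact ((hF.isRadialSolution α hα).isClassicalSolution D hα.le (hF.pos α hα)).congr (heq α hα)
  · refine (hF.tendsto_apply D (r := ‖x‖) ⟨norm_pos_iff.2 hx0, by simpa using hx⟩).congr' ?_
    filter_upwards [eventually_gt_atTop 0] with α hα using (heqb α hα x hx).symm
  · refine (hF.tendsto_apply_zero D).congr' ?_
    filter_upwards [eventually_gt_atTop 0] with α hα
    rw [heqb α hα 0 (by simp), norm_zero]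
  · obtain ⟨S, hS⟩ := eventually_atTop.1 (D.superlinear (C := 1) zero_le_one)
    have hf0 := D.f_pos 0
    -- Superlinearity covers `s ≥ S`; below `S` the positive lower bound `f 0` suffices.
    have hlin : ∀ s, 0 ≤ s → s ≤ (1 + |S| / f 0) * f s := by
      intro s hs
      have h1 : f 0 ≤ f s := D.f_mono hs
      have h2 : |S| ≤ |S| / f 0 * f s := by
        calc |S| = |S| / f 0 * f 0 := by field_simp
          _ ≤ _ := by gcongr
      have h4 : 0 ≤ f s := (D.f_pos s).le
      rcases le_total S s with h3 | h3
      · have := hS s h3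
        have := abs_nonneg S
        linarith
      · have := le_abs_self S
        linarith
    have h1 := (hF.tendsto_integral_comp D (G := fun s => s) continuous_id monotone_id rfl
      hlin).const_mul (2 * volume.real (Metric.ball (0 : Plane) 1))
    rw [mul_zero] at h1
    refine h1.congr' ?_
    filter_upwards [eventually_gt_atTop 0] with α hα
    rw [setIntegral_congr_fun Metric.isOpen_ball.measurableSet (heqb α hα)]
    exact (integral_ball_norm _).symm
  · set V := 2 * volume.real (Metric.ball (0 : Plane) 1) with hV
    -- Subtracting `f 0` gives a function vanishing at `0`, as the general convergence lemma
    -- requires; $0\le\psi\le1$ then permits inserting the weight.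
    have h1 : Tendsto (fun α => ∫ s in (0 : ℝ)..1, s * (f (U α s) - f 0)) atTop (𝓝 0) :=
      hF.tendsto_integral_comp D (G := fun s => f s - f 0) (c := 1)
        (D.f_cont.sub continuous_const) (fun s t hst => sub_le_sub_right (D.f_mono hst) _)
        (sub_self _) fun s _ => by have := D.f_pos 0; linarith
    have h2 : Tendsto (fun α => ∫ s in (0 : ℝ)..1, s * (ψ s * (f (U α s) - f 0))) atTop
        (𝓝 0) := by
      refine tendsto_of_tendsto_of_tendsto_of_le_of_le' tendsto_const_nhds h1 ?_ ?_
      · filter_upwards [eventually_gt_atTop 0] with α hα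
        refine intervalIntegral.integral_nonneg zero_le_one fun s hs => ?_
        have h3 := D.f_mono ((hF.isRadialSolution α hα).nonneg D (hF.pos α hα).le s)
        exact mul_nonneg hs.1 (mul_nonneg (D.ψ_nonneg s) (sub_nonneg.2 h3))
      · filter_upwards [eventually_gt_atTop 0] with α hα
        have hc : Continuous fun s => f (U α s) - f 0 :=
          (D.f_cont.comp (hF.isRadialSolution α hα).cont).sub continuous_const
        refine intervalIntegral.integral_mono_on zero_le_one
          ((continuous_id.mul (D.ψ_cont.mul hc)).intervalIntegrable _ _)
          ((continuous_id.mul hc).intervalIntegrable _ _) fun s hs => ?_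
        have h3 := D.f_mono ((hF.isRadialSolution α hα).nonneg D (hF.pos α hα).le s)
        exact mul_le_mul_of_nonneg_left
          (mul_le_of_le_one_left (sub_nonneg.2 h3) (D.ψ_le_one hs.1)) hs.1
    have h3 := (h2.const_mul V).add_const (f 0 * ∫ x in Metric.ball (0 : Plane) 1, ψ ‖x‖)
    rw [mul_zero, zero_add] at h3
    refine h3.congr' ?_
    filter_upwards [eventually_gt_atTop 0] with α hα
    have hfU : Continuous fun s => f (U α s) := D.f_cont.comp (hF.isRadialSolution α hα).cont
    have h4 : ∫ x in Metric.ball (0 : Plane) 1, ψ ‖x‖ * f (uStar α x) =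
        ∫ x in Metric.ball (0 : Plane) 1, (fun s => ψ s * f (U α s)) ‖x‖ :=
      setIntegral_congr_fun Metric.isOpen_ball.measurableSet fun x hx => by
        simp only [heqb α hα x hx]
    have h5 : ∫ s in (0 : ℝ)..1, s * (ψ s * (f (U α s) - f 0)) =
        (∫ s in (0 : ℝ)..1, s * (ψ s * f (U α s))) - f 0 * ∫ s in (0 : ℝ)..1, s * ψ s := by
      rw [← intervalIntegral.integral_const_mul, ← intervalIntegral.integral_sub
        (f := fun s => s * (ψ s * f (U α s))) (g := fun s => f 0 * (s * ψ s))
        ((continuous_id.mul (D.ψ_cont.mul hfU)).intervalIntegrable _ _)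
        (((continuous_id.mul D.ψ_cont).const_mul (f 0)).intervalIntegrable _ _)]
      refine intervalIntegral.integral_congr fun s _ => ?_
      ring
    rw [h4, integral_ball_norm ψ, integral_ball_norm fun s => ψ s * f (U α s), ← hV, h5]
    ring

theorem theorem1p2 (f φ ψ : ℝ → ℝ)
    (hf_diff : ContDiffOn ℝ 1 f (Ici 0))
    (hf_convex : ConvexOn ℝ (Ici 0) f)
    (hf_mono : MonotoneOn f (Ici 0))
    (hf_pos : ∀ s ∈ Ici (0 : ℝ), 0 < f s)
    (hf_int : IntegrableOn (fun s => 1 / f s) (Ioi 0))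
    (hφ_lip : ∃ C, LipschitzOnWith C φ (Icc 0 1))
    (hφ_anti : AntitoneOn φ (Icc 0 1))
    (hφ_nonneg : ∀ r ∈ Icc (0 : ℝ) 1, 0 ≤ φ r)
    (hφ_pos : ∀ r ∈ Ico (0 : ℝ) 1, 0 < φ r)
    (hφ_zero : φ 0 = 1)
    (hψ_lip : ∃ C, LipschitzOnWith C ψ (Icc 0 1))
    (hψ_anti : AntitoneOn ψ (Icc 0 1))
    (hψ_nonneg : ∀ r ∈ Icc (0 : ℝ) 1, 0 ≤ ψ r)
    (hψ_zero : ψ 0 = 1)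
    (hM : IntegrableOn (maxRatio φ ψ) (Ioo 0 1)) :
    (∀ α : ℝ, 0 < α → ∃ (L : ℝ) (w : Plane → ℝ), IsExtremalSolution f φ ψ α L w) ∧
    ∀ (lamStar : ℝ → ℝ) (uStar : ℝ → Plane → ℝ),
      (∀ α : ℝ, 0 < α → IsExtremalSolution f φ ψ α (lamStar α) (uStar α)) →
      (∀ α : ℝ, 0 < α → IsClassicalSolution f φ ψ α (lamStar α) (uStar α)) ∧
      (∀ x ∈ Metric.ball (0 : Plane) 1, x ≠ 0 →
        Tendsto (fun α => uStar α x) atTop (𝓝 0)) ∧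
      Tendsto (fun α => uStar α 0) atTop atTop ∧
      Tendsto (fun α => ∫ x in Metric.ball (0 : Plane) 1, uStar α x) atTop (𝓝 0) ∧
      Tendsto (fun α => ∫ x in Metric.ball (0 : Plane) 1, ψ ‖x‖ * f (uStar α x)) atTop
        (𝓝 (f 0 * ∫ x in Metric.ball (0 : Plane) 1, ψ ‖x‖)) := by
  obtain ⟨Cφ, hφ_lip⟩ := hφ_lip
  obtain ⟨Cψ, hψ_lip⟩ := hψ_lip
  have D := radialData_extend hf_diff hf_convex hf_mono hf_pos hf_int hφ_lip.continuousOn hφ_anti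
    hφ_nonneg hφ_pos hφ_zero hψ_lip.continuousOn hψ_anti hψ_nonneg hψ_zero hM
  refine ⟨fun α hα => ?_, fun lamStar uStar h => ?_⟩
  · obtain ⟨L, w, hw⟩ := D.exists_isExtremalSolution hα.le
    exact ⟨L, w, isExtremalSolution_extend.1 hw⟩
  · obtain ⟨h1, h2, h3, h4, h5⟩ :=
      D.extremal_asymptotics fun α hα => isExtremalSolution_extend.2 (h α hα)
    refine ⟨fun α hα => isClassicalSolution_extend.1 (h1 α hα), h2, h3, h4, ?_⟩
    have hψ : ∀ x ∈ Metric.ball (0 : Plane) 1, extendUnit ψ ‖x‖ = ψ ‖x‖ := fun x hx =>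
      extendUnit_of_mem (norm_mem_Icc (Metric.ball_subset_closedBall hx))
    rw [extendNonneg_of_nonneg le_rfl,
      setIntegral_congr_fun Metric.isOpen_ball.measurableSet hψ] at h5
    refine h5.congr' ?_
    filter_upwards [eventually_gt_atTop 0] with α hα
    refine setIntegral_congr_fun Metric.isOpen_ball.measurableSet fun x hx => ?_
    simp only [hψ x hx, extendNonneg_of_nonneg ((h1 α hα).pos x hx).le]
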